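/- **Definitions.** Let $T_xf(t)=f(t-x)$, $M_\xi f(t)=e^{2\pi i t\cdot\xi}f(t)$ and $\mathcal Ff(\xi)=\int_{\mathbb R^d} e^{-2\pi i x\cdot\xi}f(x)\,dx$, extended to $\mathcal S'(\mathbb R^d)$ by duality. A *TMIB space* on $\mathbb R^d$ is a Banach space $E$ with $\mathcal S(\mathbb R^d)\subseteq E\subseteq\mathcal S'(\mathbb R^d)$, both inclusions continuous and dense, such that $T_x(E)\subseteq E$ and $M_\xi(E)\subseteq E$ for all $x,\xi\in\mathbb R^d$, and for which there are $\tau,C>0$ with $\omega_E(x):=\|T_x\|_{\mathcal L(E)}\le C(1+|x|)^\tau$ and $\nu_E(\xi):=\|M_{-\xi}\|_{\mathcal L(E)}\le C(1+|\xi|)^\tau$ for all $x,\xi\in\mathbb R^d$. Put $\mathcal FE=\{\mathcal Ff: f\in E\}$ with $\|\mathcal Ff\|_{\mathcal FE}=\|f\|_E$. A *polynomially bounded weight* is a measurable $\eta:\mathbb R^d\to(0,\infty)$ for which there are $C,\tau>0$ with $\eta(x+y)\le C\eta(x)(1+|y|)^\tau$ for all $x,y\in\mathbb R^d$. Then $\|h\|_{L^p_\eta}=\|h\eta\|_{L^p}$,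 and $L^\infty_{\eta,0}$ is the subspace of those $h\in L^\infty_\eta$ such that for every $\varepsilon>0$ there is a compact $K\subseteq\mathbb R^d$ with $\|h\eta\|_{L^\infty(\mathbb R^d\setminus K)}\le\varepsilon$. Fix $\phi\in\mathcal D(\mathbb R^d)$ with $0\le\phi\le1$, $\operatorname{supp}\phi\subseteq(-1,1)^d$ and $\sum_{k\in\mathbb Z^d}T_k\phi=1$. For a TMIB space $E$ let $E_{\mathrm{loc}}=\{f\in\mathcal D'(\mathbb R^d):\chi f\in E\ \text{for all }\chi\in\mathcal D(\mathbb R^d)\}$. The *amalgam space* $W(E,L^p_\eta)$, $1\le p\le\infty$ (respectively $W(E,L^\infty_{\eta,0})$), consists of all $f\in E_{\mathrm{loc}}$ for which the function $\sum_{k\in\mathbb Z^d}\|f\,T_k\phi\|_E\,\mathbf 1_{k+[-1,1]^d}$ belongs to $L^p_\eta$ (respectively $L^\infty_{\eta,0}$), and it is normed by the $L^p_\eta$-norm (respectively the $L^\infty_\eta$-norm) of that function. For $p<\infty$, these spaces and $W(E,L^\infty_{\eta,0})$ are contained in $\mathcal S'(\mathbb R^d)$ and are TMIB spaces. For TMIB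 spaces $A,B$ on $\mathbb R^d$, $A\hat\otimes_\varepsilon B$ is the completion of $A\otimes B$ for the norm $\|z\|=\sup\{|(a'\otimes b')(z)|:\|a'\|_{A'}\le1,\ \|b'\|_{B'}\le1\}$, regarded in the canonical way as a subspace of $\mathcal S'(\mathbb R^{2d})$. Fix $g\in\mathcal S(\mathbb R^d)\setminus\{0\}$. For $f\in\mathcal S'(\mathbb R^d)$ let $V_gf(x,\xi)=\langle f,\overline{M_\xi T_xg}\rangle$, and for a Banach space $X\subseteq\mathcal S'(\mathbb R^{2d})$ let the *modulation space* associated to $X$ be $\mathcal M[X]=\{f\in\mathcal S'(\mathbb R^d):V_gf\in X\}$ with norm $\|f\|_{\mathcal M[X]}=\|V_gf\|_X$. **Theorem.** Let $E$ and $F$ be TMIB spaces on $\mathbb R^d$ and let $\eta_1,\eta_2$ be polynomially bounded weights on $\mathbb R^d$. Assume that $\omega_F(x)=1$ for all $x\in\mathbb R^d$. Then $W(E,L^\infty_{\eta_1\eta_2,0})$ is equal to all of the following spaces, with equivalent norms: 1. $\mathcal M[W(F,L^{p_1}_{\eta_1})\hat\otimes_\varepsilon\mathcal FW(E,L^{p_2}_{\eta_2})]$,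 where $p_1,p_2\in(1,\infty)$ and $p_1^{-1}+p_2^{-1}\le1$; 2. $\mathcal M[W(F,L^\infty_{\eta_1,0})\hat\otimes_\varepsilon\mathcal FW(E,L^{p_2}_{\eta_2})]$, where $p_2\in[1,\infty)$; 3. $\mathcal M[W(F,L^{p_1}_{\eta_1})\hat\otimes_\varepsilon\mathcal FW(E,L^\infty_{\eta_2,0})]$, where $p_1\in[1,\infty)$; 4. $\mathcal M[W(F,L^\infty_{\eta_1,0})\hat\otimes_\varepsilon\mathcal FW(E,L^\infty_{\eta_2,0})]$. -/

import Mathlib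

set_option maxSynthPendingDepth 3

open MeasureTheory TopologicalSpace
open scoped ENNReal NNReal SchwartzMap Distributions FourierTransform

namespace TMIB

noncomputable section

/-- The Euclidean space `ℝ^d`. -/
abbrev Rd (d : ℕ) : Type := EuclideanSpace ℝ (Fin d)

/-- Real-valued test functions on `ℝ^d`. -/
abbrev Test (d : ℕ) : Type := 𝓓((⊤ : Opens (Rd d)), ℝ)

/-- Complex-valued distributions on `ℝ^d`. (Mathlib evaluates distributions on real-valued test
functions; the value on a complex-valued test function is recovered by `ℂ`-linearity.) -/
abbrev Dist (d : ℕ) : Type := 𝓓'((⊤ : Opens (Rd d)), ℂ)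

/-! ### Test functions, distributions and tempered distributions -/

/-- The translate `T_a χ = χ(· - a)` of a test function. -/
def testTranslate {d : ℕ} (a : Rd d) (χ : Test d) : Test d where
  toFun x := χ (x - a)
  contDiff' := χ.contDiff.comp (contDiff_id.sub contDiff_const)
  hasCompactSupport' := χ.hasCompactSupport.comp_homeomorph (Homeomorph.subRight a)
  tsupport_subset' := fun _ _ => Set.mem_univ _

/-- The pointwise product of two test functions. -/
def testMul {d : ℕ} (χ ψ : Test d) : Test d where
  toFun x := χ x * ψ x
  contDiff' := χ.contDiff.mul ψ.contDiff
  hasCompactSupport' := χ.hasCompactSupport.mul_right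
  tsupport_subset' := fun _ _ => Set.mem_univ _

/-- A test function, regarded as a (complex-valued) Schwartz function. -/
def testToSchwartz {d : ℕ} (ψ : Test d) : 𝓢(Rd d, ℂ) :=
  HasCompactSupport.toSchwartzMap (f := fun x => (ψ x : ℂ))
    (ψ.hasCompactSupport.comp_left (g := fun r : ℝ => (r : ℂ)) Complex.ofReal_zero)
    (Complex.ofRealCLM.contDiff.comp ψ.contDiff)

theorem testToSchwartz_apply {d : ℕ} (ψ : Test d) (x : Rd d) :
    testToSchwartz ψ x = (ψ x : ℂ) := rfl

/-- The continuous inclusion of the test functions into the Schwartz functions. -/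
def testToSchwartzCLM {d : ℕ} : Test d →L[ℝ] 𝓢(Rd d, ℂ) :=
  TestFunction.mkCLM ℝ testToSchwartz
    (fun f g => by ext x; simp [testToSchwartz_apply])
    (fun c f => by ext x; simp [testToSchwartz_apply])
    (by
      intro K hK
      let L : 𝓓^{⊤}_{K}(Rd d, ℝ) →ₗ[ℝ] 𝓢(Rd d, ℂ) :=
        { toFun := testToSchwartz ∘ TestFunction.ofSupportedIn hK
          map_add' := fun f g => by ext x; simp [testToSchwartz_apply]
          map_smul' := fun c f => by ext x; simp [testToSchwartz_apply] }
      change Continuous L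
      refine WithSeminorms.continuous_of_isBounded (ContDiffMapSupportedIn.withSeminorms ℝ _ _ _ _)
        (schwartz_withSeminorms ℝ (Rd d) ℂ) L (.of_real fun i => ?_)
      obtain ⟨k, n⟩ := i
      obtain ⟨R, hR⟩ := K.isCompact.isBounded.exists_norm_le
      refine ⟨{n}, |R| ^ k, fun f => ?_⟩
      rw [Finset.sup_singleton]
      refine SchwartzMap.seminorm_le_bound ℝ k n _ (by positivity) fun x => ?_
      have h1 : ‖iteratedFDeriv ℝ n (L f) x‖ ≤ ‖iteratedFDeriv ℝ n f x‖ := by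
        have h2 : (L f : Rd d → ℂ) = Complex.ofRealLI ∘ (f : Rd d → ℝ) := rfl
        rw [h2, Complex.ofRealLI.norm_iteratedFDeriv_comp_left (n := ((⊤ : ℕ∞) : WithTop ℕ∞))
          f.contDiff.contDiffAt (mod_cast le_top)]
      by_cases hx : x ∈ K
      · exact mul_le_mul (pow_le_pow_left₀ (norm_nonneg _) ((hR x hx).trans (le_abs_self R)) k)
          (h1.trans (ContDiffMapSupportedIn.norm_iteratedFDeriv_apply_le_seminorm_top ℝ))
          (norm_nonneg _) (by positivity)
      · have h3 : ‖iteratedFDeriv ℝ n f x‖ = 0 := by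
          rw [f.iteratedFDeriv_zero_on_compl hx]; simp
        have h4 : ‖iteratedFDeriv ℝ n (L f) x‖ = 0 := le_antisymm (h1.trans h3.le) (norm_nonneg _)
        rw [h4, mul_zero]
        positivity)

/-- The restriction of a tempered distribution to the test functions; this is the inclusion of
the tempered distributions into the distributions. -/
def restr {d : ℕ} (f : 𝓢'(Rd d, ℂ)) : Dist d where
  toFun ψ := f (testToSchwartz ψ)
  map_add' ψ₁ ψ₂ := by
    rw [← map_add]; congr 1; ext x; simp [testToSchwartz_apply]
  map_smul' c ψ := by
    have : testToSchwartz (c • ψ) = (c : ℂ) • testToSchwartz ψ := by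
      ext x; simp [testToSchwartz_apply]
    rw [this, map_smul]; simp
  cont := (map_continuous f).comp testToSchwartzCLM.continuous

/-- Translation `T_a f (t) = f (t - a)` on tempered distributions. -/
def translate {d : ℕ} (a : Rd d) : 𝓢'(Rd d, ℂ) →L[ℂ] 𝓢'(Rd d, ℂ) :=
  PointwiseConvergenceCLM.precomp ℂ (SchwartzMap.compSubConstCLM ℂ (-a))

/-- The character `t ↦ exp (2 π i t·ξ)`. -/
def character {d : ℕ} (ξ : Rd d) (t : Rd d) : ℂ :=
  Complex.exp (2 * Real.pi * Complex.I * (inner ℝ t ξ : ℝ))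

/-- Characters have temperate growth, so multiplication by them is the genuine one. -/
theorem character_hasTemperateGrowth {d : ℕ} (ξ : Rd d) :
    Function.HasTemperateGrowth (character ξ) := by
  have h : ∀ (c : ℂ) (n : ℕ), iteratedDeriv n (fun s : ℝ => Complex.exp (c * s)) =
      fun s : ℝ => c ^ n * Complex.exp (c * s) := by
    intro c n
    induction n with
    | zero => simp
    | succ n ih =>
      rw [iteratedDeriv_succ, ih]
      funext s
      have h1 : HasDerivAt (fun s : ℝ => c * (s : ℂ)) (c * 1) s :=
        (Complex.ofRealCLM.hasDerivAt (x := s)).const_mul c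
      rw [(h1.cexp.const_mul (c ^ n)).deriv]
      ring
  have h2 : Function.HasTemperateGrowth
      (fun s : ℝ => Complex.exp (2 * Real.pi * Complex.I * s)) := by
    refine ⟨(contDiff_const.mul Complex.ofRealCLM.contDiff).cexp, fun n =>
      ⟨0, ‖(2 * Real.pi * Complex.I : ℂ) ^ n‖, fun s => ?_⟩⟩
    rw [norm_iteratedFDeriv_eq_norm_iteratedDeriv, h, norm_mul]
    have h3 : (2 * Real.pi * Complex.I * s : ℂ) = ((2 * Real.pi * s : ℝ) : ℂ) * Complex.I := by
      push_cast; ring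
    rw [h3, Complex.norm_exp_ofReal_mul_I]
    simp
  exact h2.comp (Function.hasTemperateGrowth_inner_left ξ)

/-- Modulation `M_ξ f (t) = exp (2 π i t·ξ) f (t)` on tempered distributions. -/
def modulate {d : ℕ} (ξ : Rd d) : 𝓢'(Rd d, ℂ) →L[ℂ] 𝓢'(Rd d, ℂ) :=
  TemperedDistribution.smulLeftCLM ℂ (character ξ)

/-! ### Normed spaces of tempered distributions -/

/-- A linear space of tempered distributions with a (semi)norm, encoded by the extended seminorm
on all tempered distributions that is `∞` exactly off the space. -/
structure DistSpace (d : ℕ) where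
  /-- The extended seminorm. -/
  eNorm : 𝓢'(Rd d, ℂ) → ℝ≥0∞
  /-- The triangle inequality. -/
  add_le : ∀ f g, eNorm (f + g) ≤ eNorm f + eNorm g
  /-- Homogeneity. -/
  smul_eq : ∀ (c : ℂ) (f), eNorm (c • f) = ‖c‖ₑ * eNorm f

namespace DistSpace

/-- The elements of the space, as a linear subspace of the tempered distributions. -/
def space {d : ℕ} (E : DistSpace d) : Submodule ℂ 𝓢'(Rd d, ℂ) where
  carrier := {f | E.eNorm f < ∞}
  add_mem' hf hg := (E.add_le _ _).trans_lt (ENNReal.add_lt_top.2 ⟨hf, hg⟩)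
  zero_mem' := by
    have h := E.smul_eq 0 0
    rw [show (0 : ℂ) • (0 : 𝓢'(Rd d, ℂ)) = 0 from zero_smul ℂ (0 : 𝓢'(Rd d, ℂ)), enorm_zero, zero_mul] at h
    change E.eNorm 0 < ∞
    rw [h]
    exact ENNReal.zero_lt_top
  smul_mem' c f hf := by
    have hf : E.eNorm f < ∞ := hf
    change E.eNorm (c • f) < ∞
    rw [E.smul_eq]
    exact ENNReal.mul_lt_top (by simp) hf

theorem eNorm_ne_top {d : ℕ} (E : DistSpace d) (f : E.space) : E.eNorm (f : 𝓢'(Rd d, ℂ)) ≠ ∞ :=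
  (show E.eNorm (f : 𝓢'(Rd d, ℂ)) < ∞ from f.2).ne

/-- The norm of the space. -/
def seminorm {d : ℕ} (E : DistSpace d) : Seminorm ℂ E.space :=
  Seminorm.of (fun f => (E.eNorm (f : 𝓢'(Rd d, ℂ))).toReal)
    (fun f g => by
      rw [← ENNReal.toReal_add (E.eNorm_ne_top f) (E.eNorm_ne_top g)]
      exact ENNReal.toReal_mono
        (ENNReal.add_ne_top.2 ⟨E.eNorm_ne_top f, E.eNorm_ne_top g⟩) (E.add_le _ _))
    (fun c f => by
      have h : E.eNorm ((c • f : E.space) : 𝓢'(Rd d, ℂ)) =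
        ‖c‖ₑ * E.eNorm (f : 𝓢'(Rd d, ℂ)) := E.smul_eq c f
      rw [h, ENNReal.toReal_mul, toReal_enorm])

/-- The space as a type of its own. It carries the topology of its norm (and not the one induced
by the tempered distributions). -/
def Carrier {d : ℕ} (E : DistSpace d) : Type := E.space

instance {d : ℕ} (E : DistSpace d) : SeminormedAddCommGroup E.Carrier :=
  AddGroupSeminorm.toSeminormedAddCommGroup (E := E.space) E.seminorm.toAddGroupSeminorm

instance {d : ℕ} (E : DistSpace d) : NormedSpace ℂ E.Carrier where
  toModule := inferInstanceAs (Module ℂ E.space)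
  norm_smul_le c f := (map_smul_eq_mul E.seminorm c f).le

/-- The inclusion of the space into the tempered distributions. -/
def incl {d : ℕ} (E : DistSpace d) : E.Carrier →ₗ[ℂ] 𝓢'(Rd d, ℂ) := E.space.subtype

theorem norm_def {d : ℕ} (E : DistSpace d) (f : E.Carrier) :
    ‖f‖ = (E.eNorm (E.incl f)).toReal := rfl

/-- The operator norm on the space `E` of an operator on tempered distributions; it is `∞` when
the operator does not restrict to a bounded operator on `E`. -/
def opENorm {d : ℕ} (E : DistSpace d) (T : 𝓢'(Rd d, ℂ) →L[ℂ] 𝓢'(Rd d, ℂ)) : ℝ≥0∞ :=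
  ⨆ (f : 𝓢'(Rd d, ℂ)) (_ : E.eNorm f ≤ 1), E.eNorm (T f)

/-- `ω_E (x)` is the operator norm of `T_x` on `E`. -/
def omega {d : ℕ} (E : DistSpace d) (x : Rd d) : ℝ≥0∞ := E.opENorm (translate x)

/-- `ν_E (ξ)` is the operator norm of `M_{-ξ}` on `E`. -/
def nu {d : ℕ} (E : DistSpace d) (ξ : Rd d) : ℝ≥0∞ := E.opENorm (modulate (-ξ))

/-- `E` is a translation-modulation invariant Banach space of distributions. -/
structure IsTMIB {d : ℕ} (E : DistSpace d) : Prop where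
  /-- The extended seminorm of `E` is a norm ... -/
  eq_zero : ∀ f, E.eNorm f = 0 → f = 0
  /-- ... for which `E` is complete. -/
  complete : CompleteSpace E.Carrier
  /-- The Schwartz functions belong to `E`, ... -/
  schwartz_mem : ∀ ψ : 𝓢(Rd d, ℂ), SchwartzMap.toTemperedDistributionCLM (Rd d) ℂ volume ψ ∈ E.space
  /-- ... their inclusion is continuous ... -/
  schwartz_continuous : Continuous fun ψ : 𝓢(Rd d, ℂ) => (⟨_, schwartz_mem ψ⟩ : E.Carrier)
  /-- ... and has dense range. -/
  schwartz_dense : DenseRange fun ψ : 𝓢(Rd d, ℂ) => (⟨_, schwartz_mem ψ⟩ : E.Carrier)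
  /-- The inclusion of `E` into the tempered distributions is continuous ... -/
  incl_continuous : Continuous E.incl
  /-- ... and has dense range. -/
  incl_dense : DenseRange E.incl
  /-- `E` is invariant under translations ... -/
  translate_mem : ∀ x, ∀ f ∈ E.space, translate x f ∈ E.space
  /-- ... and modulations, ... -/
  modulate_mem : ∀ ξ, ∀ f ∈ E.space, modulate ξ f ∈ E.space
  /-- ... which have polynomially bounded operator norms. -/
  growth : ∃ τ > (0 : ℝ), ∃ C > (0 : ℝ), ∀ x : Rd d,
    E.omega x ≤ ENNReal.ofReal (C * (1 + ‖x‖) ^ τ) ∧ E.nu x ≤ ENNReal.ofReal (C * (1 + ‖x‖) ^ τ)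

/-- The Fourier image `𝓕 E = {𝓕 f : f ∈ E}`, with `‖𝓕 f‖ = ‖f‖`. -/
def fourier {d : ℕ} (E : DistSpace d) : DistSpace d where
  eNorm f := E.eNorm (𝓕⁻ f)
  add_le f g := by rw [FourierTransform.fourierInv_add]; exact E.add_le _ _
  smul_eq c f := by rw [FourierTransform.fourierInv_smul]; exact E.smul_eq _ _

end DistSpace

/-! ### Weights and the global components -/

/-- Polynomially bounded weights on `ℝ^d`. -/
structure IsPolyWeight {d : ℕ} (η : Rd d → ℝ) : Prop where
  pos : ∀ x, 0 < η x
  measurable : Measurable η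
  moderate : ∃ C > (0 : ℝ), ∃ τ > (0 : ℝ), ∀ x y, η (x + y) ≤ C * η x * (1 + ‖y‖) ^ τ

/-- The norm of the weighted Lebesgue space `L^p_η`, for functions with values in `[0, ∞]`. -/
def lpENorm {d : ℕ} (η : Rd d → ℝ) (p : ℝ≥0∞) (h : Rd d → ℝ≥0∞) : ℝ≥0∞ :=
  eLpNorm (fun x => h x * ENNReal.ofReal (η x)) p volume

/-- The condition in `L^∞_{η,0}`: the weighted essential supremum off a compact set gets
arbitrarily small. -/
def VanishesAtInfinity {d : ℕ} (η : Rd d → ℝ) (h : Rd d → ℝ≥0∞) : Prop :=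
  ∀ ε : ℝ≥0∞, 0 < ε → ∃ K : Set (Rd d), IsCompact K ∧
    eLpNorm (fun x => h x * ENNReal.ofReal (η x)) ∞ (volume.restrict Kᶜ) ≤ ε

/-- The norm of `L^∞_{η,0}`, with value `∞` off this space. -/
def linftyZeroENorm {d : ℕ} (η : Rd d → ℝ) (h : Rd d → ℝ≥0∞) : ℝ≥0∞ :=
  ⨅ _ : VanishesAtInfinity η h, lpENorm η ∞ h

/-! ### Amalgam spaces -/

/-- The tempered distribution `e` is the product `χ u` of the distribution `u` with the test
function `χ`. (There is at most one such `e`.) -/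
def IsProduct {d : ℕ} (χ : Test d) (u : Dist d) (e : 𝓢'(Rd d, ℂ)) : Prop :=
  ∀ ψ : Test d, e (testToSchwartz ψ) = u (testMul χ ψ)

/-- `‖χ u‖_E` for a distribution `u` and a test function `χ`, with value `∞` if `χ u ∉ E`. -/
def localENorm {d : ℕ} (E : DistSpace d) (χ : Test d) (u : Dist d) : ℝ≥0∞ :=
  ⨅ (e : 𝓢'(Rd d, ℂ)) (_ : IsProduct χ u e), E.eNorm e

/-- `u ∈ E_loc`: all products `χ u` with test functions belong to `E`. -/
def IsLocallyIn {d : ℕ} (E : DistSpace d) (u : Dist d) : Prop :=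
  ∀ χ : Test d, ∃ e : 𝓢'(Rd d, ℂ), IsProduct χ u e ∧ e ∈ E.space

/-- The point of `ℝ^d` with the integer coordinates `k`. -/
def latticePoint {d : ℕ} (k : Fin d → ℤ) : Rd d := WithLp.toLp 2 fun i => (k i : ℝ)

/-- The test function `φ` generates a bounded uniform partition of unity `(T_k φ)_{k ∈ ℤ^d}`:
`0 ≤ φ ≤ 1`, `supp φ ⊆ (-1, 1)^d` and `∑_k φ (x - k) = 1`. -/
structure IsPartitionGenerator {d : ℕ} (φ : Test d) : Prop where
  nonneg : ∀ x, 0 ≤ φ x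
  le_one : ∀ x, φ x ≤ 1
  tsupport_subset : tsupport φ ⊆ {x | ∀ i, |x i| < 1}
  hasSum : ∀ x, HasSum (fun k : Fin d → ℤ => φ (x - latticePoint k)) 1

/-- The cube `k + [-1, 1]^d`. -/
def cube {d : ℕ} (k : Fin d → ℤ) : Set (Rd d) := {x | ∀ i, |x i - k i| ≤ 1}

/-- The control function `∑_k ‖u T_k φ‖_E 1_{k + [-1, 1]^d}` of `u`. -/
def controlFun {d : ℕ} (E : DistSpace d) (φ : Test d) (u : Dist d) (x : Rd d) : ℝ≥0∞ :=
  ∑' k : Fin d → ℤ,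
    (cube k).indicator (fun _ => localENorm E (testTranslate (latticePoint k) φ) u) x

/-- The norm of the amalgam space `W(E, L^p_η)`, with value `∞` for distributions off this
space. -/
def amalgamENorm {d : ℕ} (E : DistSpace d) (φ : Test d) (η : Rd d → ℝ) (p : ℝ≥0∞)
    (u : Dist d) : ℝ≥0∞ :=
  ⨅ _ : IsLocallyIn E u, lpENorm η p (controlFun E φ u)

/-- The norm of the amalgam space `W(E, L^∞_{η,0})`, with value `∞` for distributions off this
space. -/
def amalgamZeroENorm {d : ℕ} (E : DistSpace d) (φ : Test d) (η : Rd d → ℝ) (u : Dist d) : ℝ≥0∞ :=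
  ⨅ _ : IsLocallyIn E u, linftyZeroENorm η (controlFun E φ u)

theorem isProduct_add {d : ℕ} {χ : Test d} {f g e₁ e₂ : 𝓢'(Rd d, ℂ)}
    (h₁ : IsProduct χ (restr f) e₁) (h₂ : IsProduct χ (restr g) e₂) :
    IsProduct χ (restr (f + g)) (e₁ + e₂) := fun ψ => by
  have e1 := h₁ ψ
  have e2 := h₂ ψ
  change e₁ (testToSchwartz ψ) + e₂ (testToSchwartz ψ) =
    f (testToSchwartz (testMul χ ψ)) + g (testToSchwartz (testMul χ ψ))
  rw [e1, e2]; rfl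

theorem isProduct_smul {d : ℕ} {χ : Test d} {f e : 𝓢'(Rd d, ℂ)} (c : ℂ)
    (h : IsProduct χ (restr f) e) : IsProduct χ (restr (c • f)) (c • e) := fun ψ => by
  have e1 := h ψ
  change c • e (testToSchwartz ψ) = c • f (testToSchwartz (testMul χ ψ))
  rw [e1]; rfl

theorem localENorm_add_le {d : ℕ} (E : DistSpace d) (χ : Test d) (f g : 𝓢'(Rd d, ℂ)) :
    localENorm E χ (restr (f + g)) ≤ localENorm E χ (restr f) + localENorm E χ (restr g) := by
  simp only [localENorm, ENNReal.iInf_add, ENNReal.add_iInf]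
  refine le_iInf₂ fun e₁ h₁ => le_iInf₂ fun e₂ h₂ => ?_
  exact (iInf₂_le (e₂ + e₁) (isProduct_add h₂ h₁)).trans (E.add_le _ _)

theorem localENorm_smul_le {d : ℕ} (E : DistSpace d) (χ : Test d) (c : ℂ) (f : 𝓢'(Rd d, ℂ)) :
    localENorm E χ (restr (c • f)) ≤ ‖c‖ₑ * localENorm E χ (restr f) := by
  by_cases hc : c = 0
  · subst hc
    have h0 : IsProduct χ (restr ((0 : ℂ) • f)) 0 := fun ψ => by
      rw [show (0 : ℂ) • f = 0 from zero_smul ℂ f]; rfl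
    have h1 := E.smul_eq 0 0
    rw [show (0 : ℂ) • (0 : 𝓢'(Rd d, ℂ)) = 0 from zero_smul ℂ (0 : 𝓢'(Rd d, ℂ)), enorm_zero, zero_mul] at h1
    exact (iInf₂_le 0 h0).trans (h1.le.trans zero_le)
  · have hc0 : ‖c‖ₑ ≠ 0 := by simpa using hc
    simp only [localENorm, ENNReal.mul_iInf_of_ne hc0 enorm_ne_top]
    exact le_iInf₂ fun e he =>
      (iInf₂_le (c • e) (isProduct_smul c he)).trans (E.smul_eq c e).le

theorem controlFun_add_le {d : ℕ} (E : DistSpace d) (φ : Test d) (f g : 𝓢'(Rd d, ℂ)) (x : Rd d) :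
    controlFun E φ (restr (f + g)) x ≤ controlFun E φ (restr f) x + controlFun E φ (restr g) x := by
  rw [controlFun, controlFun, controlFun, ← ENNReal.tsum_add]
  refine ENNReal.tsum_le_tsum fun k => ?_
  by_cases hx : x ∈ cube k
  · simpa only [Set.indicator_of_mem hx] using localENorm_add_le E _ f g
  · simp only [Set.indicator_of_notMem hx, add_zero, le_refl]

theorem controlFun_smul_le {d : ℕ} (E : DistSpace d) (φ : Test d) (c : ℂ) (f : 𝓢'(Rd d, ℂ))
    (x : Rd d) : controlFun E φ (restr (c • f)) x ≤ ‖c‖ₑ * controlFun E φ (restr f) x := by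
  rw [controlFun, controlFun, ← ENNReal.tsum_mul_left]
  refine ENNReal.tsum_le_tsum fun k => ?_
  by_cases hx : x ∈ cube k
  · simpa only [Set.indicator_of_mem hx] using localENorm_smul_le E _ c f
  · simp only [Set.indicator_of_notMem hx, mul_zero, le_refl]

theorem measurable_controlFun {d : ℕ} (E : DistSpace d) (φ : Test d) (u : Dist d) :
    Measurable (controlFun E φ u) := by
  refine Measurable.tsum fun k => measurable_const.indicator ?_
  have : cube k = ⋂ i, {x : Rd d | |x i - k i| ≤ 1} := by ext x; simp [cube]
  rw [this]
  exact MeasurableSet.iInter fun i => measurableSet_le (by fun_prop) measurable_const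

theorem IsLocallyIn.add {d : ℕ} {E : DistSpace d} {f g : 𝓢'(Rd d, ℂ)}
    (hf : IsLocallyIn E (restr f)) (hg : IsLocallyIn E (restr g)) :
    IsLocallyIn E (restr (f + g)) := fun χ => by
  obtain ⟨e₁, h₁, m₁⟩ := hf χ
  obtain ⟨e₂, h₂, m₂⟩ := hg χ
  exact ⟨e₁ + e₂, isProduct_add h₁ h₂, add_mem m₁ m₂⟩

theorem IsLocallyIn.smul {d : ℕ} {E : DistSpace d} {f : 𝓢'(Rd d, ℂ)} (c : ℂ)
    (hf : IsLocallyIn E (restr f)) : IsLocallyIn E (restr (c • f)) := fun χ => by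
  obtain ⟨e₁, h₁, m₁⟩ := hf χ
  exact ⟨c • e₁, isProduct_smul c h₁, Submodule.smul_mem _ c m₁⟩

theorem lpENorm_add_le {d : ℕ} {η : Rd d → ℝ} (hη : Measurable η) {p : ℝ≥0∞} (hp : 1 ≤ p)
    (μ : Measure (Rd d)) {h h₁ h₂ : Rd d → ℝ≥0∞} (m₁ : Measurable h₁) (m₂ : Measurable h₂)
    (hle : ∀ x, h x ≤ h₁ x + h₂ x) :
    eLpNorm (fun x => h x * ENNReal.ofReal (η x)) p μ ≤
      eLpNorm (fun x => h₁ x * ENNReal.ofReal (η x)) p μ +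
      eLpNorm (fun x => h₂ x * ENNReal.ofReal (η x)) p μ := by
  refine le_trans (eLpNorm_mono_enorm fun x => ?_) (eLpNorm_add_le
    (m₁.mul hη.ennreal_ofReal).aestronglyMeasurable
    (m₂.mul hη.ennreal_ofReal).aestronglyMeasurable hp)
  simp only [enorm_eq_self, Pi.add_apply, ← add_mul]
  gcongr
  exact hle x

theorem lpENorm_smul_le {d : ℕ} {η : Rd d → ℝ} {p : ℝ≥0∞}
    (μ : Measure (Rd d)) {h h₁ : Rd d → ℝ≥0∞} (c : ℂ) (hle : ∀ x, h x ≤ ‖c‖ₑ * h₁ x) :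
    eLpNorm (fun x => h x * ENNReal.ofReal (η x)) p μ ≤
      ‖c‖ₑ * eLpNorm (fun x => h₁ x * ENNReal.ofReal (η x)) p μ := by
  refine le_trans (eLpNorm_le_nnreal_smul_eLpNorm_of_ae_le_mul' (c := ‖c‖₊)
    (g := fun x => h₁ x * ENNReal.ofReal (η x)) (.of_forall fun x => ?_) p) le_rfl
  simp only [enorm_eq_self, ← mul_assoc]
  gcongr
  exact hle x

/-- A space of distributions from an extended seminorm that satisfies the inequalities `≤`. -/
def DistSpace.ofLe {d : ℕ} (N : 𝓢'(Rd d, ℂ) → ℝ≥0∞) (hadd : ∀ f g, N (f + g) ≤ N f + N g)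
    (hzero : N 0 = 0) (hsmul : ∀ (c : ℂ) (f), c ≠ 0 → N (c • f) ≤ ‖c‖ₑ * N f) : DistSpace d where
  eNorm := N
  add_le := hadd
  smul_eq c f := by
    by_cases hc : c = 0
    · rw [hc, show (0 : ℂ) • f = 0 from zero_smul ℂ f, hzero, enorm_zero, zero_mul]
    refine le_antisymm (hsmul c f hc) ?_
    have h1 := hsmul c⁻¹ (c • f) (inv_ne_zero hc)
    rw [show c⁻¹ • c • f = f from inv_smul_smul₀ hc f] at h1
    calc ‖c‖ₑ * N f ≤ ‖c‖ₑ * (‖c⁻¹‖ₑ * N (c • f)) := by gcongr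
      _ = N (c • f) := by
        rw [← mul_assoc, ← enorm_mul, mul_inv_cancel₀ hc, enorm_one, one_mul]

theorem isLocallyIn_zero {d : ℕ} (E : DistSpace d) : IsLocallyIn E (restr 0) := fun _ =>
  ⟨0, fun _ => rfl, zero_mem _⟩

theorem controlFun_zero {d : ℕ} (E : DistSpace d) (φ : Test d) (x : Rd d) :
    controlFun E φ (restr 0) x = 0 := by
  have h := controlFun_smul_le E φ 0 0 x
  rwa [show (0 : ℂ) • (0 : 𝓢'(Rd d, ℂ)) = 0 from zero_smul ℂ (0 : 𝓢'(Rd d, ℂ)), enorm_zero, zero_mul,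
    nonpos_iff_eq_zero] at h

/-- The amalgam space `W(E, L^p_η)`, `1 ≤ p ≤ ∞`, as a space of tempered distributions. -/
def amalgam {d : ℕ} (E : DistSpace d) (φ : Test d) (η : Rd d → ℝ) (hη : IsPolyWeight η)
    (p : ℝ≥0∞) (hp : 1 ≤ p) : DistSpace d :=
  DistSpace.ofLe (fun f => amalgamENorm E φ η p (restr f))
    (fun f g => by
      simp only [amalgamENorm, ENNReal.iInf_add, ENNReal.add_iInf]
      refine le_iInf fun hf => le_iInf fun hg => (iInf_le _ (hg.add hf)).trans ?_
      exact lpENorm_add_le hη.measurable hp volume (measurable_controlFun E φ _)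
        (measurable_controlFun E φ _) (controlFun_add_le E φ f g))
    (by
      simp only [amalgamENorm]
      rw [iInf_pos (isLocallyIn_zero E), lpENorm]
      simp only [controlFun_zero, zero_mul]
      exact eLpNorm_zero')
    (fun c f hc => by
      simp only [amalgamENorm]
      by_cases hf : IsLocallyIn E (restr f)
      · rw [iInf_pos hf, iInf_pos (hf.smul c)]
        exact lpENorm_smul_le volume c (controlFun_smul_le E φ c f)
      · rw [iInf_neg hf, ENNReal.mul_top (by simpa using hc)]
        exact le_top)

/-- The amalgam space `W(E, L^∞_{η,0})`, as a space of tempered distributions. -/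
def amalgamZero {d : ℕ} (E : DistSpace d) (φ : Test d) (η : Rd d → ℝ) (hη : IsPolyWeight η) :
    DistSpace d :=
  DistSpace.ofLe (fun f => amalgamZeroENorm E φ η (restr f))
    (fun f g => by
      simp only [amalgamZeroENorm, linftyZeroENorm, ENNReal.iInf_add, ENNReal.add_iInf]
      refine le_iInf fun hg => le_iInf fun vg => le_iInf fun hf => le_iInf fun vf => ?_
      have hv : VanishesAtInfinity η (controlFun E φ (restr (f + g))) := fun ε hε => by
        obtain ⟨K, hK, h1⟩ := vf (ε / 2) (ENNReal.half_pos hε.ne')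
        obtain ⟨L, hL, h2⟩ := vg (ε / 2) (ENNReal.half_pos hε.ne')
        refine ⟨K ∪ L, hK.union hL, (lpENorm_add_le hη.measurable le_top _
          (measurable_controlFun E φ _) (measurable_controlFun E φ _)
          (controlFun_add_le E φ f g)).trans ?_⟩
        rw [← ENNReal.add_halves ε]
        gcongr
        · refine (eLpNorm_mono_measure _ (Measure.restrict_mono ?_ le_rfl)).trans h1
          exact Set.compl_subset_compl.2 Set.subset_union_left
        · refine (eLpNorm_mono_measure _ (Measure.restrict_mono ?_ le_rfl)).trans h2
          exact Set.compl_subset_compl.2 Set.subset_union_right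
      refine (iInf₂_le (hf.add hg) hv).trans ?_
      exact lpENorm_add_le hη.measurable le_top volume (measurable_controlFun E φ _)
        (measurable_controlFun E φ _) (controlFun_add_le E φ f g))
    (by
      simp only [amalgamZeroENorm, linftyZeroENorm]
      have hv : VanishesAtInfinity η (controlFun E φ (restr 0)) := fun ε _ =>
        ⟨∅, isCompact_empty, by simp only [controlFun_zero, zero_mul]; rw [eLpNorm_zero']; simp⟩
      rw [iInf_pos (isLocallyIn_zero E), iInf_pos hv, lpENorm]
      simp only [controlFun_zero, zero_mul]
      exact eLpNorm_zero')
    (fun c f hc => by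
      simp only [amalgamZeroENorm, linftyZeroENorm]
      by_cases hf : IsLocallyIn E (restr f)
      · rw [iInf_pos hf, iInf_pos (hf.smul c)]
        by_cases vf : VanishesAtInfinity η (controlFun E φ (restr f))
        · have hv : VanishesAtInfinity η (controlFun E φ (restr (c • f))) := fun ε hε => by
            obtain ⟨K, hK, h1⟩ := vf (ε / ‖c‖ₑ) (ENNReal.div_pos hε.ne' (by simp))
            refine ⟨K, hK, (lpENorm_smul_le _ c (controlFun_smul_le E φ c f)).trans ?_⟩
            exact (mul_le_mul_right h1 _).trans ENNReal.mul_div_le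
          rw [iInf_pos vf, iInf_pos hv]
          exact lpENorm_smul_le volume c (controlFun_smul_le E φ c f)
        · rw [iInf_neg vf, ENNReal.mul_top (by simpa using hc)]
          exact le_top
      · rw [iInf_neg hf, ENNReal.mul_top (by simpa using hc)]
        exact le_top)

/-! ### The completed injective tensor product -/

/-- The tensor product `φ ⊗ ψ : (x, y) ↦ φ x * ψ y` of two Schwartz functions. -/
def schwartzTensor {d : ℕ} (φ ψ : 𝓢(Rd d, ℂ)) : 𝓢(Rd d × Rd d, ℂ) where
  toFun z := φ z.1 * ψ z.2
  smooth' := ((φ.smooth ⊤).comp contDiff_fst).mul ((ψ.smooth ⊤).comp contDiff_snd)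
  decay' := by
    intro k n
    have hφ : ∀ (i : ℕ) (z : Rd d × Rd d),
        ‖iteratedFDeriv ℝ i (fun z : Rd d × Rd d => φ z.1) z‖ ≤ ‖iteratedFDeriv ℝ i φ z.1‖ := by
      intro i z
      have h := (ContinuousLinearMap.fst ℝ (Rd d) (Rd d)).iteratedFDeriv_comp_right
        (φ.smooth ⊤) z (i := i) (mod_cast le_top)
      rw [show (fun z : Rd d × Rd d => φ z.1) = φ ∘ ContinuousLinearMap.fst ℝ (Rd d) (Rd d) from rfl,
        h]
      refine (ContinuousMultilinearMap.norm_compContinuousLinearMap_le _ _).trans ?_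
      refine mul_le_of_le_one_right (norm_nonneg _) ?_
      exact Finset.prod_le_one (fun _ _ => norm_nonneg _)
        fun _ _ => ContinuousLinearMap.norm_fst_le ℝ _ _
    have hψ : ∀ (i : ℕ) (z : Rd d × Rd d),
        ‖iteratedFDeriv ℝ i (fun z : Rd d × Rd d => ψ z.2) z‖ ≤ ‖iteratedFDeriv ℝ i ψ z.2‖ := by
      intro i z
      have h := (ContinuousLinearMap.snd ℝ (Rd d) (Rd d)).iteratedFDeriv_comp_right
        (ψ.smooth ⊤) z (i := i) (mod_cast le_top)
      rw [show (fun z : Rd d × Rd d => ψ z.2) = ψ ∘ ContinuousLinearMap.snd ℝ (Rd d) (Rd d) from rfl,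
        h]
      refine (ContinuousMultilinearMap.norm_compContinuousLinearMap_le _ _).trans ?_
      refine mul_le_of_le_one_right (norm_nonneg _) ?_
      exact Finset.prod_le_one (fun _ _ => norm_nonneg _)
        fun _ _ => ContinuousLinearMap.norm_snd_le ℝ _ _
    have key : ∀ i j : ℕ, ∃ C : ℝ, ∀ z : Rd d × Rd d,
        ‖z‖ ^ k * (‖iteratedFDeriv ℝ i φ z.1‖ * ‖iteratedFDeriv ℝ j ψ z.2‖) ≤ C := by
      intro i j
      obtain ⟨C₁, h₁⟩ := φ.decay' k i
      obtain ⟨C₂, h₂⟩ := φ.decay' 0 i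
      obtain ⟨C₃, h₃⟩ := ψ.decay' k j
      obtain ⟨C₄, h₄⟩ := ψ.decay' 0 j
      refine ⟨C₁ * C₄ + C₂ * C₃, fun z => ?_⟩
      have b₁ := h₁ z.1
      have b₂ := h₂ z.1
      have b₃ := h₃ z.2
      have b₄ := h₄ z.2
      simp only [pow_zero, one_mul] at b₂ b₄
      have hz : ‖z‖ ^ k ≤ ‖z.1‖ ^ k + ‖z.2‖ ^ k := by
        rcases le_total ‖z.1‖ ‖z.2‖ with h | h
        · rw [Prod.norm_def, max_eq_right h]
          exact le_add_of_nonneg_left (by positivity)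
        · rw [Prod.norm_def, max_eq_left h]
          exact le_add_of_nonneg_right (by positivity)
      set p := ‖iteratedFDeriv ℝ i φ z.1‖
      set q := ‖iteratedFDeriv ℝ j ψ z.2‖
      have hp : 0 ≤ p := norm_nonneg _
      have hq : 0 ≤ q := norm_nonneg _
      calc ‖z‖ ^ k * (p * q) ≤ (‖z.1‖ ^ k + ‖z.2‖ ^ k) * (p * q) := by gcongr
        _ = (‖z.1‖ ^ k * p) * q + p * (‖z.2‖ ^ k * q) := by ring
        _ ≤ C₁ * C₄ + C₂ * C₃ := by
          have e₁ : 0 ≤ ‖z.1‖ ^ k * p := by positivity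
          have e₂ : 0 ≤ ‖z.2‖ ^ k * q := by positivity
          exact add_le_add (mul_le_mul b₁ b₄ hq (e₁.trans b₁)) (mul_le_mul b₂ b₃ e₂ (hp.trans b₂))
    choose C hC using key
    refine ⟨∑ i ∈ Finset.range (n + 1), (n.choose i : ℝ) * C i (n - i), fun z => ?_⟩
    have hmul := norm_iteratedFDeriv_mul_le (𝕜 := ℝ) (n := n)
      ((φ.smooth ⊤).comp (contDiff_fst (E := Rd d) (F := Rd d)))
      ((ψ.smooth ⊤).comp (contDiff_snd (E := Rd d) (F := Rd d))) z (mod_cast le_top)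
    refine (mul_le_mul_of_nonneg_left hmul (by positivity)).trans ?_
    rw [Finset.mul_sum]
    refine Finset.sum_le_sum fun i _ => ?_
    refine le_trans ?_ (mul_le_mul_of_nonneg_left (hC i (n - i) z) (Nat.cast_nonneg _))
    calc ‖z‖ ^ k * ((n.choose i : ℝ) * ‖iteratedFDeriv ℝ i (fun z : Rd d × Rd d => φ z.1) z‖ *
          ‖iteratedFDeriv ℝ (n - i) (fun z : Rd d × Rd d => ψ z.2) z‖)
        ≤ ‖z‖ ^ k * ((n.choose i : ℝ) * ‖iteratedFDeriv ℝ i φ z.1‖ *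
          ‖iteratedFDeriv ℝ (n - i) ψ z.2‖) := by
          gcongr
          · exact hφ i z
          · exact hψ (n - i) z
      _ = (n.choose i : ℝ) * (‖z‖ ^ k * (‖iteratedFDeriv ℝ i φ z.1‖ *
          ‖iteratedFDeriv ℝ (n - i) ψ z.2‖)) := by ring

/-- The elementary tensor `a ⊗ b`, as the bounded bilinear form `(a', b') ↦ a'(a) b'(b)` on the
duals of `A` and `B`. -/
def elementaryTensor {d : ℕ} (A B : DistSpace d) (a : A.Carrier) (b : B.Carrier) :
    StrongDual ℂ A.Carrier →L[ℂ] StrongDual ℂ B.Carrier →L[ℂ] ℂ :=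
  (NormedSpace.inclusionInDoubleDual ℂ A.Carrier a).smulRight
    (NormedSpace.inclusionInDoubleDual ℂ B.Carrier b)

/-- The completed injective tensor product of `A` and `B`: the completion of the algebraic tensor
product for the norm `‖z‖ = sup {|(a' ⊗ b')(z)| : ‖a'‖ ≤ 1, ‖b'‖ ≤ 1}`. As this is the norm of `z`
as a bilinear form on the duals, the completion is the closure of the linear span of the elementary
tensors in the Banach space of bounded bilinear forms. -/
def injTensor {d : ℕ} (A B : DistSpace d) :
    Submodule ℂ (StrongDual ℂ A.Carrier →L[ℂ] StrongDual ℂ B.Carrier →L[ℂ] ℂ) :=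
  (Submodule.span ℂ
    (Set.range fun ab : A.Carrier × B.Carrier => elementaryTensor A B ab.1 ab.2)).topologicalClosure

/-- The element `z` of the completed tensor product is, under its canonical inclusion into the
tempered distributions on `ℝ^d × ℝ^d`, the distribution `U`: Schwartz functions `φ`, `ψ` act on `A`
and `B` as bounded functionals and `⟨U, φ ⊗ ψ⟩ = (φ ⊗ ψ)(z)`. -/
def Represents {d : ℕ} (A B : DistSpace d)
    (z : StrongDual ℂ A.Carrier →L[ℂ] StrongDual ℂ B.Carrier →L[ℂ] ℂ)
    (U : 𝓢'(Rd d × Rd d, ℂ)) : Prop :=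
  ∀ φ ψ : 𝓢(Rd d, ℂ), ∃ (a' : StrongDual ℂ A.Carrier) (b' : StrongDual ℂ B.Carrier),
    (∀ a, a' a = A.incl a φ) ∧ (∀ b, b' b = B.incl b ψ) ∧ U (schwartzTensor φ ψ) = z a' b'

/-- The norm of the completed injective tensor product of `A` and `B`, as a space of tempered
distributions on `ℝ^d × ℝ^d`, with value `∞` off this space. -/
def injTensorENorm {d : ℕ} (A B : DistSpace d) (U : 𝓢'(Rd d × Rd d, ℂ)) : ℝ≥0∞ :=
  ⨅ (z : StrongDual ℂ A.Carrier →L[ℂ] StrongDual ℂ B.Carrier →L[ℂ] ℂ) (_ : z ∈ injTensor A B)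
    (_ : Represents A B z U), ‖z‖ₑ

/-! ### Modulation spaces -/

/-- The Schwartz function `t ↦ conj (M_ξ T_x g (t)) = conj (exp (2 π i t·ξ) g (t - x))`. -/
def conjTimeFreqShift {d : ℕ} (g : 𝓢(Rd d, ℂ)) (x ξ : Rd d) : 𝓢(Rd d, ℂ) :=
  SchwartzMap.postcompCLM (𝕜 := ℝ) (Complex.conjCLE : ℂ →L[ℝ] ℂ)
    (SchwartzMap.smulLeftCLM ℂ (character ξ) (SchwartzMap.compSubConstCLM ℂ x g))

theorem conjTimeFreqShift_apply {d : ℕ} (g : 𝓢(Rd d, ℂ)) (x ξ t : Rd d) :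
    conjTimeFreqShift g x ξ t = (starRingEnd ℂ) (character ξ t * g (t - x)) := by
  simp [conjTimeFreqShift,
    SchwartzMap.smulLeftCLM_apply_apply (character_hasTemperateGrowth ξ)]

/-- The short-time Fourier transform `V_g f (x, ξ) = ⟨f, conj (M_ξ T_x g)⟩`. -/
def stft {d : ℕ} (g : 𝓢(Rd d, ℂ)) (f : 𝓢'(Rd d, ℂ)) (z : Rd d × Rd d) : ℂ :=
  f (conjTimeFreqShift g z.1 z.2)

/-- The norm `‖f‖ = ‖V_g f‖_X` of the modulation space associated to the space `X` of tempered
distributions on `ℝ^d × ℝ^d` (given by its norm, with value `∞` off `X`), with value `∞` off the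
modulation space. The function `V_g f` is regarded as the tempered distribution `U` given by
integration against it. -/
def modulationENorm {d : ℕ} (g : 𝓢(Rd d, ℂ)) (X : 𝓢'(Rd d × Rd d, ℂ) → ℝ≥0∞)
    (f : 𝓢'(Rd d, ℂ)) : ℝ≥0∞ :=
  ⨅ (U : 𝓢'(Rd d × Rd d, ℂ)) (_ : ∀ Φ : 𝓢(Rd d × Rd d, ℂ), U Φ = ∫ z, stft g f z * Φ z), X U

/-- The space of distributions with norm `N` and the space of tempered distributions with norm `M`
(norms having value `∞` off the spaces) are equal, with equivalent norms. -/
def EqualWithEquivalentNorms {d : ℕ} (N : Dist d → ℝ≥0∞) (M : 𝓢'(Rd d, ℂ) → ℝ≥0∞) : Prop :=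
  (∀ u : Dist d, N u < ∞ ↔ ∃ f : 𝓢'(Rd d, ℂ), restr f = u ∧ M f < ∞) ∧
  ∃ C : ℝ≥0, ∀ f : 𝓢'(Rd d, ℂ), N (restr f) ≤ C * M f ∧ M f ≤ C * N (restr f)

end

end TMIB

namespace TMIB

noncomputable section

open Filter Topology

/-! ### Schwartz functions -/

section SchwartzNorms

variable {V : Type*} [NormedAddCommGroup V] [NormedSpace ℝ V]

/-- The `m`-th of an increasing sequence of seminorms defining the topology of the Schwartz
space. -/
def SN (m : ℕ) : Seminorm ℂ 𝓢(V, ℂ) :=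
  (Finset.Iic (m, m)).sup (schwartzSeminormFamily ℂ V ℂ)

theorem SN_mono {m n : ℕ} (h : m ≤ n) (ψ : 𝓢(V, ℂ)) : SN m ψ ≤ SN n ψ :=
  Finset.sup_mono (f := schwartzSeminormFamily ℂ V ℂ) (Finset.Iic_subset_Iic.2 (Prod.mk_le_mk.2 ⟨h, h⟩)) ψ

theorem one_add_pow_mul_le_SN {m k n : ℕ} (hk : k ≤ m) (hn : n ≤ m) (ψ : 𝓢(V, ℂ)) (x : V) :
    (1 + ‖x‖) ^ k * ‖iteratedFDeriv ℝ n ψ x‖ ≤ 2 ^ m * SN m ψ :=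
  SchwartzMap.one_add_le_sup_seminorm_apply (𝕜 := ℂ) (m := (m, m)) hk hn ψ x

theorem norm_apply_le_SN {m k : ℕ} (hk : k ≤ m) (ψ : 𝓢(V, ℂ)) (x : V) :
    (1 + ‖x‖) ^ k * ‖ψ x‖ ≤ 2 ^ m * SN m ψ := by
  simpa using one_add_pow_mul_le_SN hk (Nat.zero_le m) ψ x

theorem SN_le_bound {m : ℕ} (ψ : 𝓢(V, ℂ)) {B : ℝ} (hB : 0 ≤ B)
    (h : ∀ k ≤ m, ∀ n ≤ m, ∀ x, ‖x‖ ^ k * ‖iteratedFDeriv ℝ n ψ x‖ ≤ B) : SN m ψ ≤ B := by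
  refine Seminorm.finset_sup_apply_le hB fun i hi => ?_
  have hi := Finset.mem_Iic.1 hi
  exact SchwartzMap.seminorm_le_bound ℂ _ _ _ hB (h _ hi.1 _ hi.2)

theorem continuous_SN (m : ℕ) : Continuous (SN m : Seminorm ℂ 𝓢(V, ℂ)) := by
  unfold SN
  refine Seminorm.continuous_of_le (p := (Finset.Iic (m, m)).sup (schwartzSeminormFamily ℂ V ℂ))
    (q := ∑ i ∈ Finset.Iic (m, m), schwartzSeminormFamily ℂ V ℂ i) ?_ ?_
  · have h : ∀ ψ : 𝓢(V, ℂ), (∑ i ∈ Finset.Iic (m, m), schwartzSeminormFamily ℂ V ℂ i) ψ =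
        ∑ i ∈ Finset.Iic (m, m), schwartzSeminormFamily ℂ V ℂ i ψ := fun ψ => by
      rw [← FunLike.coeAddMonoidHom_apply, map_sum, Finset.sum_apply]; rfl
    rw [show ⇑(∑ i ∈ Finset.Iic (m, m), schwartzSeminormFamily ℂ V ℂ i) = _ from funext h]
    exact continuous_finsetSum _ fun i _ => (schwartz_withSeminorms ℂ V ℂ).continuous_seminorm i
  · exact Seminorm.finset_sup_le_sum _ _

theorem exists_SN_bound (q : Seminorm ℂ 𝓢(V, ℂ)) (hq : Continuous q) :
    ∃ m : ℕ, ∃ C > 0, ∀ ψ, q ψ ≤ C * SN m ψ := by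
  obtain ⟨s, C, hC, h⟩ := Seminorm.bound_of_continuous (schwartz_withSeminorms ℂ V ℂ) q hq
  refine ⟨s.sup fun i => max i.1 i.2, C, by positivity, fun ψ => (h ψ).trans ?_⟩
  change (C : ℝ) * (s.sup (schwartzSeminormFamily ℂ V ℂ)) ψ ≤ _
  refine mul_le_mul_of_nonneg_left ?_ C.2
  refine Finset.sup_mono (f := schwartzSeminormFamily ℂ V ℂ) (fun i hi => ?_) ψ
  have := Finset.le_sup (f := fun i : ℕ × ℕ => max i.1 i.2) hi
  exact Finset.mem_Iic.2 ⟨(le_max_left _ _).trans this, (le_max_right _ _).trans this⟩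

theorem exists_SN_comp_le {W : Type*} [NormedAddCommGroup W] [NormedSpace ℝ W]
    (T : 𝓢(V, ℂ) →L[ℂ] 𝓢(W, ℂ)) (n : ℕ) : ∃ m : ℕ, ∃ C > 0, ∀ ψ, SN n (T ψ) ≤ C * SN m ψ :=
  exists_SN_bound ((SN n).comp T.toLinearMap) ((continuous_SN n).comp T.continuous)

theorem exists_norm_temperedDistribution_le (f : 𝓢'(V, ℂ)) :
    ∃ m : ℕ, ∃ C > 0, ∀ ψ, ‖f ψ‖ ≤ C * SN m ψ :=
  exists_SN_bound ((normSeminorm ℂ ℂ).comp f.toLinearMap) ((map_continuous f).norm)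

/-- A linear functional on the Schwartz space that is bounded by a Schwartz seminorm, as a tempered
distribution. -/
def mkTempered (A : 𝓢(V, ℂ) → ℂ) (hadd : ∀ f g, A (f + g) = A f + A g)
    (hsmul : ∀ (c : ℂ) f, A (c • f) = c * A f) (hb : ∃ m : ℕ, ∃ C : ℝ, 0 ≤ C ∧ ∀ ψ, ‖A ψ‖ ≤ C * SN m ψ) :
    𝓢'(V, ℂ) :=
  ContinuousLinearMap.toPointwiseConvergenceCLM ℂ (RingHom.id ℂ) _ _
    (SchwartzMap.mkCLMtoNormedSpace (𝕜 := ℂ) (σ := RingHom.id ℂ) A hadd hsmul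
      (by obtain ⟨m, C, hC, h⟩ := hb; exact ⟨_, C, hC, h⟩))

/-- The pointwise product of Schwartz functions. -/
abbrev mulS (h ψ : 𝓢(V, ℂ)) : 𝓢(V, ℂ) := SchwartzMap.smulLeftCLM ℂ h ψ

theorem mulS_apply (h ψ : 𝓢(V, ℂ)) (x : V) : mulS h ψ x = h x * ψ x := by
  simp [mulS, SchwartzMap.smulLeftCLM_apply_apply h.hasTemperateGrowth]

theorem mulS_comm (h ψ : 𝓢(V, ℂ)) : mulS h ψ = mulS ψ h := by
  ext x; simp only [mulS_apply, mul_comm]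

theorem mulS_assoc (h k ψ : 𝓢(V, ℂ)) : mulS (mulS h k) ψ = mulS h (mulS k ψ) := by
  ext x; simp only [mulS_apply, mul_assoc]

/-- The translation `T_a` of Schwartz functions. -/
abbrev tr (a : V) : 𝓢(V, ℂ) →L[ℂ] 𝓢(V, ℂ) := SchwartzMap.compSubConstCLM ℂ a

theorem tr_apply (a : V) (ψ : 𝓢(V, ℂ)) (x : V) : tr a ψ x = ψ (x - a) := rfl

theorem tr_tr (a b : V) (ψ : 𝓢(V, ℂ)) : tr a (tr b ψ) = tr (a + b) ψ := by
  ext x; simp only [tr_apply]; congr 1; abel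

theorem tr_zero (ψ : 𝓢(V, ℂ)) : tr 0 ψ = ψ := by
  ext x; simp

theorem tr_mulS (a : V) (h ψ : 𝓢(V, ℂ)) : tr a (mulS h ψ) = mulS (tr a h) (tr a ψ) := by
  ext x; simp only [tr_apply, mulS_apply]

theorem one_add_norm_le_mul {V : Type*} [SeminormedAddCommGroup V] (x y : V) : 1 + ‖y‖ ≤ (1 + ‖x‖) * (1 + ‖x - y‖) := by
  have h : ‖y‖ ≤ ‖x‖ + ‖x - y‖ := by
    have := norm_sub_le x (x - y); simpa using this
  nlinarith [norm_nonneg x, norm_nonneg (x - y)]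

theorem norm_iteratedFDeriv_tr (y : V) (ψ : 𝓢(V, ℂ)) (n : ℕ) (x : V) :
    iteratedFDeriv ℝ n (tr y ψ) x = iteratedFDeriv ℝ n ψ (x - y) :=
  iteratedFDeriv_comp_sub n y x

/-- The product of a Schwartz function with a translate of another one decays rapidly in the
translation. -/
theorem SN_mulS_tr_le (m N : ℕ) (θ ψ : 𝓢(V, ℂ)) (y : V) :
    SN m (mulS θ (tr y ψ)) * (1 + ‖y‖) ^ N ≤
      2 ^ m * 4 ^ (m + N) * SN (m + N) θ * SN (m + N) ψ := by
  rw [← le_div_iff₀ (by positivity)]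
  refine SN_le_bound _ (by positivity) fun k hk n hn x => ?_
  rw [le_div_iff₀ (by positivity)]
  have e : ⇑(mulS θ (tr y ψ)) = fun x => θ x * tr y ψ x := funext fun x => mulS_apply _ _ x
  have h1 := norm_iteratedFDeriv_mul_le (𝕜 := ℝ) (n := n) (θ.smooth ⊤) ((tr y ψ).smooth ⊤) x
    (mod_cast le_top)
  rw [← e] at h1
  have hx : ‖x‖ ^ k ≤ (1 + ‖x‖) ^ m :=
    (pow_le_pow_left₀ (norm_nonneg _) (by linarith [norm_nonneg x]) k).trans
      (pow_le_pow_right₀ (by linarith [norm_nonneg x]) hk)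
  have hy : (1 + ‖y‖) ^ N ≤ (1 + ‖x‖) ^ N * (1 + ‖x - y‖) ^ N := by
    rw [← mul_pow]; exact pow_le_pow_left₀ (by positivity) (one_add_norm_le_mul x y) N
  calc ‖x‖ ^ k * ‖iteratedFDeriv ℝ n (mulS θ (tr y ψ)) x‖ * (1 + ‖y‖) ^ N
      ≤ (1 + ‖x‖) ^ m * (∑ i ∈ Finset.range (n + 1), (n.choose i : ℝ) *
        ‖iteratedFDeriv ℝ i θ x‖ * ‖iteratedFDeriv ℝ (n - i) (tr y ψ) x‖) *
        ((1 + ‖x‖) ^ N * (1 + ‖x - y‖) ^ N) := by gcongr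
    _ = ∑ i ∈ Finset.range (n + 1), (n.choose i : ℝ) *
        (((1 + ‖x‖) ^ (m + N) * ‖iteratedFDeriv ℝ i θ x‖) *
        ((1 + ‖x - y‖) ^ N * ‖iteratedFDeriv ℝ (n - i) ψ (x - y)‖)) := by
      rw [Finset.mul_sum, Finset.sum_mul]
      refine Finset.sum_congr rfl fun i _ => ?_
      rw [norm_iteratedFDeriv_tr]; ring
    _ ≤ ∑ i ∈ Finset.range (n + 1), (n.choose i : ℝ) *
        ((2 ^ (m + N) * SN (m + N) θ) * (2 ^ (m + N) * SN (m + N) ψ)) := by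
      refine Finset.sum_le_sum fun i hi => ?_
      have hi := Finset.mem_range_succ_iff.1 hi
      refine mul_le_mul_of_nonneg_left ?_ (by positivity)
      exact mul_le_mul (one_add_pow_mul_le_SN le_rfl (by omega) θ x)
        (one_add_pow_mul_le_SN (by omega) (by omega) ψ _) (by positivity) (by positivity)
    _ = 2 ^ n * 4 ^ (m + N) * SN (m + N) θ * SN (m + N) ψ := by
      rw [← Finset.sum_mul]
      have : (∑ i ∈ Finset.range (n + 1), (n.choose i : ℝ)) = 2 ^ n := by
        exact_mod_cast Nat.sum_range_choose n
      rw [this, show (4 : ℝ) = 2 * 2 by norm_num, mul_pow]; ring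
    _ ≤ _ := by
      gcongr
      norm_num

theorem SN_tr_le (m : ℕ) (ψ : 𝓢(V, ℂ)) (y : V) :
    SN m (tr y ψ) ≤ 2 ^ m * (1 + ‖y‖) ^ m * SN m ψ := by
  refine SN_le_bound _ (by positivity) fun k hk n hn x => ?_
  rw [norm_iteratedFDeriv_tr]
  have hx : ‖x‖ ^ k ≤ (1 + ‖y‖) ^ m * (1 + ‖x - y‖) ^ m := by
    rw [← mul_pow]
    refine (pow_le_pow_left₀ (norm_nonneg _) (by linarith [norm_nonneg x]) k).trans
      ((pow_le_pow_right₀ (by linarith [norm_nonneg x] : 1 ≤ 1 + ‖x‖) hk).trans ?_)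
    refine pow_le_pow_left₀ (by positivity) ?_ m
    have := one_add_norm_le_mul y x
    rwa [norm_sub_rev] at this
  calc ‖x‖ ^ k * ‖iteratedFDeriv ℝ n ψ (x - y)‖
      ≤ (1 + ‖y‖) ^ m * (1 + ‖x - y‖) ^ m * ‖iteratedFDeriv ℝ n ψ (x - y)‖ := by gcongr
    _ = (1 + ‖y‖) ^ m * ((1 + ‖x - y‖) ^ m * ‖iteratedFDeriv ℝ n ψ (x - y)‖) := by ring
    _ ≤ (1 + ‖y‖) ^ m * (2 ^ m * SN m ψ) := by
      exact mul_le_mul_of_nonneg_left (one_add_pow_mul_le_SN le_rfl hn ψ _) (by positivity)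
    _ = _ := by ring

/-- A series of Schwartz functions that is summable for all Schwartz seminorms converges in the
Schwartz space to its pointwise sum. -/
theorem hasSum_schwartz {ι : Type*} {u : ι → 𝓢(V, ℂ)} {v : 𝓢(V, ℂ)}
    (hu : ∀ m, Summable fun i => SN m (u i)) (h : ∀ x, HasSum (fun i => u i x) (v x)) :
    HasSum u v := by
  have hp : ∀ k n : ℕ, Summable fun i => SchwartzMap.seminorm ℂ k n (u i) := fun k n => by
    refine (hu (max k n)).of_nonneg_of_le (fun i => apply_nonneg _ _) fun i => ?_
    exact Seminorm.le_finset_sup_apply (p := schwartzSeminormFamily ℂ V ℂ) (i := (k, n))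
      (Finset.mem_Iic.2 ⟨le_max_left _ _, le_max_right _ _⟩)
  rw [HasSum, SummationFilter.unconditional_filter,
    (schwartz_withSeminorms ℂ V ℂ).tendsto_nhds]
  rintro ⟨k, n⟩ ε hε
  filter_upwards [(tendsto_tsum_compl_atTop_zero
    fun i => SchwartzMap.seminorm ℂ k n (u i)).eventually (gt_mem_nhds hε)] with s hs
  refine lt_of_le_of_lt ?_ hs
  rw [map_sub_rev]
  have hsub : ⇑(v - ∑ i ∈ s, u i) = fun y => ∑' i : {i // i ∉ s}, u i y := by
    funext y
    have h1 := (h y).summable.sum_add_tsum_subtype_compl s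
    rw [(h y).tsum_eq] at h1
    rw [sub_apply, sum_apply, ← h1, add_sub_cancel_left]
  refine SchwartzMap.seminorm_le_bound ℂ k n _ (tsum_nonneg fun i => apply_nonneg _ _) fun x => ?_
  have hD := iteratedFDeriv_tsum_apply (𝕜 := ℝ) (N := ⊤) (f := fun (i : {i // i ∉ s}) y => u i y)
    (v := fun j i => SchwartzMap.seminorm ℂ 0 j (u i)) (fun i => (u i).smooth ⊤)
    (fun j _ => (hp 0 j).subtype _) (fun j i y _ => SchwartzMap.norm_iteratedFDeriv_le_seminorm ℂ _ j y)
    (k := n) le_top x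
  rw [hsub, hD]
  have hs0 : Summable fun i : {i // i ∉ s} => ‖iteratedFDeriv ℝ n (fun y => u i y) x‖ :=
    ((hp 0 n).subtype _).of_nonneg_of_le (fun i => norm_nonneg _)
      fun i => SchwartzMap.norm_iteratedFDeriv_le_seminorm ℂ _ n x
  refine (mul_le_mul_of_nonneg_left (norm_tsum_le_tsum_norm hs0) (by positivity)).trans ?_
  rw [← tsum_mul_left]
  refine (hs0.mul_left _).tsum_le_tsum (fun i => SchwartzMap.le_seminorm ℂ k n _ x) ((hp k n).subtype _)

end SchwartzNorms

/-! ### The lattice `ℤ^d` in `ℝ^d` -/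

theorem latticePoint_apply {d : ℕ} (k : Fin d → ℤ) (i : Fin d) : latticePoint k i = k i := rfl

theorem latticePoint_add {d : ℕ} (j k : Fin d → ℤ) :
    latticePoint (j + k) = latticePoint j + latticePoint k := by
  ext i; simp [latticePoint_apply]

theorem latticePoint_sub {d : ℕ} (j k : Fin d → ℤ) :
    latticePoint (j - k) = latticePoint j - latticePoint k := by
  ext i; simp [latticePoint_apply]

theorem latticePoint_zero {d : ℕ} : latticePoint (0 : Fin d → ℤ) = 0 := by
  ext i; simp [latticePoint_apply]

/-- The coordinatewise integer part. -/
def intPart {d : ℕ} (x : Rd d) : Fin d → ℤ := fun i => ⌊x i⌋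

theorem measurable_intPart {d : ℕ} : Measurable (intPart (d := d)) :=
  measurable_pi_iff.2 fun i => Int.measurable_floor.comp (by fun_prop)

/-- The coordinatewise integer part maps the Lebesgue measure to the counting measure. -/
theorem measurePreserving_intPart {d : ℕ} :
    MeasurePreserving (intPart (d := d)) volume Measure.count := by
  refine ⟨measurable_intPart, Measure.ext_of_singleton fun k => ?_⟩
  rw [Measure.map_apply measurable_intPart (measurableSet_singleton k), Measure.count_singleton]
  have h : intPart ⁻¹' {k} = (@WithLp.ofLp 2 (Fin d → ℝ)) ⁻¹'
      (Set.pi Set.univ fun i => Set.Ico (k i : ℝ) (k i + 1)) := by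
    ext x
    simp only [Set.mem_preimage, Set.mem_singleton_iff, funext_iff, intPart, Int.floor_eq_iff,
      Set.mem_pi, Set.mem_univ, true_imp_iff, Set.mem_Ico]
  rw [h, (PiLp.volume_preserving_ofLp (Fin d)).measure_preimage
    (MeasurableSet.univ_pi fun i => measurableSet_Ico).nullMeasurableSet, Real.volume_pi_Ico]
  simp

theorem norm_le_card_of_abs_le {d : ℕ} (x : Rd d) {c : ℝ} (h : ∀ i, |x i| ≤ c) :
    ‖x‖ ≤ d * c := by
  have h0 : x = ∑ i, x i • EuclideanSpace.single i (1 : ℝ) := by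
    ext j; simp [Finset.sum_apply, Pi.single_apply]
  rw [h0]
  refine (norm_sum_le _ _).trans ((Finset.sum_le_card_nsmul _ _ c fun i _ => ?_).trans (by simp))
  simpa [norm_smul] using h i

theorem norm_sub_intPart_le {d : ℕ} (x : Rd d) : ‖x - latticePoint (intPart x)‖ ≤ d := by
  refine (norm_le_card_of_abs_le (c := 1) _ fun i => ?_).trans (by simp)
  change |x i - ⌊x i⌋| ≤ 1
  rw [abs_of_nonneg (by linarith [Int.floor_le (x i)])]
  linarith [Int.lt_floor_add_one (x i)]

theorem summable_lattice {d N : ℕ} (hN : d < N) :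
    Summable fun k : Fin d → ℤ => ((1 + ‖latticePoint k‖) ^ N)⁻¹ := by
  suffices hint : Integrable (fun k : Fin d → ℤ => ((1 + ‖latticePoint k‖) ^ N)⁻¹)
      Measure.count from (integrable_count_iff.1 hint).of_norm
  rw [← measurePreserving_intPart.integrable_comp
    (measurable_of_countable _).aestronglyMeasurable]
  have h := (integrable_one_add_norm (E := Rd d) (μ := volume) (r := N) (by simpa using hN))
  refine (h.const_mul (((1 : ℝ) + d) ^ N)).mono'
    ((measurable_of_countable _).comp measurable_intPart).aestronglyMeasurable (.of_forall fun x => ?_)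
  have h1 := one_add_norm_le_mul (latticePoint (intPart x)) x
  have h2 := norm_sub_intPart_le x
  rw [norm_sub_rev] at h2
  have h3 : 1 + ‖x‖ ≤ (1 + ‖latticePoint (intPart x)‖) * (1 + d) := h1.trans (by gcongr)
  rw [Real.rpow_neg (by positivity), Real.rpow_natCast, Function.comp_apply, norm_inv, norm_pow,
    Real.norm_of_nonneg (by positivity), ← div_eq_mul_inv, inv_eq_one_div,
    div_le_div_iff₀ (by positivity) (by positivity), one_mul, ← mul_pow]
  exact pow_le_pow_left₀ (by positivity) (by linarith) N

theorem finite_lattice_box {d : ℕ} (x : Rd d) (R : ℝ) :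
    {k : Fin d → ℤ | ∀ i, |x i - k i| ≤ R}.Finite := by
  refine (Set.Finite.pi' fun i => Set.finite_Icc (⌈x i - R⌉) (⌊x i + R⌋)).subset fun k hk i => ?_
  have h := abs_le.1 (hk i)
  exact ⟨Int.ceil_le.2 (by linarith), Int.le_floor.2 (by linarith)⟩

/-! ### Modulations and the Fourier transform -/

theorem character_apply_add {d : ℕ} (ξ s t : Rd d) :
    character ξ (s + t) = character ξ s * character ξ t := by
  simp only [character, ← Complex.exp_add, inner_add_left]
  congr 1; push_cast; ring

theorem norm_character {d : ℕ} (ξ t : Rd d) : ‖character ξ t‖ = 1 := by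
  have h3 : (2 * Real.pi * Complex.I * (inner ℝ t ξ : ℝ) : ℂ) =
      ((2 * Real.pi * inner ℝ t ξ : ℝ) : ℂ) * Complex.I := by
    push_cast; ring
  rw [character, h3, Complex.norm_exp_ofReal_mul_I]

theorem conj_character {d : ℕ} (ξ t : Rd d) :
    (starRingEnd ℂ) (character ξ t) = character (-ξ) t := by
  simp only [character, ← Complex.exp_conj, inner_neg_right]
  congr 1
  simp only [map_mul, Complex.conj_ofReal, Complex.conj_I, Complex.conj_ofNat]
  push_cast; ring

/-- The modulation `M_ξ` of Schwartz functions. -/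
abbrev md {d : ℕ} (ξ : Rd d) : 𝓢(Rd d, ℂ) →L[ℂ] 𝓢(Rd d, ℂ) :=
  SchwartzMap.smulLeftCLM ℂ (character ξ)

theorem md_apply {d : ℕ} (ξ : Rd d) (ψ : 𝓢(Rd d, ℂ)) (x : Rd d) :
    md ξ ψ x = character ξ x * ψ x := by
  simp [SchwartzMap.smulLeftCLM_apply_apply (character_hasTemperateGrowth ξ)]

theorem fourier_schwartz_apply {d : ℕ} (ψ : 𝓢(Rd d, ℂ)) (w : Rd d) :
    (𝓕 ψ) w = ∫ t, character (-w) t * ψ t := by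
  rw [SchwartzMap.fourier_coe, Real.fourier_eq']
  refine integral_congr_ae (.of_forall fun t => ?_)
  simp only [character, smul_eq_mul, inner_neg_right]
  congr 2; push_cast; ring

theorem fourier_md {d : ℕ} (ξ : Rd d) (ψ : 𝓢(Rd d, ℂ)) : 𝓕 (md ξ ψ) = tr ξ (𝓕 ψ) := by
  ext w
  rw [tr_apply, fourier_schwartz_apply, fourier_schwartz_apply]
  refine integral_congr_ae (.of_forall fun t => ?_)
  simp only [md_apply, ← mul_assoc]
  congr 1
  simp only [character, ← Complex.exp_add, inner_neg_right, inner_sub_right]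
  congr 1; push_cast; ring

theorem exists_SN_md_le {d : ℕ} (m : ℕ) : ∃ n : ℕ, ∃ C > 0, ∀ (ξ : Rd d) (ψ : 𝓢(Rd d, ℂ)),
    SN m (md ξ ψ) ≤ C * (1 + ‖ξ‖) ^ n * SN n ψ := by
  obtain ⟨m₁, C₁, hC₁, h₁⟩ := exists_SN_comp_le
    (FourierTransform.fourierInvCLM ℂ 𝓢(Rd d, ℂ)) m
  obtain ⟨m₂, C₂, hC₂, h₂⟩ := exists_SN_comp_le
    (FourierTransform.fourierCLM ℂ 𝓢(Rd d, ℂ)) m₁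
  refine ⟨max m₁ m₂, C₁ * 2 ^ m₁ * C₂, by positivity, fun ξ ψ => ?_⟩
  have e : md ξ ψ = FourierTransform.fourierInvCLM ℂ 𝓢(Rd d, ℂ) (tr ξ (𝓕 ψ)) := by
    rw [← fourier_md]; simp
  have h3 : SN m₁ (𝓕 ψ) ≤ C₂ * SN m₂ ψ := h₂ ψ
  have h4 : 1 ≤ 1 + ‖ξ‖ := by linarith [norm_nonneg ξ]
  calc SN m (md ξ ψ) ≤ C₁ * SN m₁ (tr ξ (𝓕 ψ)) := by rw [e]; exact h₁ _
    _ ≤ C₁ * (2 ^ m₁ * (1 + ‖ξ‖) ^ m₁ * (C₂ * SN m₂ ψ)) := by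
      gcongr
      exact (SN_tr_le m₁ _ ξ).trans (by gcongr)
    _ ≤ C₁ * (2 ^ m₁ * (1 + ‖ξ‖) ^ (max m₁ m₂) * (C₂ * SN (max m₁ m₂) ψ)) := by
      gcongr
      · exact le_max_left _ _
      · exact SN_mono (le_max_right _ _) ψ
    _ = _ := by ring

/-! ### Fourier series of Schwartz functions supported in a cube -/

/-- The points of the lattice `(1/2) ℤ^d`, which is dual to `2 ℤ^d`. -/
def halfLattice {d : ℕ} (n : Fin d → ℤ) : Rd d := (2⁻¹ : ℝ) • latticePoint n

theorem norm_halfLattice {d : ℕ} (n : Fin d → ℤ) :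
    ‖halfLattice n‖ = 2⁻¹ * ‖latticePoint n‖ := by
  rw [halfLattice, norm_smul]; norm_num

theorem one_add_norm_halfLattice_le {d : ℕ} (n : Fin d → ℤ) :
    1 + ‖halfLattice n‖ ≤ 1 + ‖latticePoint n‖ := by
  rw [norm_halfLattice]; linarith [norm_nonneg (latticePoint n)]

theorem le_one_add_norm_halfLattice {d : ℕ} (n : Fin d → ℤ) :
    1 + ‖latticePoint n‖ ≤ 2 * (1 + ‖halfLattice n‖) := by
  rw [norm_halfLattice]; linarith [norm_nonneg (latticePoint n)]

/-- The Fourier coefficients, on the cube `(-1, 1)^d`. -/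
def fourierCoeffCube {d : ℕ} (h : 𝓢(Rd d, ℂ)) (n : Fin d → ℤ) : ℂ :=
  (2⁻¹ : ℂ) ^ d * (𝓕 h) (halfLattice n)

theorem exists_fourierCoeffCube_le (d N : ℕ) : ∃ m : ℕ, ∃ C > 0, ∀ (h : 𝓢(Rd d, ℂ)) (n : Fin d → ℤ),
    ‖fourierCoeffCube h n‖ ≤ C * ((1 + ‖latticePoint n‖) ^ N)⁻¹ * SN m h := by
  obtain ⟨m, C, hC, hb⟩ := exists_SN_comp_le (FourierTransform.fourierCLM ℂ 𝓢(Rd d, ℂ)) N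
  refine ⟨m, 2 ^ N * 2 ^ N * C, by positivity, fun h n => ?_⟩
  have h1 := norm_apply_le_SN (le_refl N) (𝓕 h) (halfLattice n)
  have h2 : SN N (𝓕 h) ≤ C * SN m h := hb h
  have h3 : ‖fourierCoeffCube h n‖ ≤ ‖(𝓕 h) (halfLattice n)‖ := by
    rw [fourierCoeffCube, norm_mul]
    refine mul_le_of_le_one_left (norm_nonneg _) ?_
    rw [norm_pow]; exact pow_le_one₀ (norm_nonneg _) (by norm_num)
  refine h3.trans ?_
  rw [mul_assoc, mul_comm _ (SN m h), ← mul_assoc, ← div_eq_mul_inv, le_div_iff₀ (by positivity)]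
  calc ‖(𝓕 h) (halfLattice n)‖ * (1 + ‖latticePoint n‖) ^ N
      ≤ ‖(𝓕 h) (halfLattice n)‖ * (2 * (1 + ‖halfLattice n‖)) ^ N := by
        gcongr; exact le_one_add_norm_halfLattice n
    _ = 2 ^ N * ((1 + ‖halfLattice n‖) ^ N * ‖(𝓕 h) (halfLattice n)‖) := by rw [mul_pow]; ring
    _ ≤ 2 ^ N * (2 ^ N * (C * SN m h)) :=
        mul_le_mul_of_nonneg_left (h1.trans (by gcongr)) (by positivity)
    _ = _ := by ring

theorem mFourier_coe {d : ℕ} (n : Fin d → ℤ) (y : Fin d → ℝ) :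
    UnitAddTorus.mFourier n (fun i => (y i : UnitAddCircle)) =
      character (halfLattice n) ((2 : ℝ) • WithLp.toLp 2 y) := by
  have h : inner ℝ ((2 : ℝ) • WithLp.toLp 2 y) (halfLattice n) = ∑ i, (n i : ℝ) * y i := by
    rw [halfLattice, inner_smul_left, inner_smul_right]
    simp [PiLp.inner_apply, latticePoint_apply]
  rw [character, h]
  change ∏ i, fourier (n i) ((y i : ℝ) : UnitAddCircle) = _
  simp only [fourier_coe_apply, ← Complex.exp_sum]
  congr 1
  push_cast
  rw [Finset.mul_sum]
  refine Finset.sum_congr rfl fun i _ => by simp; ring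

/-- The Fourier series of a Schwartz function that is supported in the cube `(-1, 1)^d`. -/
theorem hasSum_fourierCoeffCube {d : ℕ} (h : 𝓢(Rd d, ℂ)) (hs : ∀ t, h t ≠ 0 → ∀ i, |t i| < 1)
    (t : Rd d) (ht : ∀ i, |t i| < 1) :
    HasSum (fun n => fourierCoeffCube h n * character (halfLattice n) t) (h t) := by
  let u : (Fin d → ℤ) → (Fin d → ℝ) → ℂ := fun k y =>
    h ((2 : ℝ) • (WithLp.toLp 2 y - latticePoint k))
  have hu0 : ∀ k y, u k y ≠ 0 → ∀ i, |y i - k i| < 1 / 2 := fun k y hk i => by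
    have h1 : |2 * (y i - k i)| < 1 := hs _ hk i
    rw [abs_mul, abs_two] at h1
    linarith
  have hucont : ∀ k, Continuous (u k) := fun k => h.continuous.comp
    (by fun_prop)
  have hulf : LocallyFinite fun k => Function.support (u k) := fun y => by
    refine ⟨Metric.ball y 1, Metric.ball_mem_nhds y one_pos,
      (finite_lattice_box (WithLp.toLp 2 y) 2).subset ?_⟩
    rintro k ⟨w, hw, hwy⟩ i
    have h1 := hu0 k w hw i
    have h2 : |w i - y i| < 1 := lt_of_le_of_lt (norm_le_pi_norm (w - y) i) (by
      simpa [dist_eq_norm] using hwy)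
    have h3 : (WithLp.toLp 2 y) i - (k i : ℝ) = (w i - k i) - (w i - y i) := by
      change y i - _ = _; ring
    rw [h3]
    exact (abs_sub _ _).trans (by linarith)
  let P : (Fin d → ℝ) → ℂ := fun y => ∑ᶠ k, u k y
  have hPcont : Continuous P := continuous_finsum hucont hulf
  have hPeq : ∀ y : Fin d → ℝ, (∀ i, |y i| ≤ 1 / 2) → P y = h ((2 : ℝ) • WithLp.toLp 2 y) := by
    intro y hy
    have h1 : P y = u 0 y := finsum_eq_single _ 0 fun k hk => by
      by_contra hne
      apply hk
      funext i
      have h1 := hu0 k y hne i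
      have h2 := hy i
      have h3 : |(k i : ℝ)| < 1 := by
        have : (k i : ℝ) = y i - (y i - k i) := by ring
        rw [this]
        exact lt_of_le_of_lt (abs_sub _ _) (by linarith)
      have h4 : |k i| < 1 := by exact_mod_cast h3
      simpa using Int.abs_lt_one_iff.1 h4
    rw [h1]
    simp only [u, latticePoint_zero, sub_zero]
  have hPper : ∀ (y : Fin d → ℝ) (n : Fin d → ℤ), P (fun i => y i + n i) = P y := by
    intro y n
    refine (finsum_comp_equiv (Equiv.addRight n) (f := fun k => u k (fun i => y i + n i))).symm.trans ?_
    refine finsum_congr fun k => ?_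
    simp only [u]
    congr 2
    ext i
    simp [latticePoint_apply]
  let q : (Fin d → ℝ) → UnitAddTorus (Fin d) := Pi.map fun _ x => (x : UnitAddCircle)
  have hq : IsOpenQuotientMap q :=
    IsOpenQuotientMap.piMap fun _ => QuotientAddGroup.isOpenQuotientMap_mk
  have hqP : ∀ a b, q a = q b → P a = P b := by
    intro a b hab
    have h1 : ∀ i, ∃ n : ℤ, a i = b i + n := fun i => by
      have h2 : ((a i : ℝ) : UnitAddCircle) = (b i : ℝ) := congrFun hab i
      obtain ⟨n, hn⟩ := AddSubgroup.mem_zmultiples_iff.1 (QuotientAddGroup.eq.1 h2)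
      refine ⟨-n, ?_⟩
      simp only [zsmul_eq_mul, mul_one] at hn
      push_cast
      linarith
    choose n hn using h1
    rw [← hPper b n]
    congr 1
    funext i
    exact hn i
  let Q : UnitAddTorus (Fin d) → ℂ := fun z => P (Function.surjInv hq.surjective z)
  have hQq : ∀ y, Q (q y) = P y := fun y => hqP _ _ (Function.surjInv_eq hq.surjective (q y))
  have hQcont : Continuous Q := by
    rw [← hq.continuous_comp_iff]
    exact hPcont.congr fun y => (hQq y).symm
  have hcoef : ∀ n, UnitAddTorus.mFourierCoeff Q n = fourierCoeffCube h n := by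
    intro n
    rw [UnitAddTorus.mFourierCoeff_eq_integral Q n (fun _ => -(1 / 2))]
    have e1 : ∀ y : Fin d → ℝ, (∀ i, |y i| ≤ 1 / 2) →
        UnitAddTorus.mFourier (-n) (fun i => (y i : UnitAddCircle)) • Q (fun i => (y i : UnitAddCircle)) =
        character (-halfLattice n) ((2 : ℝ) • WithLp.toLp 2 y) * h ((2 : ℝ) • WithLp.toLp 2 y) := by
      intro y hy
      have e2 : Q (fun i => (y i : UnitAddCircle)) = P y := hQq y
      rw [e2, hPeq y hy, UnitAddTorus.mFourier_neg, mFourier_coe, conj_character, smul_eq_mul]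
    rw [setIntegral_congr_fun (g := fun y => character (-halfLattice n) ((2 : ℝ) • WithLp.toLp 2 y) *
        h ((2 : ℝ) • WithLp.toLp 2 y)) ?_ ?_]
    · rw [setIntegral_eq_integral_of_forall_compl_eq_zero]
      · have e3 := (PiLp.volume_preserving_toLp (Fin d)).integral_comp
          (MeasurableEquiv.toLp 2 (Fin d → ℝ)).measurableEmbedding
          (fun t : Rd d => character (-halfLattice n) ((2 : ℝ) • t) * h ((2 : ℝ) • t))
        rw [e3, Measure.integral_comp_smul volume
          (fun t : Rd d => character (-halfLattice n) t * h t) 2, fourierCoeffCube,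
          fourier_schwartz_apply]
        simp [abs_of_pos]
      · intro y hy
        by_contra hne
        apply hy
        intro i
        have h1 : |2 * y i| < 1 := hs _ (right_ne_zero_of_mul hne) i
        rw [abs_lt] at h1
        exact ⟨by linarith, by linarith⟩
    · have : {x : Fin d → ℝ | ∀ i, x i ∈ Set.Ioc (-(1 / 2) : ℝ) (-(1 / 2) + 1)} =
          Set.pi Set.univ fun _ => Set.Ioc (-(1 / 2) : ℝ) (-(1 / 2) + 1) := by
        ext x; simp
      rw [this]
      exact MeasurableSet.univ_pi fun i => measurableSet_Ioc
    · intro y hy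
      exact e1 y fun i => abs_le.2 ⟨(hy i).1.le, by linarith [(hy i).2]⟩
  obtain ⟨m, C, hC, hb⟩ := exists_fourierCoeffCube_le d (d + 1)
  have hsum : Summable (UnitAddTorus.mFourierCoeff Q) := by
    refine Summable.of_norm_bounded (((summable_lattice (Nat.lt_succ_self d)).mul_left C).mul_right
      (SN m h)) fun n => ?_
    rw [hcoef]
    exact hb h n
  have key := UnitAddTorus.hasSum_mFourier_series_apply_of_summable (f := ⟨Q, hQcont⟩) hsum
    (q fun i => t i / 2)
  have e4 : (2 : ℝ) • WithLp.toLp 2 (fun i => t i / 2) = t := by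
    ext i; simp; ring
  have e5 : (⟨Q, hQcont⟩ : C(UnitAddTorus (Fin d), ℂ)) (q fun i => t i / 2) = h t := by
    change Q _ = _
    rw [hQq, hPeq _ fun i => ?_, e4]
    rw [abs_div, abs_two]
    linarith [ht i]
  rw [e5] at key
  refine key.congr_fun ?_
  intro n
  have e6 : UnitAddTorus.mFourier n (q fun i => t i / 2) = character (halfLattice n) t := by
    exact (mFourier_coe n _).trans (by rw [e4])
  change _ = UnitAddTorus.mFourierCoeff Q n • _
  rw [hcoef, e6, smul_eq_mul]

/-! ### Products with tempered distributions -/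

/-- The product of a Schwartz function and a tempered distribution. -/
abbrev mulD {d : ℕ} (h : 𝓢(Rd d, ℂ)) : 𝓢'(Rd d, ℂ) →L[ℂ] 𝓢'(Rd d, ℂ) :=
  TemperedDistribution.smulLeftCLM ℂ h

theorem mulD_apply {d : ℕ} (h : 𝓢(Rd d, ℂ)) (f : 𝓢'(Rd d, ℂ)) (ψ : 𝓢(Rd d, ℂ)) :
    mulD h f ψ = f (mulS h ψ) := rfl

theorem hasSum_tempered {d : ℕ} {ι : Type*} (f : 𝓢'(Rd d, ℂ)) {u : ι → 𝓢(Rd d, ℂ)} {v : 𝓢(Rd d, ℂ)}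
    (h : HasSum u v) : HasSum (fun i => f (u i)) (f v) :=
  h.map f (map_continuous f)

theorem mulD_mulD {d : ℕ} (h k : 𝓢(Rd d, ℂ)) (f : 𝓢'(Rd d, ℂ)) :
    mulD h (mulD k f) = mulD (mulS h k) f := by
  ext ψ
  simp only [mulD_apply, mulS_assoc, mulS_comm h k]

theorem translate_apply {d : ℕ} (a : Rd d) (f : 𝓢'(Rd d, ℂ)) (ψ : 𝓢(Rd d, ℂ)) :
    translate a f ψ = f (tr (-a) ψ) := rfl

theorem modulate_apply {d : ℕ} (ξ : Rd d) (f : 𝓢'(Rd d, ℂ)) (ψ : 𝓢(Rd d, ℂ)) :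
    modulate ξ f ψ = f (md ξ ψ) := rfl

theorem md_mulS {d : ℕ} (ξ : Rd d) (h ψ : 𝓢(Rd d, ℂ)) : md ξ (mulS h ψ) = mulS h (md ξ ψ) := by
  ext x; simp only [md_apply, mulS_apply]; ring

theorem modulate_mulD {d : ℕ} (ξ : Rd d) (h : 𝓢(Rd d, ℂ)) (f : 𝓢'(Rd d, ℂ)) :
    modulate ξ (mulD h f) = mulD h (modulate ξ f) := by
  ext ψ
  simp only [modulate_apply, mulD_apply, md_mulS]

/-! ### The partition of unity -/

/-- The function `T_k φ` of the partition of unity generated by `φ`. -/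
def pu {d : ℕ} (φ : Test d) (k : Fin d → ℤ) : 𝓢(Rd d, ℂ) := tr (latticePoint k) (testToSchwartz φ)

theorem pu_apply {d : ℕ} (φ : Test d) (k : Fin d → ℤ) (x : Rd d) :
    pu φ k x = (φ (x - latticePoint k) : ℂ) := rfl

theorem tr_pu {d : ℕ} (φ : Test d) (j k : Fin d → ℤ) :
    tr (latticePoint j) (pu φ k) = pu φ (j + k) := by
  rw [pu, pu, tr_tr, latticePoint_add]

theorem exists_SN_pu_mulS_le {d : ℕ} (φ : Test d) (m N : ℕ) : ∃ n : ℕ, ∃ C > 0, ∀ k (ψ : 𝓢(Rd d, ℂ)),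
    SN m (mulS (pu φ k) ψ) ≤ C * ((1 + ‖latticePoint k‖) ^ N)⁻¹ * SN n ψ := by
  refine ⟨m + N, 2 ^ m * 4 ^ (m + N) * SN (m + N) (testToSchwartz φ) + 1, by positivity,
    fun k ψ => ?_⟩
  have h := SN_mulS_tr_le m N ψ (testToSchwartz φ) (latticePoint k)
  rw [mulS_comm, mul_assoc, mul_comm _ (SN _ ψ), ← mul_assoc, ← div_eq_mul_inv,
    le_div_iff₀ (by positivity)]
  refine h.trans ?_
  nlinarith [apply_nonneg (SN (m + N)) ψ]

theorem hasSum_pu_mulS {d : ℕ} {φ : Test d} (hφ : IsPartitionGenerator φ) (ψ : 𝓢(Rd d, ℂ)) :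
    HasSum (fun k => mulS (pu φ k) ψ) ψ := by
  refine hasSum_schwartz (fun m => ?_) fun x => ?_
  · obtain ⟨n, C, hC, h⟩ := exists_SN_pu_mulS_le φ m (d + 1)
    exact (((summable_lattice (Nat.lt_succ_self d)).mul_left C).mul_right (SN n ψ)).of_nonneg_of_le
      (fun k => apply_nonneg _ _) fun k => h k ψ
  · have h1 := ((Complex.hasSum_ofReal).2 (hφ.hasSum x)).mul_right (ψ x)
    simpa [mulS_apply, pu_apply] using h1

/-- The real part of a compactly supported Schwartz function, as a test function. -/
def testRe {d : ℕ} (ψ : 𝓢(Rd d, ℂ)) (h : HasCompactSupport ψ) : Test d where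
  toFun x := (ψ x).re
  contDiff' := Complex.reCLM.contDiff.comp (ψ.smooth ⊤)
  hasCompactSupport' := h.comp_left (g := Complex.re) rfl
  tsupport_subset' := fun _ _ => Set.mem_univ _

/-- The imaginary part of a compactly supported Schwartz function, as a test function. -/
def testIm {d : ℕ} (ψ : 𝓢(Rd d, ℂ)) (h : HasCompactSupport ψ) : Test d where
  toFun x := (ψ x).im
  contDiff' := Complex.imCLM.contDiff.comp (ψ.smooth ⊤)
  hasCompactSupport' := h.comp_left (g := Complex.im) rfl
  tsupport_subset' := fun _ _ => Set.mem_univ _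

theorem eq_testRe_add_testIm {d : ℕ} (ψ : 𝓢(Rd d, ℂ)) (h : HasCompactSupport ψ) :
    ψ = testToSchwartz (testRe ψ h) + Complex.I • testToSchwartz (testIm ψ h) := by
  ext x
  change ψ x = ((ψ x).re : ℂ) + Complex.I * ((ψ x).im : ℂ)
  rw [mul_comm, Complex.re_add_im]

theorem hasCompactSupport_testToSchwartz {d : ℕ} (φ : Test d) :
    HasCompactSupport (testToSchwartz φ) :=
  φ.hasCompactSupport.comp_left (g := fun r : ℝ => (r : ℂ)) Complex.ofReal_zero

theorem hasCompactSupport_pu {d : ℕ} (φ : Test d) (k : Fin d → ℤ) : HasCompactSupport (pu φ k) :=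
  hasCompactSupport_testToSchwartz (testTranslate (latticePoint k) φ)

theorem hasCompactSupport_mulS {d : ℕ} {h : 𝓢(Rd d, ℂ)} (hh : HasCompactSupport h)
    (ψ : 𝓢(Rd d, ℂ)) : HasCompactSupport (mulS h ψ) := by
  rw [show ⇑(mulS h ψ) = fun x => h x * ψ x from funext fun x => mulS_apply _ _ x]
  exact hh.mul_right

/-- Tempered distributions are determined by their values on test functions. -/
theorem tempered_ext {d : ℕ} {φ : Test d} (hφ : IsPartitionGenerator φ) {f g : 𝓢'(Rd d, ℂ)}
    (h : ∀ ψ : Test d, f (testToSchwartz ψ) = g (testToSchwartz ψ)) : f = g := by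
  ext ψ
  have hk : ∀ k, f (mulS (pu φ k) ψ) = g (mulS (pu φ k) ψ) := fun k => by
    rw [eq_testRe_add_testIm _ (hasCompactSupport_mulS (hasCompactSupport_pu φ k) ψ)]
    simp only [map_add, map_smul, h]
  exact (hasSum_tempered f (hasSum_pu_mulS hφ ψ)).unique
    ((hasSum_tempered g (hasSum_pu_mulS hφ ψ)).congr_fun hk)

theorem testMul_apply {d : ℕ} (χ ψ : Test d) (x : Rd d) : testMul χ ψ x = χ x * ψ x := rfl

theorem isProduct_mulD {d : ℕ} (χ : Test d) (f : 𝓢'(Rd d, ℂ)) :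
    IsProduct χ (restr f) (mulD (testToSchwartz χ) f) := fun ψ => by
  rw [mulD_apply]
  change _ = f (testToSchwartz (testMul χ ψ))
  congr 1
  ext x
  rw [mulS_apply, testToSchwartz_apply, testToSchwartz_apply, testToSchwartz_apply,
    testMul_apply, Complex.ofReal_mul]

theorem IsProduct.unique {d : ℕ} {φ : Test d} (hφ : IsPartitionGenerator φ) {χ : Test d} {u : Dist d}
    {e e' : 𝓢'(Rd d, ℂ)} (h : IsProduct χ u e) (h' : IsProduct χ u e') : e = e' :=
  tempered_ext hφ fun ψ => (h ψ).trans (h' ψ).symm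

theorem localENorm_eq {d : ℕ} {φ : Test d} (hφ : IsPartitionGenerator φ) (E : DistSpace d)
    {χ : Test d} {u : Dist d} {e : 𝓢'(Rd d, ℂ)} (h : IsProduct χ u e) :
    localENorm E χ u = E.eNorm e :=
  le_antisymm (iInf₂_le e h) (le_iInf₂ fun e' h' => by rw [h.unique hφ h'])

/-- `τ` is a cutoff function, supported in the cube `(-1, 1)^d`, that is `1` on the support of
`φ`. -/
structure IsCutoff {d : ℕ} (φ : Test d) (τ : 𝓢(Rd d, ℂ)) : Prop where
  supp : ∀ t, τ t ≠ 0 → ∀ i, |t i| < 1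
  one : ∀ t ∈ tsupport φ, τ t = 1

theorem IsPartitionGenerator.supp {d : ℕ} {φ : Test d} (hφ : IsPartitionGenerator φ) (t : Rd d)
    (ht : testToSchwartz φ t ≠ 0) (i : Fin d) : |t i| < 1 :=
  hφ.tsupport_subset (subset_tsupport _ fun h => ht (by rw [testToSchwartz_apply, h]; rfl)) i

theorem exists_isCutoff {d : ℕ} {φ : Test d} (hφ : IsPartitionGenerator φ) :
    ∃ τ, IsCutoff φ τ := by
  have hopen : IsOpen {x : Rd d | ∀ i, |x i| < 1} := by
    rw [Set.ofPred_forall]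
    exact isOpen_iInter_of_finite fun i => isOpen_lt (by fun_prop) continuous_const
  obtain ⟨f, h0, h1, -⟩ := exists_contMDiffMap_zero_one_of_isClosed (n := ⊤)
    (modelWithCornersSelf ℝ (Rd d)) hopen.isClosed_compl (isClosed_tsupport φ)
    (Set.disjoint_left.2 fun x hx hx' => hx (hφ.tsupport_subset hx'))
  have hs : ∀ t, f t ≠ 0 → ∀ i, |t i| < 1 := fun t ht => by
    by_contra hne
    exact ht (h0 hne)
  have hc : HasCompactSupport fun x => (f x : ℂ) := by
    refine HasCompactSupport.of_support_subset_isCompact (isCompact_closedBall (0 : Rd d) (d * 1))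
      fun t ht => ?_
    have := norm_le_card_of_abs_le t (c := 1) fun i => (hs t (fun h => ht (by simp [h])) i).le
    simpa using this
  refine ⟨hc.toSchwartzMap (Complex.ofRealCLM.contDiff.comp f.contMDiff.contDiff), ⟨fun t ht => ?_,
    fun t ht => ?_⟩⟩
  · exact hs t fun h => ht (by change ((f t : ℝ) : ℂ) = 0; rw [h]; rfl)
  · change ((f t : ℝ) : ℂ) = 1
    rw [h1 ht]; rfl

theorem IsCutoff.mulS_eq {d : ℕ} {φ : Test d} {τ : 𝓢(Rd d, ℂ)} (hτ : IsCutoff φ τ) :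
    mulS τ (testToSchwartz φ) = testToSchwartz φ := by
  ext x
  rw [mulS_apply]
  by_cases h : φ x = 0
  · rw [testToSchwartz_apply, h]; simp
  · rw [hτ.one x (subset_tsupport _ h), one_mul]

theorem IsCutoff.mulS_tr_eq {d : ℕ} {φ : Test d} {τ : 𝓢(Rd d, ℂ)} (hτ : IsCutoff φ τ)
    (k : Fin d → ℤ) : mulS (tr (latticePoint k) τ) (pu φ k) = pu φ k := by
  rw [pu, ← tr_mulS, hτ.mulS_eq]

/-! ### Atomic decompositions -/

/-- The Fourier series in a cube, with convergence in the Schwartz space. -/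
theorem hasSum_fourierCoeffCube_smul {d : ℕ} (h θ : 𝓢(Rd d, ℂ)) (hs : ∀ t, h t ≠ 0 → ∀ i, |t i| < 1)
    (hθ : ∀ t, θ t ≠ 0 → ∀ i, |t i| < 1) :
    HasSum (fun n => fourierCoeffCube h n • md (halfLattice n) θ) (mulS h θ) := by
  refine hasSum_schwartz (fun m => ?_) fun x => ?_
  · obtain ⟨n₁, C₁, hC₁, h₁⟩ := exists_SN_md_le (d := d) m
    obtain ⟨n₂, C₂, hC₂, h₂⟩ := exists_fourierCoeffCube_le d (n₁ + (d + 1))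
    refine (((summable_lattice (Nat.lt_succ_self d)).mul_left (C₂ * SN n₂ h * C₁)).mul_right
      (SN n₁ θ)).of_nonneg_of_le (fun k => apply_nonneg _ _) fun k => ?_
    rw [map_smul_eq_mul]
    have hpos : 0 < 1 + ‖latticePoint k‖ := by positivity
    calc ‖fourierCoeffCube h k‖ * SN m (md (halfLattice k) θ)
        ≤ (C₂ * ((1 + ‖latticePoint k‖) ^ (n₁ + (d + 1)))⁻¹ * SN n₂ h) *
          (C₁ * (1 + ‖latticePoint k‖) ^ n₁ * SN n₁ θ) := by
          gcongr
          · exact h₂ h k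
          · refine (h₁ (halfLattice k) θ).trans ?_
            gcongr C₁ * ?_ ^ n₁ * _
            exact one_add_norm_halfLattice_le k
      _ = _ := by
          rw [pow_add, mul_inv]
          field_simp
  · simp only [mulS_apply]
    by_cases hx : θ x = 0
    · simp only [hx, mul_zero]
      refine hasSum_zero.congr_fun fun n => ?_
      rw [smul_apply, md_apply, hx]; simp
    · refine ((hasSum_fourierCoeffCube h hs x (hθ x hx)).mul_right (θ x)).congr_fun fun n => ?_
      rw [smul_apply, md_apply, smul_eq_mul, mul_assoc]

/-- The coefficient functionals of the atomic decomposition. -/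
def atomCoeff {d : ℕ} (φ : Test d) (i : (Fin d → ℤ) × (Fin d → ℤ)) (ψ : 𝓢(Rd d, ℂ)) : ℂ :=
  fourierCoeffCube (mulS (testToSchwartz φ) (tr (-latticePoint i.1) ψ)) i.2

/-- The atoms of the atomic decomposition. -/
def atom {d : ℕ} (τ : 𝓢(Rd d, ℂ)) (i : (Fin d → ℤ) × (Fin d → ℤ)) : 𝓢(Rd d, ℂ) :=
  tr (latticePoint i.1) (md (halfLattice i.2) τ)

/-- The Schwartz functions that represent the coefficient functionals. -/
def atomDual {d : ℕ} (φ : Test d) (i : (Fin d → ℤ) × (Fin d → ℤ)) : 𝓢(Rd d, ℂ) :=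
  (2⁻¹ : ℂ) ^ d • tr (latticePoint i.1) (md (-halfLattice i.2) (testToSchwartz φ))

theorem atomCoeff_eq_integral {d : ℕ} (φ : Test d) (i : (Fin d → ℤ) × (Fin d → ℤ))
    (ψ : 𝓢(Rd d, ℂ)) : atomCoeff φ i ψ = ∫ t, atomDual φ i t * ψ t := by
  rw [atomCoeff, fourierCoeffCube, fourier_schwartz_apply, ← integral_const_mul,
    ← integral_sub_right_eq_self _ (latticePoint i.1)]
  refine integral_congr_ae (.of_forall fun t => ?_)
  simp only [atomDual, smul_apply, tr_apply, md_apply, mulS_apply, smul_eq_mul, sub_neg_eq_add,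
    sub_add_cancel]
  ring

theorem exists_atomCoeff_le {d : ℕ} (φ : Test d) (N : ℕ) : ∃ m : ℕ, ∃ C > 0,
    ∀ (i : (Fin d → ℤ) × (Fin d → ℤ)) (ψ : 𝓢(Rd d, ℂ)), ‖atomCoeff φ i ψ‖ ≤
      C * ((1 + ‖latticePoint i.1‖) ^ N)⁻¹ * ((1 + ‖latticePoint i.2‖) ^ N)⁻¹ * SN m ψ := by
  obtain ⟨m₁, C₁, hC₁, h₁⟩ := exists_fourierCoeffCube_le d N
  refine ⟨m₁ + N, C₁ * (2 ^ m₁ * 4 ^ (m₁ + N) * SN (m₁ + N) (testToSchwartz φ) + 1),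
    by positivity, fun i ψ => ?_⟩
  have h := SN_mulS_tr_le m₁ N (testToSchwartz φ) ψ (-latticePoint i.1)
  rw [norm_neg] at h
  have h2 : SN m₁ (mulS (testToSchwartz φ) (tr (-latticePoint i.1) ψ)) ≤
      (2 ^ m₁ * 4 ^ (m₁ + N) * SN (m₁ + N) (testToSchwartz φ) + 1) *
        ((1 + ‖latticePoint i.1‖) ^ N)⁻¹ * SN (m₁ + N) ψ := by
    rw [mul_assoc, mul_comm _ (SN _ ψ), ← mul_assoc, ← div_eq_mul_inv, le_div_iff₀ (by positivity)]
    refine h.trans ?_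
    nlinarith [apply_nonneg (SN (m₁ + N)) ψ]
  refine (h₁ _ i.2).trans ((mul_le_mul_of_nonneg_left h2 (by positivity)).trans (le_of_eq ?_))
  ring

theorem exists_SN_atom_le {d : ℕ} (τ : 𝓢(Rd d, ℂ)) (m : ℕ) : ∃ n : ℕ, ∃ C > 0,
    ∀ i : (Fin d → ℤ) × (Fin d → ℤ), SN m (atom τ i) ≤
      C * (1 + ‖latticePoint i.1‖) ^ n * (1 + ‖latticePoint i.2‖) ^ n := by
  obtain ⟨n, C, hC, h⟩ := exists_SN_md_le (d := d) m
  refine ⟨max m n, 2 ^ m * C * (SN n τ + 1), by positivity, fun i => ?_⟩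
  have h1 : 1 ≤ 1 + ‖latticePoint i.1‖ := by linarith [norm_nonneg (latticePoint i.1)]
  have h2 : 1 ≤ 1 + ‖latticePoint i.2‖ := by linarith [norm_nonneg (latticePoint i.2)]
  calc SN m (atom τ i) ≤ 2 ^ m * (1 + ‖latticePoint i.1‖) ^ m * SN m (md (halfLattice i.2) τ) :=
        SN_tr_le m _ _
    _ ≤ 2 ^ m * (1 + ‖latticePoint i.1‖) ^ (max m n) *
        (C * (1 + ‖latticePoint i.2‖) ^ (max m n) * (SN n τ + 1)) := by
      gcongr 2 ^ m * ?_ * ?_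
      · exact pow_le_pow_right₀ h1 (le_max_left _ _)
      · refine (h (halfLattice i.2) τ).trans ?_
        gcongr C * ?_ * ?_
        · exact (pow_le_pow_left₀ (by positivity) (one_add_norm_halfLattice_le _) n).trans
            (pow_le_pow_right₀ h2 (le_max_right _ _))
        · linarith
    _ = _ := by ring

theorem summable_lattice_prod (d : ℕ) : Summable fun i : (Fin d → ℤ) × (Fin d → ℤ) =>
    ((1 + ‖latticePoint i.1‖) ^ (d + 1))⁻¹ * ((1 + ‖latticePoint i.2‖) ^ (d + 1))⁻¹ :=
  (summable_lattice (Nat.lt_succ_self d)).mul_of_nonneg (summable_lattice (Nat.lt_succ_self d))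
    (fun _ => by positivity) (fun _ => by positivity)

theorem exists_atomCoeff_mul_SN_atom_le {d : ℕ} (φ : Test d) (τ : 𝓢(Rd d, ℂ)) (m : ℕ) :
    ∃ n : ℕ, ∃ C > 0, ∀ (i : (Fin d → ℤ) × (Fin d → ℤ)) (ψ : 𝓢(Rd d, ℂ)),
      ‖atomCoeff φ i ψ‖ * SN m (atom τ i) ≤
        C * (((1 + ‖latticePoint i.1‖) ^ (d + 1))⁻¹ * ((1 + ‖latticePoint i.2‖) ^ (d + 1))⁻¹) *
          SN n ψ := by
  obtain ⟨n₁, C₁, hC₁, h₁⟩ := exists_SN_atom_le τ m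
  obtain ⟨n₂, C₂, hC₂, h₂⟩ := exists_atomCoeff_le φ (n₁ + (d + 1))
  refine ⟨n₂, C₁ * C₂, by positivity, fun i ψ => ?_⟩
  refine (mul_le_mul (h₂ i ψ) (h₁ i) (apply_nonneg _ _) (by positivity)).trans (le_of_eq ?_)
  have p1 : 0 < 1 + ‖latticePoint i.1‖ := by positivity
  have p2 : 0 < 1 + ‖latticePoint i.2‖ := by positivity
  rw [pow_add (1 + ‖latticePoint i.1‖), pow_add (1 + ‖latticePoint i.2‖), mul_inv, mul_inv]
  field_simp

/-- The atomic decomposition of Schwartz functions. -/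
theorem hasSum_atomCoeff_smul_atom {d : ℕ} {φ : Test d} (hφ : IsPartitionGenerator φ)
    {τ : 𝓢(Rd d, ℂ)} (hτ : IsCutoff φ τ) (ψ : 𝓢(Rd d, ℂ)) :
    HasSum (fun i => atomCoeff φ i ψ • atom τ i) ψ := by
  have hsum : ∀ m, Summable fun i => SN m (atomCoeff φ i ψ • atom τ i) := fun m => by
    obtain ⟨n, C, hC, h⟩ := exists_atomCoeff_mul_SN_atom_le φ τ m
    refine (((summable_lattice_prod d).mul_left C).mul_right (SN n ψ)).of_nonneg_of_le
      (fun i => apply_nonneg _ _) fun i => ?_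
    rw [map_smul_eq_mul]
    exact h i ψ
  refine hasSum_schwartz hsum fun x => ?_
  have hsx : Summable fun i => (atomCoeff φ i ψ • atom τ i) x := by
    refine Summable.of_norm_bounded ((hsum 0).mul_left (2 ^ 0)) fun i => ?_
    simpa using norm_apply_le_SN (le_refl 0) (atomCoeff φ i ψ • atom τ i) x
  have hin : ∀ k, HasSum (fun n => (atomCoeff φ (k, n) ψ • atom τ (k, n)) x) (pu φ k x * ψ x) := by
    intro k
    have h1 := hasSum_fourierCoeffCube_smul
      (mulS (testToSchwartz φ) (tr (-latticePoint k) ψ)) τ (fun t ht => hφ.supp t fun h => ht (by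
        rw [mulS_apply, h, zero_mul])) hτ.supp
    have h2 := hasSum_tempered (TemperedDistribution.delta (x - latticePoint k)) h1
    have h3 : pu φ k x * ψ x =
        (mulS (mulS (testToSchwartz φ) (tr (-latticePoint k) ψ)) τ) (x - latticePoint k) := by
      rw [mulS_comm, ← mulS_assoc, hτ.mulS_eq, mulS_apply, tr_apply, pu_apply,
        testToSchwartz_apply]
      simp
    rw [h3]
    exact h2
  have h3 := hsx.hasSum.prod_fiberwise hin
  have h4 : HasSum (fun k => pu φ k x * ψ x) (ψ x) := by
    have h5 := hasSum_tempered (TemperedDistribution.delta x) (hasSum_pu_mulS hφ ψ)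
    refine h5.congr_fun fun k => ?_
    exact (mulS_apply (pu φ k) ψ x).symm
  rw [← h3.unique h4]
  exact hsx.hasSum

/-- The atomic decomposition of tempered distributions. -/
theorem hasSum_atomDecomposition {d : ℕ} {φ : Test d} (hφ : IsPartitionGenerator φ)
    {τ : 𝓢(Rd d, ℂ)} (hτ : IsCutoff φ τ) (f : 𝓢'(Rd d, ℂ)) (ψ : 𝓢(Rd d, ℂ)) :
    HasSum (fun i => f (atom τ i) * ∫ t, atomDual φ i t * ψ t) (f ψ) := by
  refine (hasSum_tempered f (hasSum_atomCoeff_smul_atom hφ hτ ψ)).congr_fun fun i => ?_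
  rw [← atomCoeff_eq_integral, map_smul, smul_eq_mul, mul_comm]

theorem exists_atomDecomposition_le {d : ℕ} (φ : Test d) (τ : 𝓢(Rd d, ℂ)) (f : 𝓢'(Rd d, ℂ)) :
    ∃ n : ℕ, ∃ C > 0, ∀ (i : (Fin d → ℤ) × (Fin d → ℤ)) (ψ : 𝓢(Rd d, ℂ)),
      ‖f (atom τ i) * ∫ t, atomDual φ i t * ψ t‖ ≤
        C * (((1 + ‖latticePoint i.1‖) ^ (d + 1))⁻¹ * ((1 + ‖latticePoint i.2‖) ^ (d + 1))⁻¹) *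
          SN n ψ := by
  obtain ⟨m, C₁, hC₁, h₁⟩ := exists_norm_temperedDistribution_le f
  obtain ⟨n, C₂, hC₂, h₂⟩ := exists_atomCoeff_mul_SN_atom_le φ τ m
  refine ⟨n, C₁ * C₂, by positivity, fun i ψ => ?_⟩
  rw [← atomCoeff_eq_integral, norm_mul]
  calc ‖f (atom τ i)‖ * ‖atomCoeff φ i ψ‖ ≤ C₁ * SN m (atom τ i) * ‖atomCoeff φ i ψ‖ := by
        gcongr; exact h₁ _
    _ = C₁ * (‖atomCoeff φ i ψ‖ * SN m (atom τ i)) := by ring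
    _ ≤ C₁ * _ := mul_le_mul_of_nonneg_left (h₂ i ψ) hC₁.le
    _ = _ := by ring

/-! ### The short-time Fourier transform -/

/-- The complex conjugate of a Schwartz function. -/
def conjS {d : ℕ} (g : 𝓢(Rd d, ℂ)) : 𝓢(Rd d, ℂ) :=
  SchwartzMap.postcompCLM (𝕜 := ℝ) (Complex.conjCLE : ℂ →L[ℝ] ℂ) g

theorem conjS_apply {d : ℕ} (g : 𝓢(Rd d, ℂ)) (x : Rd d) :
    conjS g x = (starRingEnd ℂ) (g x) := rfl

theorem conjTimeFreqShift_eq {d : ℕ} (g : 𝓢(Rd d, ℂ)) (x ξ : Rd d) :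
    conjTimeFreqShift g x ξ = md (-ξ) (tr x (conjS g)) := by
  ext t
  rw [conjTimeFreqShift_apply, md_apply, tr_apply, conjS_apply, map_mul, conj_character]

theorem exists_SN_conjTimeFreqShift_le {d : ℕ} (g : 𝓢(Rd d, ℂ)) (m : ℕ) : ∃ n : ℕ, ∃ C > 0,
    ∀ z : Rd d × Rd d, SN m (conjTimeFreqShift g z.1 z.2) ≤ C * (1 + ‖z‖) ^ n := by
  obtain ⟨n, C, hC, h⟩ := exists_SN_md_le (d := d) m
  refine ⟨n + n, C * (2 ^ n * (SN n (conjS g) + 1)), by positivity, fun z => ?_⟩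
  rw [conjTimeFreqShift_eq]
  refine (h _ _).trans ?_
  have h1 : 1 + ‖-z.2‖ ≤ 1 + ‖z‖ := by rw [norm_neg]; linarith [norm_snd_le z]
  have h2 : 1 + ‖z.1‖ ≤ 1 + ‖z‖ := by linarith [norm_fst_le z]
  calc C * (1 + ‖-z.2‖) ^ n * SN n (tr z.1 (conjS g))
      ≤ C * (1 + ‖z‖) ^ n * (2 ^ n * (1 + ‖z‖) ^ n * (SN n (conjS g) + 1)) := by
        refine mul_le_mul (by gcongr) ((SN_tr_le n _ _).trans ?_) (apply_nonneg _ _) (by positivity)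
        refine mul_le_mul (by gcongr) (by linarith) (apply_nonneg _ _) (by positivity)
    _ = _ := by rw [pow_add]; ring

theorem character_neg_comm {d : ℕ} (ξ t : Rd d) : character (-ξ) t = character (-t) ξ := by
  simp only [character, inner_neg_right, real_inner_comm]

theorem continuous_character_neg {d : ℕ} {X : Type*} [TopologicalSpace X] {a b : X → Rd d}
    (ha : Continuous a) (hb : Continuous b) : Continuous fun x => character (-(a x)) (b x) := by
  unfold character
  fun_prop

/-- The short-time Fourier transform of a Schwartz function. -/
theorem continuous_integral_conjTimeFreqShift {d : ℕ} (g v : 𝓢(Rd d, ℂ)) :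
    Continuous fun z : Rd d × Rd d => ∫ t, v t * conjTimeFreqShift g z.1 z.2 t := by
  have hb : ∀ x, ‖conjS g x‖ ≤ 2 ^ 0 * SN 0 (conjS g) := fun x => by
    simpa using norm_apply_le_SN (le_refl 0) (conjS g) x
  refine continuous_of_dominated (bound := fun t => ‖v t‖ * (2 ^ 0 * SN 0 (conjS g)))
    (fun z => ((v.continuous.mul (conjTimeFreqShift g z.1 z.2).continuous)).aestronglyMeasurable)
    (fun z => .of_forall fun t => ?_) (v.integrable.norm.mul_const _)
    (.of_forall fun t => ?_)
  · rw [conjTimeFreqShift_eq, norm_mul, md_apply, norm_mul, norm_character, one_mul]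
    exact mul_le_mul_of_nonneg_left (hb _) (norm_nonneg _)
  · simp only [conjTimeFreqShift_eq, md_apply, tr_apply]
    refine continuous_const.mul ((continuous_character_neg continuous_snd continuous_const).mul ?_)
    exact (conjS g).continuous.comp (continuous_const.sub continuous_fst)

theorem hasSum_stft {d : ℕ} {φ : Test d} (hφ : IsPartitionGenerator φ)
    {τ : 𝓢(Rd d, ℂ)} (hτ : IsCutoff φ τ) (g : 𝓢(Rd d, ℂ)) (f : 𝓢'(Rd d, ℂ)) (z : Rd d × Rd d) :
    HasSum (fun i => f (atom τ i) * ∫ t, atomDual φ i t * conjTimeFreqShift g z.1 z.2 t)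
      (stft g f z) :=
  hasSum_atomDecomposition hφ hτ f _

theorem measurable_stft {d : ℕ} {φ : Test d} (hφ : IsPartitionGenerator φ) (g : 𝓢(Rd d, ℂ))
    (f : 𝓢'(Rd d, ℂ)) : Measurable (stft g f) := by
  obtain ⟨τ, hτ⟩ := exists_isCutoff hφ
  refine measurable_of_tendsto_metrizable' (f := fun s : Finset ((Fin d → ℤ) × (Fin d → ℤ)) =>
    fun z : Rd d × Rd d => ∑ i ∈ s, f (atom τ i) *
      ∫ t, atomDual φ i t * conjTimeFreqShift g z.1 z.2 t) atTop (fun s => ?_) ?_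
  · exact (continuous_finsetSum _ fun i _ => continuous_const.mul
      (continuous_integral_conjTimeFreqShift g _)).measurable
  · exact tendsto_pi_nhds.2 fun z => hasSum_stft hφ hτ g f z

theorem exists_norm_stft_le {d : ℕ} (g : 𝓢(Rd d, ℂ)) (f : 𝓢'(Rd d, ℂ)) : ∃ n : ℕ, ∃ C > 0,
    ∀ z, ‖stft g f z‖ ≤ C * (1 + ‖z‖) ^ n := by
  obtain ⟨m, C₁, hC₁, h₁⟩ := exists_norm_temperedDistribution_le f
  obtain ⟨n, C₂, hC₂, h₂⟩ := exists_SN_conjTimeFreqShift_le g m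
  refine ⟨n, C₁ * C₂, by positivity, fun z => (h₁ _).trans ?_⟩
  rw [mul_assoc]
  exact mul_le_mul_of_nonneg_left (h₂ z) hC₁.le

theorem integrable_one_add_norm_prod (d : ℕ) :
    Integrable fun z : Rd d × Rd d => ((1 + ‖z‖) ^ (2 * d + 1))⁻¹ := by
  have : (volume : Measure (Rd d × Rd d)).IsAddHaarMeasure := by
    rw [Measure.volume_eq_prod]; infer_instance
  have h := integrable_one_add_norm (E := Rd d × Rd d) (μ := volume) (r := (2 * d + 1 : ℕ))
    (by simp; norm_cast; omega)
  refine h.congr (.of_forall fun z => ?_)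
  simp only []
  rw [Real.rpow_neg (by positivity), Real.rpow_natCast]

theorem pow_mul_norm_le {d n : ℕ} (Φ : 𝓢(Rd d × Rd d, ℂ)) (z : Rd d × Rd d) :
    (1 + ‖z‖) ^ n * ‖Φ z‖ ≤
      2 ^ (n + (2 * d + 1)) * SN (n + (2 * d + 1)) Φ * ((1 + ‖z‖) ^ (2 * d + 1))⁻¹ := by
  have h := norm_apply_le_SN (le_refl (n + (2 * d + 1))) Φ z
  rw [← div_eq_mul_inv, le_div_iff₀ (by positivity)]
  refine le_trans (le_of_eq ?_) h
  rw [pow_add]; ring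

theorem integrable_mul_schwartz {d : ℕ} {H : Rd d × Rd d → ℂ} (hH : Measurable H) {C : ℝ} {n : ℕ}
    (hb : ∀ z, ‖H z‖ ≤ C * (1 + ‖z‖) ^ n) (hC : 0 ≤ C) (Φ : 𝓢(Rd d × Rd d, ℂ)) :
    Integrable (fun z => H z * Φ z) ∧ ‖∫ z, H z * Φ z‖ ≤
      C * (2 ^ (n + (2 * d + 1)) * ∫ z : Rd d × Rd d, ((1 + ‖z‖) ^ (2 * d + 1))⁻¹) *
        SN (n + (2 * d + 1)) Φ := by
  have h1 : ∀ z, ‖H z * Φ z‖ ≤ C * (2 ^ (n + (2 * d + 1)) * SN (n + (2 * d + 1)) Φ) *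
      ((1 + ‖z‖) ^ (2 * d + 1))⁻¹ := fun z => by
    rw [norm_mul]
    calc ‖H z‖ * ‖Φ z‖ ≤ C * (1 + ‖z‖) ^ n * ‖Φ z‖ := by gcongr; exact hb z
      _ = C * ((1 + ‖z‖) ^ n * ‖Φ z‖) := by ring
      _ ≤ C * _ := mul_le_mul_of_nonneg_left (pow_mul_norm_le Φ z) hC
      _ = _ := by ring
  have h2 := (integrable_one_add_norm_prod d).const_mul
    (C * (2 ^ (n + (2 * d + 1)) * SN (n + (2 * d + 1)) Φ))
  refine ⟨h2.mono' (hH.mul Φ.continuous.measurable).aestronglyMeasurable (.of_forall h1), ?_⟩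
  refine (norm_integral_le_of_norm_le h2 (.of_forall h1)).trans (le_of_eq ?_)
  rw [integral_const_mul]; ring

/-- The short-time Fourier transform, as a tempered distribution. -/
theorem exists_stft_distribution {d : ℕ} {φ : Test d} (hφ : IsPartitionGenerator φ)
    (g : 𝓢(Rd d, ℂ)) (f : 𝓢'(Rd d, ℂ)) :
    ∃ U : 𝓢'(Rd d × Rd d, ℂ), ∀ Φ : 𝓢(Rd d × Rd d, ℂ), U Φ = ∫ z, stft g f z * Φ z := by
  obtain ⟨n, C, hC, h⟩ := exists_norm_stft_le g f
  have key := integrable_mul_schwartz (measurable_stft hφ g f) h hC.le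
  refine ⟨mkTempered (fun Φ => ∫ z, stft g f z * Φ z) (fun Φ Ψ => ?_) (fun c Φ => ?_)
    ⟨_, _, ?_, fun Φ => (key Φ).2⟩, fun Φ => rfl⟩
  · rw [← integral_add (key Φ).1 (key Ψ).1]
    refine integral_congr_ae (.of_forall fun z => ?_)
    simp only [add_apply, mul_add]
  · rw [← integral_const_mul]
    refine integral_congr_ae (.of_forall fun z => ?_)
    simp only [smul_apply, smul_eq_mul]
    ring
  · have : 0 ≤ ∫ z : Rd d × Rd d, ((1 + ‖z‖) ^ (2 * d + 1))⁻¹ :=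
      integral_nonneg fun z => by positivity
    positivity

/-- The convolution of Schwartz functions. -/
def conv {d : ℕ} (φ ψ : 𝓢(Rd d, ℂ)) : 𝓢(Rd d, ℂ) :=
  SchwartzMap.convolution (ContinuousLinearMap.mul ℂ ℂ) φ ψ

theorem conv_apply {d : ℕ} (φ ψ : 𝓢(Rd d, ℂ)) (t : Rd d) :
    conv φ ψ t = ∫ x, φ x * ψ (t - x) := by
  rw [conv, SchwartzMap.convolution_apply]; rfl

theorem fourier_conv {d : ℕ} (φ ψ : 𝓢(Rd d, ℂ)) : 𝓕 (conv φ ψ) = mulS (𝓕 φ) (𝓕 ψ) := by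
  ext x
  rw [conv, SchwartzMap.fourier_convolution, SchwartzMap.pairing_apply_apply, mulS_apply]
  rfl

theorem schwartzTensor_apply {d : ℕ} (φ ψ : 𝓢(Rd d, ℂ)) (z : Rd d × Rd d) :
    schwartzTensor φ ψ z = φ z.1 * ψ z.2 := rfl

theorem integral_integral_conjTimeFreqShift {d : ℕ} (g v φ ψ : 𝓢(Rd d, ℂ)) :
    ∫ z : Rd d × Rd d, (∫ t, v t * conjTimeFreqShift g z.1 z.2 t) * schwartzTensor φ ψ z =
      ∫ t, v t * mulS (conv φ (conjS g)) (𝓕 ψ) t := by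
  have hb : ∀ x, ‖conjS g x‖ ≤ 2 ^ 0 * SN 0 (conjS g) := fun x => by
    simpa using norm_apply_le_SN (le_refl 0) (conjS g) x
  let G : Rd d × Rd d → Rd d → ℂ := fun z t =>
    v t * conjTimeFreqShift g z.1 z.2 t * schwartzTensor φ ψ z
  have hGeq : ∀ z t, G z t = v t * ((φ z.1 * conjS g (t - z.1)) * (character (-t) z.2 * ψ z.2)) := by
    intro z t
    simp only [G, conjTimeFreqShift_eq, md_apply, tr_apply, schwartzTensor_apply,
      character_neg_comm z.2 t]
    ring
  have hint : Integrable (Function.uncurry G) (volume.prod volume) := by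
    have h0 : Integrable (fun q : Rd d × Rd d => φ q.1 * ψ q.2) volume :=
      Integrable.mul_prod (μ := volume) (ν := volume) (φ.integrable (μ := volume))
        (ψ.integrable (μ := volume))
    have h1 : Integrable (fun p : (Rd d × Rd d) × Rd d => (φ p.1.1 * ψ p.1.2) * v p.2)
        (volume.prod volume) :=
      Integrable.mul_prod (f := fun q : Rd d × Rd d => φ q.1 * ψ q.2) (g := fun t => v t) h0
        (v.integrable (μ := volume))
    refine (h1.norm.mul_const (2 ^ 0 * SN 0 (conjS g))).mono' ?_ (.of_forall fun p => ?_)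
    · have hc : Continuous fun p : (Rd d × Rd d) × Rd d => character (-p.2) p.1.2 :=
        continuous_character_neg continuous_snd (continuous_snd.comp continuous_fst)
      have h2 : Continuous fun p : (Rd d × Rd d) × Rd d => v p.2 *
          ((φ p.1.1 * conjS g (p.2 - p.1.1)) * (character (-p.2) p.1.2 * ψ p.1.2)) :=
        (v.continuous.comp continuous_snd).mul
          (((φ.continuous.comp (continuous_fst.comp continuous_fst)).mul
            ((conjS g).continuous.comp
              (continuous_snd.sub (continuous_fst.comp continuous_fst)))).mul
          (hc.mul (ψ.continuous.comp (continuous_snd.comp continuous_fst))))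
      exact h2.aestronglyMeasurable.congr (.of_forall fun p => (hGeq p.1 p.2).symm)
    · rw [show Function.uncurry G p = G p.1 p.2 from rfl, hGeq]
      simp only [norm_mul, norm_character, one_mul]
      calc ‖v p.2‖ * (‖φ p.1.1‖ * ‖conjS g (p.2 - p.1.1)‖ * ‖ψ p.1.2‖)
          = (‖φ p.1.1‖ * ‖ψ p.1.2‖ * ‖v p.2‖) * ‖conjS g (p.2 - p.1.1)‖ := by ring
        _ ≤ _ := mul_le_mul_of_nonneg_left (hb _) (by positivity)
  calc ∫ z : Rd d × Rd d, (∫ t, v t * conjTimeFreqShift g z.1 z.2 t) * schwartzTensor φ ψ z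
      = ∫ z : Rd d × Rd d, ∫ t, G z t :=
        integral_congr_ae (.of_forall fun z => (integral_mul_const _ _).symm)
    _ = ∫ t, ∫ z : Rd d × Rd d, G z t := integral_integral_swap hint
    _ = _ := by
      refine integral_congr_ae (.of_forall fun t => ?_)
      simp only [hGeq]
      rw [integral_const_mul, mulS_apply, conv_apply, fourier_schwartz_apply]
      congr 1
      exact integral_prod_mul (μ := volume) (ν := volume) (fun x => φ x * conjS g (t - x))
        (fun ξ => character (-t) ξ * ψ ξ)

/-- The short-time Fourier transform, tested with a tensor product. -/
theorem integral_stft_mul_schwartzTensor {d : ℕ} {χ : Test d} (hχ : IsPartitionGenerator χ)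
    (g : 𝓢(Rd d, ℂ)) (f : 𝓢'(Rd d, ℂ)) (φ ψ : 𝓢(Rd d, ℂ)) :
    ∫ z, stft g f z * schwartzTensor φ ψ z = f (mulS (conv φ (conjS g)) (𝓕 ψ)) := by
  obtain ⟨τ, hτ⟩ := exists_isCutoff hχ
  obtain ⟨m, C₁, hC₁, h₁⟩ := exists_atomDecomposition_le χ τ f
  obtain ⟨n, C₂, hC₂, h₂⟩ := exists_SN_conjTimeFreqShift_le g m
  let a : (Fin d → ℤ) × (Fin d → ℤ) → ℝ := fun i =>
    ((1 + ‖latticePoint i.1‖) ^ (d + 1))⁻¹ * ((1 + ‖latticePoint i.2‖) ^ (d + 1))⁻¹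
  have ha : ∀ i, 0 ≤ a i := fun i => by positivity
  let H : (Fin d → ℤ) × (Fin d → ℤ) → Rd d × Rd d → ℂ := fun i z =>
    f (atom τ i) * ∫ t, atomDual χ i t * conjTimeFreqShift g z.1 z.2 t
  have hHm : ∀ i, Measurable (H i) := fun i =>
    (continuous_const.mul (continuous_integral_conjTimeFreqShift g _)).measurable
  have hHb : ∀ i z, ‖H i z‖ ≤ (C₁ * C₂ * a i) * (1 + ‖z‖) ^ n := fun i z => by
    refine (h₁ i _).trans ?_
    calc C₁ * a i * SN m (conjTimeFreqShift g z.1 z.2) ≤ C₁ * a i * (C₂ * (1 + ‖z‖) ^ n) :=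
          mul_le_mul_of_nonneg_left (h₂ z) (mul_nonneg hC₁.le (ha i))
      _ = _ := by ring
  have hpos : ∀ i, 0 ≤ C₁ * C₂ * a i := fun i => mul_nonneg (by positivity) (ha i)
  have hint := fun i => (integrable_mul_schwartz (hHm i) (hHb i) (hpos i) (schwartzTensor φ ψ)).1
  have hnorm : Summable fun i => ∫ z, ‖H i z * schwartzTensor φ ψ z‖ := by
    let K : ℝ := 2 ^ (n + (2 * d + 1)) * SN (n + (2 * d + 1)) (schwartzTensor φ ψ)
    let J : ℝ := ∫ z : Rd d × Rd d, ((1 + ‖z‖) ^ (2 * d + 1))⁻¹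
    refine (((summable_lattice_prod d).mul_left (C₁ * C₂)).mul_right (K * J)).of_nonneg_of_le
      (fun i => integral_nonneg fun z => norm_nonneg _) fun i => ?_
    calc ∫ z, ‖H i z * schwartzTensor φ ψ z‖
        ≤ ∫ z : Rd d × Rd d, (C₁ * C₂ * a i * K) * ((1 + ‖z‖) ^ (2 * d + 1))⁻¹ := by
          refine integral_mono (hint i).norm ((integrable_one_add_norm_prod d).const_mul _)
            fun z => ?_
          simp only [norm_mul]
          calc ‖H i z‖ * ‖schwartzTensor φ ψ z‖
              ≤ (C₁ * C₂ * a i) * (1 + ‖z‖) ^ n * ‖schwartzTensor φ ψ z‖ := by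
                gcongr; exact hHb i z
            _ = (C₁ * C₂ * a i) * ((1 + ‖z‖) ^ n * ‖schwartzTensor φ ψ z‖) := by ring
            _ ≤ (C₁ * C₂ * a i) * (K * ((1 + ‖z‖) ^ (2 * d + 1))⁻¹) :=
                mul_le_mul_of_nonneg_left (pow_mul_norm_le _ z) (hpos i)
            _ = _ := by ring
      _ = _ := by rw [integral_const_mul]; simp only [J, a]; ring
  have hs := hasSum_integral_of_summable_integral_norm hint hnorm
  have e1 : ∀ z, ∑' i, H i z * schwartzTensor φ ψ z = stft g f z * schwartzTensor φ ψ z :=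
    fun z => ((hasSum_stft hχ hτ g f z).mul_right _).tsum_eq
  simp only [e1] at hs
  refine hs.unique ?_
  refine (hasSum_atomDecomposition hχ hτ f (mulS (conv φ (conjS g)) (𝓕 ψ))).congr_fun fun i => ?_
  rw [← integral_integral_conjTimeFreqShift, ← integral_const_mul]
  refine integral_congr_ae (.of_forall fun z => ?_)
  simp only [H]; ring

/-! ### TMIB spaces -/

/-- Schwartz functions as tempered distributions. -/
abbrev toTD {d : ℕ} : 𝓢(Rd d, ℂ) →L[ℂ] 𝓢'(Rd d, ℂ) :=
  SchwartzMap.toTemperedDistributionCLM (Rd d) ℂ volume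

theorem toTD_apply {d : ℕ} (ψ χ : 𝓢(Rd d, ℂ)) : toTD ψ χ = ∫ x, χ x * ψ x :=
  SchwartzMap.toTemperedDistributionCLM_apply_apply volume ψ χ

theorem mulD_toTD {d : ℕ} (h ψ : 𝓢(Rd d, ℂ)) : mulD h (toTD ψ) = toTD (mulS h ψ) := by
  ext χ
  rw [mulD_apply, toTD_apply, toTD_apply]
  refine integral_congr_ae (.of_forall fun x => ?_)
  simp only [mulS_apply]; ring

theorem translate_toTD {d : ℕ} (a : Rd d) (ψ : 𝓢(Rd d, ℂ)) :
    translate a (toTD ψ) = toTD (tr a ψ) := by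
  ext χ
  rw [translate_apply, toTD_apply, toTD_apply, ← integral_sub_right_eq_self _ a]
  refine integral_congr_ae (.of_forall fun x => ?_)
  simp only [tr_apply, sub_neg_eq_add, sub_add_cancel]

theorem modulate_toTD {d : ℕ} (ξ : Rd d) (ψ : 𝓢(Rd d, ℂ)) :
    modulate ξ (toTD ψ) = toTD (md ξ ψ) := by
  ext χ
  rw [modulate_apply, toTD_apply, toTD_apply]
  refine integral_congr_ae (.of_forall fun x => ?_)
  simp only [md_apply]; ring

theorem toTD_comm {d : ℕ} (ψ χ : 𝓢(Rd d, ℂ)) : toTD ψ χ = toTD χ ψ := by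
  rw [toTD_apply, toTD_apply]
  exact integral_congr_ae (.of_forall fun x => mul_comm _ _)

theorem tr_md {d : ℕ} (y ξ : Rd d) (χ : 𝓢(Rd d, ℂ)) :
    tr y (md ξ χ) = character ξ (-y) • md ξ (tr y χ) := by
  ext x
  rw [tr_apply, md_apply, smul_apply, md_apply, tr_apply, smul_eq_mul, sub_eq_add_neg,
    character_apply_add]
  ring

/-- The Fourier series of a multiplier on a translate of the cube. -/
theorem hasSum_smul_modulate_apply {d : ℕ} {φ : Test d} (hφ : IsPartitionGenerator φ)
    {τ : 𝓢(Rd d, ℂ)} (hτ : IsCutoff φ τ) (h : 𝓢(Rd d, ℂ)) (y : Rd d) (f : 𝓢'(Rd d, ℂ))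
    (ψ : 𝓢(Rd d, ℂ)) :
    HasSum (fun n => ((fourierCoeffCube (mulS τ h) n * character (halfLattice n) (-y)) •
      modulate (halfLattice n) (mulD (tr y (testToSchwartz φ)) f)) ψ)
      (mulD (tr y h) (mulD (tr y (testToSchwartz φ)) f) ψ) := by
  have h3 := hasSum_fourierCoeffCube_smul (mulS τ h)
    (mulS (testToSchwartz φ) (tr (-y) ψ))
    (fun t ht => hτ.supp t fun h0 => ht (by rw [mulS_apply, h0, zero_mul]))
    (fun t ht => hφ.supp t fun h0 => ht (by rw [mulS_apply, h0, zero_mul]))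
  have h4 := hasSum_tempered (translate (-y) f) h3
  have e1 : tr (-(-y)) (mulS (mulS τ h) (mulS (testToSchwartz φ) (tr (-y) ψ))) =
      mulS (tr y (testToSchwartz φ)) (mulS (tr y h) ψ) := by
    rw [mulS_comm τ h, mulS_assoc, ← mulS_assoc τ, hτ.mulS_eq, neg_neg, tr_mulS, tr_mulS, tr_tr,
      add_neg_cancel, tr_zero, ← mulS_assoc, ← mulS_assoc, mulS_comm (tr y h)]
  rw [translate_apply, e1] at h4
  refine h4.congr_fun fun n => ?_
  change (fourierCoeffCube (mulS τ h) n * character (halfLattice n) (-y)) • f (mulS (tr y (testToSchwartz φ))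
    (md (halfLattice n) ψ)) = _
  rw [translate_apply, map_smul, neg_neg, tr_md, map_smul, map_smul, tr_mulS, tr_tr,
    add_neg_cancel, tr_zero, md_mulS, smul_eq_mul, smul_eq_mul, smul_eq_mul, mul_assoc]

namespace DistSpace

theorem eNorm_zero {d : ℕ} (E : DistSpace d) : E.eNorm 0 = 0 := by
  have h := E.smul_eq 0 0
  rwa [show (0 : ℂ) • (0 : 𝓢'(Rd d, ℂ)) = 0 from zero_smul ℂ (0 : 𝓢'(Rd d, ℂ)), enorm_zero,
    zero_mul] at h

theorem eNorm_neg {d : ℕ} (E : DistSpace d) (f : 𝓢'(Rd d, ℂ)) : E.eNorm (-f) = E.eNorm f := by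
  have h := E.smul_eq (-1) f
  rwa [show (-1 : ℂ) • f = -f from neg_one_smul ℂ f, enorm_neg, enorm_one, one_mul] at h

theorem eNorm_sum_le {d : ℕ} (E : DistSpace d) {ι : Type*} (s : Finset ι) (f : ι → 𝓢'(Rd d, ℂ)) :
    E.eNorm (∑ i ∈ s, f i) ≤ ∑ i ∈ s, E.eNorm (f i) := by
  classical
  induction s using Finset.induction_on with
  | empty => simp [eNorm_zero]
  | insert a s ha ih =>
    rw [Finset.sum_insert ha, Finset.sum_insert ha]
    exact (E.add_le _ _).trans (by gcongr)

/-- An element of the space. -/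
def elem {d : ℕ} (E : DistSpace d) (f : 𝓢'(Rd d, ℂ)) (hf : E.eNorm f < ∞) : E.Carrier := ⟨f, hf⟩

theorem incl_elem {d : ℕ} (E : DistSpace d) (f : 𝓢'(Rd d, ℂ)) (hf : E.eNorm f < ∞) :
    E.incl (E.elem f hf) = f := rfl

theorem norm_elem {d : ℕ} (E : DistSpace d) (f : 𝓢'(Rd d, ℂ)) (hf : E.eNorm f < ∞) :
    ‖E.elem f hf‖ = (E.eNorm f).toReal := rfl

theorem eNorm_incl_lt_top {d : ℕ} (E : DistSpace d) (f : E.Carrier) : E.eNorm (E.incl f) < ∞ := f.2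

theorem enorm_eq {d : ℕ} (E : DistSpace d) (f : E.Carrier) : ‖f‖ₑ = E.eNorm (E.incl f) := by
  rw [← ofReal_norm, norm_def, ENNReal.ofReal_toReal (E.eNorm_incl_lt_top f).ne]

end DistSpace

namespace DistSpace.IsTMIB

variable {d : ℕ} {E : DistSpace d}

theorem continuous_incl_apply (hE : E.IsTMIB) (ψ : 𝓢(Rd d, ℂ)) :
    Continuous fun f : E.Carrier => E.incl f ψ :=
  (PointwiseConvergenceCLM.evalCLM (RingHom.id ℂ) ℂ ψ).continuous.comp hE.incl_continuous

theorem eNorm_toTD_lt_top (hE : E.IsTMIB) (ψ : 𝓢(Rd d, ℂ)) : E.eNorm (toTD ψ) < ∞ :=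
  hE.schwartz_mem ψ

/-- The elements of a TMIB space are uniformly bounded functionals on the Schwartz space. -/
theorem exists_norm_apply_le (hE : E.IsTMIB) : ∃ m : ℕ, ∃ C > 0, ∀ (f : E.Carrier) (ψ : 𝓢(Rd d, ℂ)),
    ‖E.incl f ψ‖ ≤ C * ‖f‖ * SN m ψ := by
  have := hE.complete
  let S : ℕ → Set E.Carrier := fun n => {f | ∀ ψ : 𝓢(Rd d, ℂ), ‖E.incl f ψ‖ ≤ n * SN n ψ}
  have hS : ∀ n, IsClosed (S n) := fun n => by
    simp only [S, Set.ofPred_forall]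
    exact isClosed_iInter fun ψ => isClosed_le (hE.continuous_incl_apply ψ).norm continuous_const
  have hU : ⋃ n, S n = Set.univ := Set.eq_univ_of_forall fun f => by
    obtain ⟨m, C, hC, h⟩ := exists_norm_temperedDistribution_le (E.incl f)
    obtain ⟨n, hn⟩ := exists_nat_ge (max (m : ℝ) C)
    refine Set.mem_iUnion.2 ⟨n, fun ψ => (h ψ).trans ?_⟩
    exact mul_le_mul ((le_max_right _ _).trans hn)
      (SN_mono (by exact_mod_cast (le_max_left _ _).trans hn) ψ) (apply_nonneg _ _) (by positivity)
  obtain ⟨n, f₀, hf₀⟩ := nonempty_interior_of_iUnion_of_closed hS hU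
  obtain ⟨r, hr, hball⟩ := Metric.isOpen_iff.1 isOpen_interior f₀ hf₀
  have hsub : ∀ f : E.Carrier, ‖f‖ < r → ∀ ψ, ‖E.incl f ψ‖ ≤ 2 * (n * SN n ψ) := fun f hf ψ => by
    have h1 : f₀ + f ∈ S n := interior_subset (hball (by simpa [dist_eq_norm] using hf))
    have h2 : f₀ ∈ S n := interior_subset hf₀
    have h3 : E.incl f ψ = E.incl (f₀ + f) ψ - E.incl f₀ ψ := by
      rw [map_add, add_apply]; ring
    rw [h3]
    exact (norm_sub_le _ _).trans (by linarith [h1 ψ, h2 ψ])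
  refine ⟨n, (2 * n) / (r / 2) + 1, by positivity, fun f ψ => ?_⟩
  by_cases hf : ‖f‖ = 0
  · have h0 : E.eNorm (E.incl f) = 0 := by rw [← E.enorm_eq, ← ofReal_norm, hf]; simp
    rw [hE.eq_zero _ h0, zero_apply, norm_zero]
    positivity
  have hfp : 0 < ‖f‖ := lt_of_le_of_ne (norm_nonneg _) (Ne.symm hf)
  have h1 := hsub (((r / 2 / ‖f‖ : ℝ) : ℂ) • f) (by
    rw [norm_smul, Complex.norm_real, Real.norm_of_nonneg (by positivity),
      div_mul_cancel₀ _ hf]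
    linarith) ψ
  rw [map_smul, smul_apply, norm_smul, Complex.norm_real, Real.norm_of_nonneg (by positivity)] at h1
  have h2 : ‖E.incl f ψ‖ ≤ 2 * (n * SN n ψ) / (r / 2 / ‖f‖) := by
    rw [le_div_iff₀ (by positivity), mul_comm]; exact h1
  refine h2.trans (le_trans (le_of_eq ?_) (mul_le_mul_of_nonneg_right
    (mul_le_mul_of_nonneg_right (le_add_of_nonneg_right zero_le_one) hfp.le) (apply_nonneg _ _)))
  field_simp

theorem eNorm_map_le (hE : E.IsTMIB) (T : 𝓢'(Rd d, ℂ) →L[ℂ] 𝓢'(Rd d, ℂ)) {f : 𝓢'(Rd d, ℂ)}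
    (hf : E.eNorm f < ∞) : E.eNorm (T f) ≤ E.opENorm T * E.eNorm f := by
  by_cases h0 : E.eNorm f = 0
  · rw [hE.eq_zero f h0, map_zero, E.eNorm_zero]; exact zero_le
  set c : ℂ := (((E.eNorm f).toReal⁻¹ : ℝ) : ℂ) with hc
  have hpos : 0 < (E.eNorm f).toReal := ENNReal.toReal_pos h0 hf.ne
  have hcn : ‖c‖ₑ = (E.eNorm f)⁻¹ := by
    rw [← ofReal_norm, hc, Complex.norm_real, Real.norm_of_nonneg (by positivity),
      ENNReal.ofReal_inv_of_pos hpos, ENNReal.ofReal_toReal hf.ne]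
  have h1 : E.eNorm (T (c • f)) ≤ E.opENorm T :=
    le_iSup₂ (f := fun (f : 𝓢'(Rd d, ℂ)) (_ : E.eNorm f ≤ 1) => E.eNorm (T f)) (c • f) (by
      rw [E.smul_eq, hcn, ENNReal.inv_mul_cancel h0 hf.ne])
  rw [map_smul, E.smul_eq, hcn] at h1
  calc E.eNorm (T f) = E.eNorm f * ((E.eNorm f)⁻¹ * E.eNorm (T f)) := by
        rw [← mul_assoc, ENNReal.mul_inv_cancel h0 hf.ne, one_mul]
    _ ≤ E.eNorm f * E.opENorm T := by gcongr
    _ = _ := mul_comm _ _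

theorem exists_growth (hE : E.IsTMIB) : ∃ N : ℕ, ∃ C > 0, ∀ (x : Rd d) (f : 𝓢'(Rd d, ℂ)),
    E.eNorm (translate x f) ≤ ENNReal.ofReal (C * (1 + ‖x‖) ^ N) * E.eNorm f ∧
    E.eNorm (modulate x f) ≤ ENNReal.ofReal (C * (1 + ‖x‖) ^ N) * E.eNorm f := by
  obtain ⟨s, hs, C, hC, h⟩ := hE.growth
  obtain ⟨N, hN⟩ := exists_nat_ge s
  refine ⟨N, C, hC, fun x f => ?_⟩
  have hle : ENNReal.ofReal (C * (1 + ‖x‖) ^ s) ≤ ENNReal.ofReal (C * (1 + ‖x‖) ^ N) := by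
    refine ENNReal.ofReal_le_ofReal (mul_le_mul_of_nonneg_left ?_ hC.le)
    rw [← Real.rpow_natCast]
    exact Real.rpow_le_rpow_of_exponent_le (by linarith [norm_nonneg x]) hN
  by_cases hf : E.eNorm f = ∞
  · have hpos : ENNReal.ofReal (C * (1 + ‖x‖) ^ N) ≠ 0 := by
      rw [Ne, ENNReal.ofReal_eq_zero, not_le]; positivity
    rw [hf, ENNReal.mul_top hpos]
    exact ⟨le_top, le_top⟩
  · have hf : E.eNorm f < ∞ := lt_top_iff_ne_top.2 hf
    refine ⟨(hE.eNorm_map_le (translate x) hf).trans ?_,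
      (hE.eNorm_map_le (modulate x) hf).trans ?_⟩
    · gcongr
      exact (h x).1.trans hle
    · gcongr
      have h1 := (h (-x)).2
      rw [DistSpace.nu, neg_neg, norm_neg] at h1
      exact h1.trans hle

/-- An absolutely convergent series in a TMIB space. -/
theorem eNorm_le_tsum (hE : E.IsTMIB) {ι : Type*} (x : ι → 𝓢'(Rd d, ℂ)) (f : 𝓢'(Rd d, ℂ))
    (h : ∀ ψ : 𝓢(Rd d, ℂ), HasSum (fun i => x i ψ) (f ψ)) :
    E.eNorm f ≤ ∑' i, E.eNorm (x i) := by
  by_cases hfin : ∑' i, E.eNorm (x i) = ∞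
  · rw [hfin]; exact le_top
  have hx : ∀ i, E.eNorm (x i) < ∞ := fun i =>
    (ENNReal.le_tsum i).trans_lt (lt_top_iff_ne_top.2 hfin)
  have := hE.complete
  have hs : Summable fun i => ‖E.elem (x i) (hx i)‖ := ENNReal.summable_toReal hfin
  have hs' : Summable fun i => E.elem (x i) (hx i) := hs.of_norm
  obtain ⟨y, hy⟩ := hs'
  have hyf : E.incl y = f := by
    ext ψ
    let L : E.Carrier →+ ℂ :=
      { toFun := fun f => E.incl f ψ
        map_zero' := by rw [map_zero, zero_apply]
        map_add' := fun f g => by rw [map_add, add_apply] }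
    exact (hy.map L (hE.continuous_incl_apply ψ)).unique (h ψ)
  rw [← hyf, ← E.enorm_eq, ← ofReal_norm]
  have h2 : ‖y‖ ≤ ∑' i, ‖E.elem (x i) (hx i)‖ := hy.norm_le_of_bounded hs.hasSum (fun i => le_rfl)
  refine (ENNReal.ofReal_le_ofReal h2).trans (le_of_eq ?_)
  simp only [E.norm_elem]
  rw [← ENNReal.tsum_toReal_eq fun i => (hx i).ne, ENNReal.ofReal_toReal hfin]

/-- The norm of a TMIB space is continuous on the Schwartz functions. -/
theorem exists_eNorm_toTD_le (hE : E.IsTMIB) {φ : Test d} (hφ : IsPartitionGenerator φ) :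
    ∃ m : ℕ, ∃ C > 0, ∀ ψ : 𝓢(Rd d, ℂ), E.eNorm (toTD ψ) ≤ ENNReal.ofReal (C * SN m ψ) := by
  obtain ⟨τ, hτ⟩ := exists_isCutoff hφ
  obtain ⟨N, C₁, hC₁, h₁⟩ := hE.exists_growth
  obtain ⟨m, C₂, hC₂, h₂⟩ := exists_atomCoeff_le φ (N + (d + 1))
  let S : ℝ := ∑' i : (Fin d → ℤ) × (Fin d → ℤ),
    ((1 + ‖latticePoint i.1‖) ^ (d + 1))⁻¹ * ((1 + ‖latticePoint i.2‖) ^ (d + 1))⁻¹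
  have hS : 0 ≤ S := tsum_nonneg fun k => by positivity
  let D : ℝ := (E.eNorm (toTD τ)).toReal
  have hD0 : 0 ≤ D := ENNReal.toReal_nonneg
  have hD : E.eNorm (toTD τ) = ENNReal.ofReal D :=
    (ENNReal.ofReal_toReal (hE.eNorm_toTD_lt_top τ).ne).symm
  refine ⟨m, C₁ * C₁ * C₂ * D * S + 1, by positivity, fun ψ => ?_⟩
  have hx : ∀ χ : 𝓢(Rd d, ℂ),
      HasSum (fun i => (atomCoeff φ i ψ • toTD (atom τ i)) χ) (toTD ψ χ) := by
    intro χ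
    rw [toTD_comm]
    refine (hasSum_tempered (toTD χ) (hasSum_atomCoeff_smul_atom hφ hτ ψ)).congr_fun fun i => ?_
    rw [smul_apply, map_smul, toTD_comm]
  refine (hE.eNorm_le_tsum _ _ hx).trans ?_
  have hterm : ∀ i, E.eNorm (atomCoeff φ i ψ • toTD (atom τ i)) ≤
      ENNReal.ofReal (C₁ * C₁ * C₂ * D * SN m ψ * (((1 + ‖latticePoint i.1‖) ^ (d + 1))⁻¹ *
        ((1 + ‖latticePoint i.2‖) ^ (d + 1))⁻¹)) := by
    intro i
    have e1 : E.eNorm (toTD (atom τ i)) ≤ ENNReal.ofReal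
        (C₁ * (1 + ‖latticePoint i.1‖) ^ N * (C₁ * (1 + ‖latticePoint i.2‖) ^ N * D)) := by
      rw [atom, ← translate_toTD, ← modulate_toTD]
      refine (h₁ _ _).1.trans ?_
      rw [ENNReal.ofReal_mul (p := C₁ * (1 + ‖latticePoint i.1‖) ^ N) (by positivity)]
      gcongr
      refine (h₁ _ _).2.trans ?_
      rw [ENNReal.ofReal_mul (p := C₁ * (1 + ‖latticePoint i.2‖) ^ N) (by positivity), hD]
      gcongr
      linarith [one_add_norm_halfLattice_le i.2]
    rw [E.smul_eq, ← ofReal_norm]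
    refine (mul_le_mul_right e1 _).trans ?_
    rw [← ENNReal.ofReal_mul (norm_nonneg _)]
    refine ENNReal.ofReal_le_ofReal ?_
    refine (mul_le_mul_of_nonneg_right (h₂ i ψ) (by positivity)).trans (le_of_eq ?_)
    simp only [pow_add, mul_inv]
    have hp1 : 0 < 1 + ‖latticePoint i.1‖ := by positivity
    have hp2 : 0 < 1 + ‖latticePoint i.2‖ := by positivity
    field_simp
  refine (ENNReal.tsum_le_tsum hterm).trans ?_
  rw [← ENNReal.ofReal_tsum_of_nonneg (fun n => by positivity)
    ((summable_lattice_prod d).mul_left _), tsum_mul_left]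
  refine ENNReal.ofReal_le_ofReal ?_
  change C₁ * C₁ * C₂ * D * SN m ψ * S ≤ _
  nlinarith [apply_nonneg (SN m) ψ]

/-- A Cauchy sequence of a TMIB space that converges as a sequence of tempered distributions,
converges in the space. -/
theorem eNorm_sub_le_of_cauchy (hE : E.IsTMIB) (x : ℕ → 𝓢'(Rd d, ℂ)) (f : 𝓢'(Rd d, ℂ))
    (h : ∀ ψ : 𝓢(Rd d, ℂ), Tendsto (fun n => x n ψ) atTop (𝓝 (f ψ))) (hx : ∀ n, E.eNorm (x n) < ∞)
    (δ : ℕ → ℝ) (hδ : Tendsto δ atTop (𝓝 0))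
    (hc : ∀ m n, m ≤ n → E.eNorm (x m - x n) ≤ ENNReal.ofReal (δ m)) (n : ℕ) :
    E.eNorm (x n - f) ≤ ENNReal.ofReal (δ n) := by
  have := hE.complete
  have hδ0 : ∀ m n, m ≤ n → dist (E.elem (x m) (hx m)) (E.elem (x n) (hx n)) ≤ max (δ m) 0 := by
    intro m n hmn
    rw [dist_eq_norm]
    change (E.eNorm (x m - x n)).toReal ≤ _
    refine (ENNReal.toReal_mono ENNReal.ofReal_ne_top (hc m n hmn)).trans (le_of_eq ?_)
    rw [ENNReal.toReal_ofReal']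
  have hδ' : Tendsto (fun n => max (δ n) 0) atTop (𝓝 0) := by
    simpa using hδ.max (tendsto_const_nhds (x := (0 : ℝ)))
  have hcau : CauchySeq fun n => E.elem (x n) (hx n) :=
    cauchySeq_of_le_tendsto_0' (fun n => max (δ n) 0) hδ0 hδ'
  obtain ⟨y, hy⟩ := cauchySeq_tendsto_of_complete hcau
  have hyf : E.incl y = f := by
    ext ψ
    exact tendsto_nhds_unique (((hE.continuous_incl_apply ψ).tendsto y).comp hy) (h ψ)
  have h3 : dist (E.elem (x n) (hx n)) y ≤ max (δ n) 0 :=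
    le_of_tendsto (tendsto_const_nhds.dist hy) (eventually_atTop.2 ⟨n, fun m hm => hδ0 n m hm⟩)
  rw [dist_eq_norm] at h3
  have h4 : E.incl (E.elem (x n) (hx n) - y) = x n - f := by rw [map_sub, hyf, E.incl_elem]
  rw [← h4, ← E.enorm_eq, ← ofReal_norm]
  refine (ENNReal.ofReal_le_ofReal h3).trans (le_of_eq ?_)
  rw [← ENNReal.toReal_ofReal', ENNReal.ofReal_toReal ENNReal.ofReal_ne_top]

/-- Multiplication with Schwartz functions is bounded on the local parts of a TMIB space. -/
theorem exists_eNorm_mulD_le (hE : E.IsTMIB) {φ : Test d} (hφ : IsPartitionGenerator φ)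
    {τ : 𝓢(Rd d, ℂ)} (hτ : IsCutoff φ τ) : ∃ m : ℕ, ∃ C > 0, ∀ (h : 𝓢(Rd d, ℂ)) (y : Rd d)
    (f : 𝓢'(Rd d, ℂ)), E.eNorm (mulD (tr y h) (mulD (tr y (testToSchwartz φ)) f)) ≤
      ENNReal.ofReal (C * SN m (mulS τ h)) * E.eNorm (mulD (tr y (testToSchwartz φ)) f) := by
  obtain ⟨N, C₁, hC₁, h₁⟩ := hE.exists_growth
  obtain ⟨m, C₂, hC₂, h₂⟩ := exists_fourierCoeffCube_le d (N + (d + 1))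
  let T : ℝ := ∑' k : Fin d → ℤ, ((1 + ‖latticePoint k‖) ^ (d + 1))⁻¹
  have hT : 0 ≤ T := tsum_nonneg fun k => by positivity
  refine ⟨m, C₁ * C₂ * (T + 1), by positivity, fun h y f => ?_⟩
  set e := mulD (tr y (testToSchwartz φ)) f with he
  let c : (Fin d → ℤ) → ℂ := fourierCoeffCube (mulS τ h)
  let x : (Fin d → ℤ) → 𝓢'(Rd d, ℂ) := fun n =>
    (c n * character (halfLattice n) (-y)) • modulate (halfLattice n) e
  have hx : ∀ ψ : 𝓢(Rd d, ℂ), HasSum (fun n => x n ψ) (mulD (tr y h) e ψ) :=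
    hasSum_smul_modulate_apply hφ hτ h y f
  refine (hE.eNorm_le_tsum x _ hx).trans ?_
  have hterm : ∀ n, E.eNorm (x n) ≤ ENNReal.ofReal (C₁ * C₂ * SN m (mulS τ h) *
      ((1 + ‖latticePoint n‖) ^ (d + 1))⁻¹) * E.eNorm e := by
    intro n
    rw [E.smul_eq, enorm_mul, ← ofReal_norm, ← ofReal_norm, norm_character]
    simp only [ENNReal.ofReal_one, mul_one]
    refine (mul_le_mul_right (h₁ (halfLattice n) e).2 _).trans ?_
    rw [← mul_assoc, ← ENNReal.ofReal_mul (norm_nonneg _)]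
    refine mul_le_mul_left (ENNReal.ofReal_le_ofReal ?_) _
    have hpos : 0 < 1 + ‖latticePoint n‖ := by positivity
    calc ‖c n‖ * (C₁ * (1 + ‖halfLattice n‖) ^ N)
        ≤ (C₂ * ((1 + ‖latticePoint n‖) ^ (N + (d + 1)))⁻¹ * SN m (mulS τ h)) *
          (C₁ * (1 + ‖latticePoint n‖) ^ N) := by
          refine mul_le_mul (h₂ _ n) ?_ (by positivity) (by positivity)
          gcongr C₁ * ?_ ^ N
          exact one_add_norm_halfLattice_le n
      _ = _ := by
          rw [pow_add, mul_inv]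
          field_simp
  refine (ENNReal.tsum_le_tsum hterm).trans ?_
  rw [ENNReal.tsum_mul_right, ← ENNReal.ofReal_tsum_of_nonneg (fun n => by positivity)
    ((summable_lattice (Nat.lt_succ_self d)).mul_left _), tsum_mul_left]
  refine mul_le_mul_left (ENNReal.ofReal_le_ofReal ?_) _
  change C₁ * C₂ * SN m (mulS τ h) * T ≤ _
  nlinarith [mul_nonneg (mul_nonneg hC₁.le hC₂.le) (apply_nonneg (SN m) (mulS τ h))]

end DistSpace.IsTMIB

/-! ### Sequence spaces on the lattice -/

/-- The norm of `ℓ^p(ℤ^d)`, for sequences with values in `[0, ∞]`. -/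
def lpN {d : ℕ} (p : ℝ≥0∞) (b : (Fin d → ℤ) → ℝ≥0∞) : ℝ≥0∞ := eLpNorm b p Measure.count

section lpN

variable {d : ℕ} {p : ℝ≥0∞}

theorem lpN_mono {a b : (Fin d → ℤ) → ℝ≥0∞} (h : ∀ k, a k ≤ b k) : lpN p a ≤ lpN p b :=
  eLpNorm_mono_enorm fun k => by simpa using h k

theorem lpN_const_mul_le (c : ℝ≥0) (b : (Fin d → ℤ) → ℝ≥0∞) :
    lpN p (fun k => c * b k) ≤ c * lpN p b := by
  refine le_trans (eLpNorm_le_nnreal_smul_eLpNorm_of_ae_le_mul' (c := c) (g := b)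
    (.of_forall fun k => ?_) p) le_rfl
  simp

theorem lpN_sum_le (hp : 1 ≤ p) {ι : Type*} (s : Finset ι) (b : ι → (Fin d → ℤ) → ℝ≥0∞) :
    lpN p (fun k => ∑ i ∈ s, b i k) ≤ ∑ i ∈ s, lpN p (b i) := by
  have h := eLpNorm_sum_le (μ := Measure.count) (p := p) (s := s) (f := b)
    (fun i _ => (measurable_of_countable _).aestronglyMeasurable) hp
  refine le_trans (le_of_eq ?_) h
  rw [lpN]
  congr 1
  ext k
  rw [Finset.sum_apply]

theorem lpN_comp_equiv (e : (Fin d → ℤ) ≃ (Fin d → ℤ)) (b : (Fin d → ℤ) → ℝ≥0∞) :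
    lpN p (fun k => b (e k)) = lpN p b := by
  have he : MeasurePreserving e Measure.count Measure.count := by
    refine ⟨measurable_of_countable _, Measure.ext_of_singleton fun k => ?_⟩
    rw [Measure.map_apply (measurable_of_countable _) (measurableSet_singleton k),
      Measure.count_singleton, show e ⁻¹' {k} = {e.symm k} by ext j; simp [Equiv.eq_symm_apply],
      Measure.count_singleton]
  exact eLpNorm_comp_measurePreserving (measurable_of_countable _).aestronglyMeasurable he

theorem lpN_top (b : (Fin d → ℤ) → ℝ≥0∞) : lpN ∞ b = ⨆ k, b k := by
  rw [lpN, eLpNorm_exponent_top, eLpNormEssSup, essSup_count]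
  simp

theorem lpN_rpow (hp : 1 ≤ p) (hp' : p ≠ ∞) (b : (Fin d → ℤ) → ℝ≥0∞) :
    lpN p b ^ p.toReal = ∑' k, b k ^ p.toReal := by
  have h0 : 0 < p.toReal := ENNReal.toReal_pos (zero_lt_one.trans_le hp).ne' hp'
  rw [lpN, eLpNorm_eq_lintegral_rpow_enorm_toReal (zero_lt_one.trans_le hp).ne' hp',
    ← ENNReal.rpow_mul, one_div_mul_cancel h0.ne', ENNReal.rpow_one, lintegral_count]
  simp

theorem lpN_le_iff (hp : 1 ≤ p) (hp' : p ≠ ∞) (b : (Fin d → ℤ) → ℝ≥0∞) (M : ℝ≥0∞) :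
    lpN p b ≤ M ↔ ∑' k, b k ^ p.toReal ≤ M ^ p.toReal := by
  have h0 : 0 < p.toReal := ENNReal.toReal_pos (zero_lt_one.trans_le hp).ne' hp'
  rw [← lpN_rpow hp hp', ENNReal.rpow_le_rpow_iff h0]

theorem le_lpN (hp : 1 ≤ p) (b : (Fin d → ℤ) → ℝ≥0∞) (k : Fin d → ℤ) : b k ≤ lpN p b := by
  by_cases hp' : p = ∞
  · rw [hp', lpN_top]; exact le_iSup b k
  have h0 : 0 < p.toReal := ENNReal.toReal_pos (zero_lt_one.trans_le hp).ne' hp'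
  rw [← ENNReal.rpow_le_rpow_iff h0, lpN_rpow hp hp']
  exact ENNReal.le_tsum k

theorem tendsto_of_lpN_lt_top (hp : 1 ≤ p) (hp' : p ≠ ∞) {b : (Fin d → ℤ) → ℝ≥0∞}
    (hb : lpN p b < ∞) : Tendsto b cofinite (𝓝 0) := by
  have h0 : 0 < p.toReal := ENNReal.toReal_pos (zero_lt_one.trans_le hp).ne' hp'
  have h1 : ∑' k, b k ^ p.toReal ≠ ∞ := by
    rw [← lpN_rpow hp hp']
    exact ENNReal.rpow_ne_top_of_nonneg h0.le hb.ne
  have h2 := (ENNReal.tendsto_cofinite_zero_of_tsum_ne_top h1).ennrpow_const (p.toReal⁻¹)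
  rw [ENNReal.zero_rpow_of_pos (by positivity)] at h2
  refine h2.congr fun k => ?_
  rw [← ENNReal.rpow_mul, mul_inv_cancel₀ h0.ne', ENNReal.rpow_one]

theorem lpN_tsum_le (hp : 1 ≤ p) {ι : Type*} (b : ι → (Fin d → ℤ) → ℝ≥0∞) :
    lpN p (fun k => ∑' i, b i k) ≤ ∑' i, lpN p (b i) := by
  by_cases hp' : p = ∞
  · subst hp'
    rw [lpN_top]
    exact iSup_le fun k => ENNReal.tsum_le_tsum fun i => le_lpN le_top _ k
  have h0 : 0 < p.toReal := ENNReal.toReal_pos (zero_lt_one.trans_le hp).ne' hp'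
  rw [lpN_le_iff hp hp', ENNReal.tsum_eq_iSup_sum]
  refine iSup_le fun J => ?_
  have h1 : Tendsto (fun I : Finset ι => ∑ k ∈ J, (∑ i ∈ I, b i k) ^ p.toReal) atTop
      (𝓝 (∑ k ∈ J, (∑' i, b i k) ^ p.toReal)) :=
    tendsto_finsetSum _ fun k _ => (ENNReal.summable.hasSum (f := fun i => b i k)).ennrpow_const _
  refine le_of_tendsto' h1 fun I => ?_
  calc ∑ k ∈ J, (∑ i ∈ I, b i k) ^ p.toReal ≤ ∑' k, (∑ i ∈ I, b i k) ^ p.toReal :=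
        ENNReal.sum_le_tsum J
    _ = lpN p (fun k => ∑ i ∈ I, b i k) ^ p.toReal := (lpN_rpow hp hp' _).symm
    _ ≤ (∑' i, lpN p (b i)) ^ p.toReal := by
        refine ENNReal.rpow_le_rpow ((lpN_sum_le hp I b).trans (ENNReal.sum_le_tsum I)) h0.le

/-- Young's inequality. -/
theorem lpN_convolution_le (hp : 1 ≤ p) (w b : (Fin d → ℤ) → ℝ≥0∞) (hw : ∀ k, w k ≠ ∞) :
    lpN p (fun j => ∑' k, w (j - k) * b k) ≤ (∑' r, w r) * lpN p b := by
  have h1 : (fun j => ∑' k, w (j - k) * b k) = fun j => ∑' r, w r * b (j - r) := by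
    funext j
    rw [← (Equiv.subLeft j).tsum_eq fun k => w (j - k) * b k]
    simp
  rw [h1]
  refine (lpN_tsum_le hp _).trans ?_
  rw [← ENNReal.tsum_mul_right]
  refine ENNReal.tsum_le_tsum fun r => ?_
  lift w to (Fin d → ℤ) → ℝ≥0 using hw
  refine (lpN_const_mul_le (w r) _).trans (le_of_eq ?_)
  congr 1
  exact lpN_comp_equiv (Equiv.subRight r) b

end lpN

/-! ### The discrete description of amalgam spaces -/

theorem IsPolyWeight.exists_nat {d : ℕ} {η : Rd d → ℝ} (hη : IsPolyWeight η) :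
    ∃ N : ℕ, ∃ C > 0, ∀ x y, η (x + y) ≤ C * η x * (1 + ‖y‖) ^ N := by
  obtain ⟨C, hC, s, hs, h⟩ := hη.moderate
  obtain ⟨N, hN⟩ := exists_nat_ge s
  refine ⟨N, C, hC, fun x y => (h x y).trans ?_⟩
  rw [← Real.rpow_natCast]
  exact mul_le_mul_of_nonneg_left
    (Real.rpow_le_rpow_of_exponent_le (by linarith [norm_nonneg y]) hN)
    (mul_nonneg hC.le (hη.pos x).le)

theorem IsPolyWeight.mul {d : ℕ} {η₁ η₂ : Rd d → ℝ} (h₁ : IsPolyWeight η₁) (h₂ : IsPolyWeight η₂) :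
    IsPolyWeight fun x => η₁ x * η₂ x := by
  refine ⟨fun x => mul_pos (h₁.pos x) (h₂.pos x), h₁.measurable.mul h₂.measurable, ?_⟩
  obtain ⟨C₁, hC₁, s₁, hs₁, b₁⟩ := h₁.moderate
  obtain ⟨C₂, hC₂, s₂, hs₂, b₂⟩ := h₂.moderate
  refine ⟨C₁ * C₂, by positivity, s₁ + s₂, by positivity, fun x y => ?_⟩
  refine (mul_le_mul (b₁ x y) (b₂ x y) (h₂.pos _).le
    (by have := (h₁.pos x).le; positivity)).trans (le_of_eq ?_)
  rw [Real.rpow_add (by positivity)]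
  ring

/-- The weight at the lattice points. -/
def latW {d : ℕ} (η : Rd d → ℝ) (k : Fin d → ℤ) : ℝ≥0∞ := ENNReal.ofReal (η (latticePoint k))

/-- The step function with the values `a k` on the cubes `k + [-1, 1]^d`. -/
def stepFun {d : ℕ} (a : (Fin d → ℤ) → ℝ≥0∞) (x : Rd d) : ℝ≥0∞ :=
  ∑' k, (cube k).indicator (fun _ => a k) x

section stepFun

variable {d : ℕ} {η : Rd d → ℝ}

theorem mem_cube_intPart (x : Rd d) : x ∈ cube (intPart x) := fun i => by
  change |x i - ⌊x i⌋| ≤ 1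
  rw [abs_of_nonneg (by linarith [Int.floor_le (x i)])]
  linarith [Int.lt_floor_add_one (x i)]

theorem norm_sub_le_of_mem_cube {k : Fin d → ℤ} {x : Rd d} (hx : x ∈ cube k) :
    ‖x - latticePoint k‖ ≤ d := by
  refine (norm_le_card_of_abs_le (c := 1) _ fun i => ?_).trans (by simp)
  exact hx i

/-- The neighbours of the origin in the lattice. -/
def nbhd (d : ℕ) : Finset (Fin d → ℤ) := Fintype.piFinset fun _ => Finset.Icc (-1) 2

theorem sub_intPart_mem_nbhd {k : Fin d → ℤ} {x : Rd d} (hx : x ∈ cube k) :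
    k - intPart x ∈ nbhd d := by
  refine Fintype.mem_piFinset.2 fun i => Finset.mem_Icc.2 ?_
  have h := abs_le.1 (hx i)
  have h1 := Int.floor_le (x i)
  have h2 := Int.lt_floor_add_one (x i)
  have h3 : (k i : ℝ) - ⌊x i⌋ < 3 := by linarith
  have h4 : (-2 : ℝ) < (k i : ℝ) - ⌊x i⌋ := by linarith
  have h3' : k i - ⌊x i⌋ < 3 := by exact_mod_cast h3
  have h4' : -2 < k i - ⌊x i⌋ := by exact_mod_cast h4
  change -1 ≤ k i - ⌊x i⌋ ∧ k i - ⌊x i⌋ ≤ 2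
  omega

theorem IsPolyWeight.exists_latW_le (hη : IsPolyWeight η) : ∃ C : ℝ≥0, 0 < C ∧
    ∀ (k : Fin d → ℤ) (x : Rd d), x ∈ cube k →
      ENNReal.ofReal (η x) ≤ C * latW η k ∧ latW η k ≤ C * ENNReal.ofReal (η x) := by
  obtain ⟨N, C, hC, h⟩ := hη.exists_nat
  refine ⟨Real.toNNReal (C * (1 + d) ^ N), Real.toNNReal_pos.2 (by positivity), fun k x hx => ?_⟩
  have hb := norm_sub_le_of_mem_cube hx
  have hb' : ‖latticePoint k - x‖ ≤ d := by rwa [norm_sub_rev]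
  rw [latW]
  change _ ≤ ENNReal.ofReal _ * _ ∧ _ ≤ ENNReal.ofReal _ * _
  rw [← ENNReal.ofReal_mul (by positivity), ← ENNReal.ofReal_mul (by positivity)]
  constructor <;> refine ENNReal.ofReal_le_ofReal ?_
  · have h1 := h (latticePoint k) (x - latticePoint k)
    rw [add_sub_cancel] at h1
    refine h1.trans ?_
    calc C * η (latticePoint k) * (1 + ‖x - latticePoint k‖) ^ N
        ≤ C * η (latticePoint k) * (1 + d) ^ N := by
          have := (hη.pos (latticePoint k)).le
          gcongr
      _ = _ := by ring
  · have h1 := h x (latticePoint k - x)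
    rw [add_sub_cancel] at h1
    refine h1.trans ?_
    calc C * η x * (1 + ‖latticePoint k - x‖) ^ N
        ≤ C * η x * (1 + d) ^ N := by
          have := (hη.pos x).le
          gcongr
      _ = _ := by ring

theorem IsPolyWeight.exists_stepFun_le (hη : IsPolyWeight η) : ∃ C : ℝ≥0, 0 < C ∧
    ∀ (a : (Fin d → ℤ) → ℝ≥0∞) (x : Rd d), stepFun a x * ENNReal.ofReal (η x) ≤
      C * ∑ r ∈ nbhd d, a (intPart x + r) * latW η (intPart x + r) := by
  obtain ⟨C, hC, h⟩ := hη.exists_latW_le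
  refine ⟨C, hC, fun a x => ?_⟩
  rw [stepFun, ← ENNReal.tsum_mul_right, Finset.mul_sum,
    ← (Equiv.addLeft (intPart x)).tsum_eq, tsum_eq_sum (s := nbhd d)]
  · refine Finset.sum_le_sum fun r _ => ?_
    rw [Equiv.coe_addLeft]
    by_cases hx : x ∈ cube (intPart x + r)
    · rw [Set.indicator_of_mem hx]
      calc a (intPart x + r) * ENNReal.ofReal (η x)
          ≤ a (intPart x + r) * (C * latW η (intPart x + r)) := by gcongr; exact (h _ x hx).1
        _ = _ := by ring
    · rw [Set.indicator_of_notMem hx, zero_mul]; exact zero_le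
  · intro r hr
    rw [Equiv.coe_addLeft, Set.indicator_of_notMem, zero_mul]
    intro hx
    exact hr (by simpa using sub_intPart_mem_nbhd hx)

theorem IsPolyWeight.exists_le_stepFun (hη : IsPolyWeight η) : ∃ C : ℝ≥0, 0 < C ∧
    ∀ (a : (Fin d → ℤ) → ℝ≥0∞) (x : Rd d), a (intPart x) * latW η (intPart x) ≤
      C * (stepFun a x * ENNReal.ofReal (η x)) := by
  obtain ⟨C, hC, h⟩ := hη.exists_latW_le
  refine ⟨C, hC, fun a x => ?_⟩
  have h1 : a (intPart x) ≤ stepFun a x := by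
    refine le_trans (le_of_eq ?_) (ENNReal.le_tsum (intPart x))
    rw [Set.indicator_of_mem (mem_cube_intPart x)]
  calc a (intPart x) * latW η (intPart x) ≤ stepFun a x * (C * ENNReal.ofReal (η x)) := by
        gcongr
        exact (h _ x (mem_cube_intPart x)).2
    _ = _ := by ring

theorem eLpNorm_comp_intPart (p : ℝ≥0∞) (b : (Fin d → ℤ) → ℝ≥0∞) :
    eLpNorm (b ∘ intPart) p volume = lpN p b :=
  eLpNorm_comp_measurePreserving (measurable_of_countable b).aestronglyMeasurable
    measurePreserving_intPart

theorem eLpNorm_le_const_mul {p : ℝ≥0∞} {C : ℝ≥0} {a b : Rd d → ℝ≥0∞} (h : ∀ x, a x ≤ C * b x) :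
    eLpNorm a p volume ≤ C * eLpNorm b p volume :=
  eLpNorm_le_nnreal_smul_eLpNorm_of_ae_le_mul' (.of_forall h) p

theorem IsPolyWeight.exists_lpENorm_stepFun_le (hη : IsPolyWeight η) {p : ℝ≥0∞} (hp : 1 ≤ p) :
    ∃ C : ℝ≥0, ∀ a : (Fin d → ℤ) → ℝ≥0∞,
      lpENorm η p (stepFun a) ≤ C * lpN p (fun k => a k * latW η k) := by
  obtain ⟨C, hC, h⟩ := hη.exists_stepFun_le
  refine ⟨C * (nbhd d).card, fun a => ?_⟩
  let b : (Fin d → ℤ) → ℝ≥0∞ := fun k => a k * latW η k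
  have h1 : lpENorm η p (stepFun a) ≤
      C * eLpNorm ((fun k => ∑ r ∈ nbhd d, b (k + r)) ∘ intPart) p volume :=
    eLpNorm_le_const_mul fun x => h a x
  refine h1.trans ?_
  rw [eLpNorm_comp_intPart]
  push_cast
  rw [mul_assoc]
  gcongr
  refine (lpN_sum_le hp _ _).trans (le_of_eq ?_)
  have h2 : ∀ r ∈ nbhd d, lpN p (fun k => b (k + r)) = lpN p b := fun r _ =>
    lpN_comp_equiv (Equiv.addRight r) b
  rw [Finset.sum_congr rfl h2, Finset.sum_const, nsmul_eq_mul]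

theorem IsPolyWeight.exists_lpN_le_lpENorm_stepFun (hη : IsPolyWeight η) (p : ℝ≥0∞) :
    ∃ C : ℝ≥0, 0 < C ∧ ∀ a : (Fin d → ℤ) → ℝ≥0∞,
      lpN p (fun k => a k * latW η k) ≤ C * lpENorm η p (stepFun a) := by
  obtain ⟨C, hC, h⟩ := hη.exists_le_stepFun
  refine ⟨C, hC, fun a => ?_⟩
  rw [← eLpNorm_comp_intPart]
  exact eLpNorm_le_const_mul fun x => h a x

theorem tendsto_sum_shift {b : (Fin d → ℤ) → ℝ≥0∞} (hb : Tendsto b cofinite (𝓝 0))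
    (s : Finset (Fin d → ℤ)) : Tendsto (fun k => ∑ r ∈ s, b (k + r)) cofinite (𝓝 0) := by
  have h := tendsto_finsetSum (f := fun r k => b (k + r)) s fun r _ =>
    hb.comp (Equiv.addRight r).injective.tendsto_cofinite
  simpa using h

theorem IsPolyWeight.vanishesAtInfinity_stepFun_iff (hη : IsPolyWeight η)
    (a : (Fin d → ℤ) → ℝ≥0∞) :
    VanishesAtInfinity η (stepFun a) ↔ Tendsto (fun k => a k * latW η k) cofinite (𝓝 0) := by
  constructor
  · intro hv
    obtain ⟨C, hC, h⟩ := hη.exists_le_stepFun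
    have hC0 : (C : ℝ≥0∞) ≠ 0 := by exact_mod_cast hC.ne'
    rw [ENNReal.tendsto_nhds_zero]
    intro ε hε
    obtain ⟨K, hK, hKε⟩ := hv (ε / C) (ENNReal.div_pos hε.ne' ENNReal.coe_ne_top)
    obtain ⟨R, hR⟩ := hK.isBounded.exists_norm_le
    refine (finite_lattice_box (0 : Rd d) (R + d)).subset fun k hk => ?_
    by_contra hk'
    refine hk ?_
    have hdisj : intPart ⁻¹' {k} ⊆ Kᶜ := fun x hx hxK => hk' fun i => by
      have hx : intPart x = k := hx
      have h1 : |(latticePoint k : Rd d) i| ≤ ‖(latticePoint k : Rd d)‖ :=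
        PiLp.norm_apply_le (latticePoint k : Rd d) i
      have h2 := norm_sub_intPart_le x
      rw [hx, norm_sub_rev] at h2
      have h3 : ‖(latticePoint k : Rd d)‖ ≤ ‖latticePoint k - x‖ + ‖x‖ := by
        simpa using norm_add_le (latticePoint k - x) x
      have h4 := hR x hxK
      rw [latticePoint_apply] at h1
      simp only [PiLp.zero_apply, zero_sub, abs_neg]
      linarith
    have hae : ∀ᵐ x ∂volume.restrict Kᶜ, stepFun a x * ENNReal.ofReal (η x) ≤ ε / C := by
      rw [eLpNorm_exponent_top] at hKε
      filter_upwards [ae_le_eLpNormEssSup (μ := volume.restrict Kᶜ)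
        (f := fun x => stepFun a x * ENNReal.ofReal (η x))] with x hx
      exact (by simpa using hx : _ ≤ _).trans hKε
    have hm : volume (intPart ⁻¹' {k} : Set (Rd d)) = 1 := by
      rw [measurePreserving_intPart.measure_preimage (measurableSet_singleton k).nullMeasurableSet,
        Measure.count_singleton]
    obtain ⟨x, hx1, hx2⟩ : ∃ x, intPart x = k ∧ stepFun a x * ENNReal.ofReal (η x) ≤ ε / C := by
      by_contra hne
      push Not at hne
      have hz : (volume.restrict Kᶜ) (intPart ⁻¹' {k} : Set (Rd d)) = 0 := by
        refine measure_mono_null (fun x hx => ?_) hae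
        exact not_le.2 (hne x hx)
      rw [Measure.restrict_apply (measurable_intPart (measurableSet_singleton k)),
        Set.inter_eq_left.2 hdisj, hm] at hz
      exact one_ne_zero hz
    have h5 := h a x
    rw [hx1] at h5
    refine h5.trans ((mul_le_mul_right hx2 _).trans ?_)
    exact ENNReal.mul_div_le
  · intro ht ε hε
    obtain ⟨C, hC, h⟩ := hη.exists_stepFun_le
    have hC0 : (C : ℝ≥0∞) ≠ 0 := by exact_mod_cast hC.ne'
    have h1 := tendsto_sum_shift ht (nbhd d)
    rw [ENNReal.tendsto_nhds_zero] at h1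
    have h2 := h1 (ε / C) (ENNReal.div_pos hε.ne' ENNReal.coe_ne_top)
    rw [eventually_cofinite] at h2
    obtain ⟨R, hR⟩ := (h2.image latticePoint).isBounded.exists_norm_le
    refine ⟨Metric.closedBall 0 (R + d), isCompact_closedBall _ _, ?_⟩
    rw [eLpNorm_exponent_top]
    refine eLpNormEssSup_le_of_ae_enorm_bound ?_
    filter_upwards [ae_restrict_mem (Metric.isClosed_closedBall.measurableSet.compl)] with x hx
    rw [enorm_eq_self]
    refine (h a x).trans ((mul_le_mul_right ?_ _).trans (ENNReal.mul_div_le (a := C)))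
    by_contra hne
    refine hx ?_
    have h3 := hR _ ⟨intPart x, hne, rfl⟩
    have h4 := norm_sub_intPart_le x
    have h5 : ‖x‖ ≤ ‖x - latticePoint (intPart x)‖ + ‖(latticePoint (intPart x) : Rd d)‖ := by
      simpa using norm_add_le (x - latticePoint (intPart x)) (latticePoint (intPart x))
    rw [mem_closedBall_zero_iff]
    linarith

end stepFun

/-- The weighted sequence of the local norms of a distribution. -/
def locSeq {d : ℕ} (E : DistSpace d) (φ : Test d) (η : Rd d → ℝ) (u : Dist d) (k : Fin d → ℤ) :
    ℝ≥0∞ :=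
  localENorm E (testTranslate (latticePoint k) φ) u * latW η k

theorem locSeq_restr {d : ℕ} (E : DistSpace d) {φ : Test d} (hφ : IsPartitionGenerator φ)
    (η : Rd d → ℝ) (f : 𝓢'(Rd d, ℂ)) (k : Fin d → ℤ) :
    locSeq E φ η (restr f) k = E.eNorm (mulD (pu φ k) f) * latW η k := by
  rw [locSeq, localENorm_eq hφ E (isProduct_mulD _ f)]
  rfl

/-- The extended norm `N` describes the closure of the test functions in an amalgam space with the
local component `E` and the global component `L^p_η`: it is equivalent to a norm of a sequence
space. -/
structure IsAmalgamNorm {d : ℕ} (N : Dist d → ℝ≥0∞) (E : DistSpace d) (φ : Test d) (η : Rd d → ℝ)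
    (p : ℝ≥0∞) : Prop where
  one_le : 1 ≤ p
  lpN_le : ∃ C : ℝ≥0, ∀ u, lpN p (locSeq E φ η u) ≤ C * N u
  le_lpN : ∃ C : ℝ≥0, ∀ u, IsLocallyIn E u → Tendsto (locSeq E φ η u) cofinite (𝓝 0) →
    N u ≤ C * lpN p (locSeq E φ η u)
  isLocallyIn : ∀ u, N u < ∞ → IsLocallyIn E u
  tendsto : ∀ u, N u < ∞ → Tendsto (locSeq E φ η u) cofinite (𝓝 0)

theorem isAmalgamNorm_amalgamENorm {d : ℕ} (E : DistSpace d) (φ : Test d) {η : Rd d → ℝ}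
    (hη : IsPolyWeight η) {p : ℝ≥0∞} (hp : 1 ≤ p) (hp' : p ≠ ∞) :
    IsAmalgamNorm (amalgamENorm E φ η p) E φ η p := by
  obtain ⟨C₁, hC₁, h₁⟩ := hη.exists_lpN_le_lpENorm_stepFun p
  obtain ⟨C₂, h₂⟩ := hη.exists_lpENorm_stepFun_le hp
  have hle : ∀ u, lpN p (locSeq E φ η u) ≤ C₁ * amalgamENorm E φ η p u := fun u => by
    by_cases hu : IsLocallyIn E u
    · rw [amalgamENorm, iInf_pos hu]
      exact h₁ _
    · rw [amalgamENorm, iInf_neg hu, ENNReal.mul_top (by exact_mod_cast hC₁.ne')]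
      exact le_top
  refine ⟨hp, ⟨C₁, hle⟩, ⟨C₂, fun u hu _ => ?_⟩, fun u hu => ?_, fun u hu => ?_⟩
  · rw [amalgamENorm, iInf_pos hu]
    exact h₂ _
  · by_contra h
    rw [amalgamENorm, iInf_neg h] at hu
    exact lt_irrefl _ hu
  · exact tendsto_of_lpN_lt_top hp hp' ((hle u).trans_lt (ENNReal.mul_lt_top ENNReal.coe_lt_top hu))

theorem isAmalgamNorm_amalgamZeroENorm {d : ℕ} (E : DistSpace d) (φ : Test d) {η : Rd d → ℝ}
    (hη : IsPolyWeight η) : IsAmalgamNorm (amalgamZeroENorm E φ η) E φ η ∞ := by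
  obtain ⟨C₁, hC₁, h₁⟩ := hη.exists_lpN_le_lpENorm_stepFun ∞
  obtain ⟨C₂, h₂⟩ := hη.exists_lpENorm_stepFun_le (p := ∞) le_top
  have hv : ∀ u, VanishesAtInfinity η (controlFun E φ u) ↔
      Tendsto (locSeq E φ η u) cofinite (𝓝 0) := fun u => hη.vanishesAtInfinity_stepFun_iff _
  refine ⟨le_top, ⟨C₁, fun u => ?_⟩, ⟨C₂, fun u hu ht => ?_⟩, fun u hu => ?_, fun u hu => ?_⟩
  · by_cases hu : IsLocallyIn E u ∧ VanishesAtInfinity η (controlFun E φ u)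
    · rw [amalgamZeroENorm, iInf_pos hu.1, linftyZeroENorm, iInf_pos hu.2]
      exact h₁ _
    · have : amalgamZeroENorm E φ η u = ∞ := by
        rw [amalgamZeroENorm, iInf_eq_top]
        intro hu1
        rw [linftyZeroENorm, iInf_neg fun h => hu ⟨hu1, h⟩]
      rw [this, ENNReal.mul_top (by exact_mod_cast hC₁.ne')]
      exact le_top
  · rw [amalgamZeroENorm, iInf_pos hu, linftyZeroENorm, iInf_pos ((hv u).2 ht)]
    exact h₂ _
  · by_contra h
    rw [amalgamZeroENorm, iInf_neg h] at hu
    exact lt_irrefl _ hu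
  · by_contra h
    have : amalgamZeroENorm E φ η u = ∞ := by
      rw [amalgamZeroENorm, iInf_eq_top]
      intro hu1
      rw [linftyZeroENorm, iInf_neg fun h' => h ((hv u).1 h')]
    exact hu.ne this

/-! ### Amalgam spaces of tempered distributions -/

/-- A summable weight on the lattice. -/
def latDecay {d : ℕ} (k : Fin d → ℤ) : ℝ≥0∞ :=
  ENNReal.ofReal (((1 + ‖latticePoint k‖) ^ (d + 1))⁻¹)

theorem latDecay_ne_top {d : ℕ} (k : Fin d → ℤ) : latDecay k ≠ ∞ := ENNReal.ofReal_ne_top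

theorem tsum_latDecay_ne_top (d : ℕ) : ∑' k : Fin d → ℤ, latDecay k ≠ ∞ := by
  simp only [latDecay]
  rw [← ENNReal.ofReal_tsum_of_nonneg (fun k => by positivity)
    (summable_lattice (Nat.lt_succ_self d))]
  exact ENNReal.ofReal_ne_top

theorem tsum_latDecay_sub {d : ℕ} (k : Fin d → ℤ) :
    ∑' j, latDecay (k - j) = ∑' j : Fin d → ℤ, latDecay j :=
  (Equiv.subLeft k).tsum_eq latDecay

theorem latW_ne_top {d : ℕ} (η : Rd d → ℝ) (k : Fin d → ℤ) : latW η k ≠ ∞ := ENNReal.ofReal_ne_top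

theorem IsPolyWeight.latW_ne_zero {d : ℕ} {η : Rd d → ℝ} (hη : IsPolyWeight η) (k : Fin d → ℤ) :
    latW η k ≠ 0 := by
  rw [latW, Ne, ENNReal.ofReal_eq_zero, not_le]
  exact hη.pos _

theorem latW_mul {d : ℕ} {η₁ : Rd d → ℝ} (h₁ : IsPolyWeight η₁) (η₂ : Rd d → ℝ) (k : Fin d → ℤ) :
    latW (fun x => η₁ x * η₂ x) k = latW η₁ k * latW η₂ k :=
  ENNReal.ofReal_mul (h₁.pos _).le

theorem IsPolyWeight.exists_latW_le_latW {d : ℕ} {η : Rd d → ℝ} (hη : IsPolyWeight η) :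
    ∃ N : ℕ, ∃ C > 0, ∀ j k : Fin d → ℤ,
      latW η j ≤ ENNReal.ofReal (C * (1 + ‖latticePoint (j - k)‖) ^ N) * latW η k := by
  obtain ⟨N, C, hC, h⟩ := hη.exists_nat
  refine ⟨N, C, hC, fun j k => ?_⟩
  rw [latW, latW, ← ENNReal.ofReal_mul (by positivity)]
  refine ENNReal.ofReal_le_ofReal ?_
  have h1 := h (latticePoint k) (latticePoint (j - k))
  rw [latticePoint_sub, add_sub_cancel] at h1
  rw [latticePoint_sub]
  linarith

theorem norm_latticePoint_sub_comm {d : ℕ} (j k : Fin d → ℤ) :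
    ‖latticePoint (j - k)‖ = ‖latticePoint (k - j)‖ := by
  rw [latticePoint_sub, latticePoint_sub, norm_sub_rev]

section local_parts

variable {d : ℕ} {E : DistSpace d}

theorem DistSpace.IsTMIB.exists_enorm_apply_le (hE : E.IsTMIB) : ∃ m : ℕ, ∃ C > 0,
    ∀ (e : 𝓢'(Rd d, ℂ)) (ψ : 𝓢(Rd d, ℂ)), ‖e ψ‖ₑ ≤ ENNReal.ofReal (C * SN m ψ) * E.eNorm e := by
  obtain ⟨m, C, hC, h⟩ := hE.exists_norm_apply_le
  refine ⟨m, C, hC, fun e ψ => ?_⟩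
  by_cases hψ : SN m ψ = 0
  · have h0 : ψ = 0 := by
      ext x
      have h1 := norm_apply_le_SN (Nat.zero_le m) ψ x
      rw [hψ, pow_zero, one_mul, mul_zero] at h1
      exact norm_le_zero_iff.1 h1
    rw [h0, map_zero, enorm_zero]
    exact zero_le
  by_cases he : E.eNorm e < ∞
  · have h1 := h (E.elem e he) ψ
    rw [E.incl_elem, E.norm_elem] at h1
    rw [← ofReal_norm, ← ENNReal.ofReal_toReal he.ne, ← ENNReal.ofReal_mul (by positivity)]
    exact ENNReal.ofReal_le_ofReal (h1.trans (le_of_eq (by ring)))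
  · rw [not_lt_top_iff.1 he, ENNReal.mul_top]
    · exact le_top
    · rw [Ne, ENNReal.ofReal_eq_zero, not_le]
      exact mul_pos hC (lt_of_le_of_ne (apply_nonneg _ _) (Ne.symm hψ))

theorem DistSpace.IsTMIB.exists_enorm_local_apply_le (hE : E.IsTMIB) {η : Rd d → ℝ}
    (hη : IsPolyWeight η) (τ : 𝓢(Rd d, ℂ)) : ∃ m : ℕ, ∃ C > 0,
    ∀ k : Fin d → ℤ, (∀ e, E.eNorm (translate (-latticePoint k) e) ≤ E.eNorm e) →
    ∀ (j : Fin d → ℤ) (e : 𝓢'(Rd d, ℂ)) (ψ : 𝓢(Rd d, ℂ)),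
      ‖mulD (tr (latticePoint j) τ) e (tr (latticePoint k) ψ)‖ₑ * latW η k ≤
        ENNReal.ofReal (C * SN m ψ) * (latDecay (k - j) * (E.eNorm e * latW η j)) := by
  obtain ⟨m, C₁, hC₁, h₁⟩ := hE.exists_enorm_apply_le
  obtain ⟨N, C₂, hC₂, h₂⟩ := hη.exists_latW_le_latW
  refine ⟨m + (N + (d + 1)),
    C₁ * C₂ * (2 ^ m * 4 ^ (m + (N + (d + 1))) * (SN (m + (N + (d + 1))) τ + 1)),
    by positivity, fun k hk j e ψ => ?_⟩
  set M := m + (N + (d + 1)) with hM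
  have e1 : mulD (tr (latticePoint j) τ) e (tr (latticePoint k) ψ) =
      translate (-latticePoint k) e (mulS (tr (latticePoint (j - k)) τ) ψ) := by
    rw [mulD_apply, translate_apply, neg_neg, tr_mulS, tr_tr, latticePoint_sub, add_sub_cancel]
  have e2 : SN m (mulS (tr (latticePoint (j - k)) τ) ψ) ≤
      2 ^ m * 4 ^ M * SN M ψ * SN M τ * ((1 + ‖latticePoint (k - j)‖) ^ (N + (d + 1)))⁻¹ := by
    rw [← div_eq_mul_inv, le_div_iff₀ (by positivity), mulS_comm, norm_latticePoint_sub_comm]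
    exact SN_mulS_tr_le m _ ψ τ _
  rw [e1]
  calc ‖translate (-latticePoint k) e (mulS (tr (latticePoint (j - k)) τ) ψ)‖ₑ * latW η k
      ≤ (ENNReal.ofReal (C₁ * SN m (mulS (tr (latticePoint (j - k)) τ) ψ)) * E.eNorm e) *
          (ENNReal.ofReal (C₂ * (1 + ‖latticePoint (k - j)‖) ^ N) * latW η j) := by
        gcongr
        · refine (h₁ _ _).trans ?_
          gcongr
          exact hk e
        · exact h₂ k j
    _ = ENNReal.ofReal (C₁ * SN m (mulS (tr (latticePoint (j - k)) τ) ψ) *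
          (C₂ * (1 + ‖latticePoint (k - j)‖) ^ N)) * (E.eNorm e * latW η j) := by
        rw [ENNReal.ofReal_mul (p := C₁ * SN m (mulS (tr (latticePoint (j - k)) τ) ψ))
          (by positivity)]
        ring
    _ ≤ ENNReal.ofReal (C₁ * C₂ * (2 ^ m * 4 ^ M * (SN M τ + 1)) * SN M ψ *
          ((1 + ‖latticePoint (k - j)‖) ^ (d + 1))⁻¹) * (E.eNorm e * latW η j) := by
        refine mul_le_mul_left (ENNReal.ofReal_le_ofReal ?_) _
        have hpos : 0 < 1 + ‖latticePoint (k - j)‖ := by positivity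
        calc C₁ * SN m (mulS (tr (latticePoint (j - k)) τ) ψ) *
              (C₂ * (1 + ‖latticePoint (k - j)‖) ^ N)
            ≤ C₁ * (2 ^ m * 4 ^ M * SN M ψ * (SN M τ + 1) *
              ((1 + ‖latticePoint (k - j)‖) ^ (N + (d + 1)))⁻¹) *
              (C₂ * (1 + ‖latticePoint (k - j)‖) ^ N) := by
              gcongr
              refine e2.trans ?_
              gcongr
              linarith
          _ = _ := by
              rw [pow_add _ N, mul_inv]
              field_simp
    _ = _ := by
        rw [ENNReal.ofReal_mul (by positivity), latDecay]
        ring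

/-- The functions of the partition of unity that meet a given compact set. -/
theorem exists_finset_pu {φ : Test d} (hφ : IsPartitionGenerator φ) {χ : Rd d → ℂ}
    (hχ : HasCompactSupport χ) : ∃ S : Finset (Fin d → ℤ), ∀ k ∉ S, ∀ x, pu φ k x * χ x = 0 := by
  obtain ⟨R, hR⟩ := hχ.isCompact.isBounded.exists_norm_le
  refine ⟨(finite_lattice_box (0 : Rd d) (R + 1)).toFinset, fun k hk x => ?_⟩
  by_contra hne
  refine hk ?_
  rw [Set.Finite.mem_toFinset]
  intro i
  have h1 := hφ.supp (x - latticePoint k) (fun h => hne (by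
    rw [show pu φ k x = testToSchwartz φ (x - latticePoint k) from rfl, h, zero_mul])) i
  have h2 := hR x (subset_tsupport _ fun h => hne (by rw [h, mul_zero]))
  have h3 : |x i| ≤ ‖x‖ := PiLp.norm_apply_le x i
  have h4 : |x i - k i| < 1 := h1
  simp only [PiLp.zero_apply, zero_sub, abs_neg]
  rw [abs_lt] at h4
  rw [abs_le] at h3 ⊢
  constructor <;> linarith

theorem sum_pu_mulS {φ : Test d} (hφ : IsPartitionGenerator φ) {χ : 𝓢(Rd d, ℂ)}
    {S : Finset (Fin d → ℤ)} (hS : ∀ k ∉ S, ∀ x, pu φ k x * χ x = 0) :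
    ∑ k ∈ S, mulS (pu φ k) χ = χ := by
  refine (hasSum_sum_of_ne_finset_zero fun k hk => ?_).unique (hasSum_pu_mulS hφ χ)
  ext x
  rw [mulS_apply]
  exact hS k hk x

theorem mulD_tr_cutoff {φ : Test d} {τ : 𝓢(Rd d, ℂ)} (hτ : IsCutoff φ τ) (k : Fin d → ℤ)
    (f : 𝓢'(Rd d, ℂ)) : mulD (tr (latticePoint k) τ) (mulD (pu φ k) f) = mulD (pu φ k) f := by
  rw [mulD_mulD, hτ.mulS_tr_eq]

theorem hasSum_mulD_pu {φ : Test d} (hφ : IsPartitionGenerator φ) (f : 𝓢'(Rd d, ℂ))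
    (ψ : 𝓢(Rd d, ℂ)) : HasSum (fun k => mulD (pu φ k) f ψ) (f ψ) :=
  hasSum_tempered f (hasSum_pu_mulS hφ ψ)

theorem DistSpace.IsTMIB.eNorm_mulD_lt_top (hE : E.IsTMIB) {φ : Test d}
    (hφ : IsPartitionGenerator φ) (h : 𝓢(Rd d, ℂ)) {f : 𝓢'(Rd d, ℂ)} {k : Fin d → ℤ}
    (hf : E.eNorm (mulD (pu φ k) f) < ∞) : E.eNorm (mulD h (mulD (pu φ k) f)) < ∞ := by
  obtain ⟨τ, hτ⟩ := exists_isCutoff hφ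
  obtain ⟨m, C, hC, hM⟩ := hE.exists_eNorm_mulD_le hφ hτ
  have h1 := hM (tr (-latticePoint k) h) (latticePoint k) f
  rw [tr_tr, add_neg_cancel, tr_zero] at h1
  exact h1.trans_lt (ENNReal.mul_lt_top ENNReal.ofReal_lt_top hf)

theorem DistSpace.IsTMIB.isLocallyIn_restr (hE : E.IsTMIB) {φ : Test d}
    (hφ : IsPartitionGenerator φ) {f : 𝓢'(Rd d, ℂ)}
    (hf : ∀ k, E.eNorm (mulD (pu φ k) f) < ∞) : IsLocallyIn E (restr f) := by
  intro χ
  refine ⟨mulD (testToSchwartz χ) f, isProduct_mulD χ f, ?_⟩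
  obtain ⟨S, hS⟩ := exists_finset_pu hφ (hasCompactSupport_testToSchwartz χ)
  have h1 : mulD (testToSchwartz χ) f =
      ∑ k ∈ S, mulD (testToSchwartz χ) (mulD (pu φ k) f) := by
    ext ψ
    have h2 := congrArg (fun θ => f (mulS θ ψ)) (sum_pu_mulS hφ hS)
    simp only [mulD_apply] at h2 ⊢
    rw [← h2]
    have h3 : mulS (∑ k ∈ S, mulS (pu φ k) (testToSchwartz χ)) ψ =
        ∑ k ∈ S, mulS (pu φ k) (mulS (testToSchwartz χ) ψ) := by
      ext x
      simp only [mulS_apply, sum_apply, Finset.sum_mul, mul_assoc]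
    rw [h3, map_sum]
    have h4 : ∀ T : Finset (Fin d → ℤ), (∑ k ∈ T, mulD (testToSchwartz χ) (mulD (pu φ k) f)) ψ =
        ∑ k ∈ T, f (mulS (pu φ k) (mulS (testToSchwartz χ) ψ)) := fun T => by
      classical
      induction T using Finset.induction_on with
      | empty => simp
      | insert a T ha ih =>
        rw [Finset.sum_insert ha, Finset.sum_insert ha, add_apply, ih]
        rfl
    exact (h4 S).symm
  rw [h1]
  exact Submodule.sum_mem _ fun k _ => hE.eNorm_mulD_lt_top hφ _ (hf k)

end local_parts

/-- The weighted sequence of the local norms of a tempered distribution. -/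
def ampl {d : ℕ} (E : DistSpace d) (φ : Test d) (η : Rd d → ℝ) (f : 𝓢'(Rd d, ℂ)) (k : Fin d → ℤ) :
    ℝ≥0∞ :=
  E.eNorm (mulD (pu φ k) f) * latW η k

/-- The space `W` is the closure of the Schwartz functions in an amalgam space with the local
component `E` and the global component `L^p_η`. -/
structure IsAmalgam {d : ℕ} (W E : DistSpace d) (φ : Test d) (η : Rd d → ℝ) (p : ℝ≥0∞) : Prop where
  one_le : 1 ≤ p
  lpN_le : ∃ C : ℝ≥0, ∀ f, lpN p (ampl E φ η f) ≤ C * W.eNorm f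
  le_lpN : ∃ C : ℝ≥0, ∀ f, Tendsto (ampl E φ η f) cofinite (𝓝 0) →
    W.eNorm f ≤ C * lpN p (ampl E φ η f)
  tendsto : ∀ f, W.eNorm f < ∞ → Tendsto (ampl E φ η f) cofinite (𝓝 0)

theorem IsAmalgamNorm.isAmalgam {d : ℕ} {N : Dist d → ℝ≥0∞} {W E : DistSpace d} {φ : Test d}
    {η : Rd d → ℝ} {p : ℝ≥0∞} (hN : IsAmalgamNorm N E φ η p) (hE : E.IsTMIB)
    (hφ : IsPartitionGenerator φ) (hη : IsPolyWeight η) (hW : ∀ f, W.eNorm f = N (restr f)) :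
    IsAmalgam W E φ η p := by
  have h : ∀ f, ampl E φ η f = locSeq E φ η (restr f) := fun f =>
    funext fun k => (locSeq_restr E hφ η f k).symm
  obtain ⟨C₁, h₁⟩ := hN.lpN_le
  obtain ⟨C₂, h₂⟩ := hN.le_lpN
  refine ⟨hN.one_le, ⟨C₁, fun f => ?_⟩, ⟨C₂ + 1, fun f hf => ?_⟩, fun f hf => ?_⟩
  · rw [h, hW]; exact h₁ _
  · by_cases hfin : lpN p (ampl E φ η f) = ∞
    · rw [hfin, ENNReal.mul_top (by simp)]
      exact le_top
    rw [hW]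
    have hk : ∀ k, E.eNorm (mulD (pu φ k) f) < ∞ := fun k => by
      have h3 := (TMIB.le_lpN hN.one_le (ampl E φ η f) k).trans_lt (lt_top_iff_ne_top.2 hfin)
      by_contra h4
      rw [ampl, not_lt_top_iff.1 h4, ENNReal.top_mul (hη.latW_ne_zero k)] at h3
      exact lt_irrefl _ h3
    rw [h] at hf ⊢
    refine (h₂ _ (hE.isLocallyIn_restr hφ hk) hf).trans ?_
    gcongr
    simp
  · rw [hW] at hf
    rw [h]
    exact hN.tendsto _ hf

theorem isAmalgam_amalgam {d : ℕ} {E : DistSpace d} (hE : E.IsTMIB) {φ : Test d}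
    (hφ : IsPartitionGenerator φ) {η : Rd d → ℝ} (hη : IsPolyWeight η) {p : ℝ≥0∞} (hp : 1 ≤ p)
    (hp' : p ≠ ∞) : IsAmalgam (amalgam E φ η hη p hp) E φ η p :=
  (isAmalgamNorm_amalgamENorm E φ hη hp hp').isAmalgam hE hφ hη fun _ => rfl

theorem isAmalgam_amalgamZero {d : ℕ} {E : DistSpace d} (hE : E.IsTMIB) {φ : Test d}
    (hφ : IsPartitionGenerator φ) {η : Rd d → ℝ} (hη : IsPolyWeight η) :
    IsAmalgam (amalgamZero E φ η hη) E φ η ∞ :=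
  (isAmalgamNorm_amalgamZeroENorm E φ hη).isAmalgam hE hφ hη fun _ => rfl

namespace IsAmalgam

variable {d : ℕ} {W E : DistSpace d} {φ : Test d} {η : Rd d → ℝ} {p : ℝ≥0∞}

theorem exists_ampl_le (hW : IsAmalgam W E φ η p) :
    ∃ C : ℝ≥0, ∀ f k, ampl E φ η f k ≤ C * W.eNorm f := by
  obtain ⟨C, h⟩ := hW.lpN_le
  exact ⟨C, fun f k => (TMIB.le_lpN hW.one_le _ k).trans (h f)⟩

end IsAmalgam

theorem DistSpace.IsTMIB.exists_enorm_apply_tr_le {d : ℕ} {E : DistSpace d} (hE : E.IsTMIB)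
    {φ : Test d} (hφ : IsPartitionGenerator φ) {η : Rd d → ℝ} (hη : IsPolyWeight η) :
    ∃ m : ℕ, ∃ C > 0,
    ∀ k : Fin d → ℤ, (∀ e, E.eNorm (translate (-latticePoint k) e) ≤ E.eNorm e) →
    ∀ (f : 𝓢'(Rd d, ℂ)) (ψ : 𝓢(Rd d, ℂ)), ‖f (tr (latticePoint k) ψ)‖ₑ * latW η k ≤
      ENNReal.ofReal (C * SN m ψ) * ∑' j, latDecay (k - j) * ampl E φ η f j := by
  obtain ⟨τ, hτ⟩ := exists_isCutoff hφ
  obtain ⟨m, C, hC, h⟩ := hE.exists_enorm_local_apply_le hη τ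
  refine ⟨m, C, hC, fun k hk f ψ => ?_⟩
  rw [← (hasSum_mulD_pu hφ f (tr (latticePoint k) ψ)).tsum_eq, ← ENNReal.tsum_mul_left]
  refine (mul_le_mul_left (enorm_tsum_le_tsum_enorm) _).trans ?_
  rw [← ENNReal.tsum_mul_right]
  refine ENNReal.tsum_le_tsum fun j => ?_
  have h1 := h k hk j (mulD (pu φ j) f) ψ
  rwa [mulD_tr_cutoff hτ] at h1

theorem translate_zero {d : ℕ} (f : 𝓢'(Rd d, ℂ)) : translate 0 f = f := by
  ext ψ
  rw [translate_apply, neg_zero, tr_zero]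

theorem eNorm_translate_le_of_omega_eq_one {d : ℕ} {F : DistSpace d} (hF : F.IsTMIB)
    (hω : ∀ x, F.omega x = 1) (x : Rd d) (f : 𝓢'(Rd d, ℂ)) :
    F.eNorm (translate x f) ≤ F.eNorm f := by
  by_cases hf : F.eNorm f < ∞
  · have h := hF.eNorm_map_le (translate x) hf
    rwa [show F.opENorm (translate x) = 1 from hω x, one_mul] at h
  · rw [not_lt_top_iff.1 hf]; exact le_top

theorem tendsto_convolution {d : ℕ} {b : (Fin d → ℤ) → ℝ≥0∞} {M : ℝ≥0∞} (hM : M ≠ ∞)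
    (hbM : ∀ k, b k ≤ M) (hb : Tendsto b cofinite (𝓝 0)) :
    Tendsto (fun k => ∑' j, latDecay (k - j) * b j) cofinite (𝓝 0) := by
  have hbt : ∀ k, b k ≠ ∞ := fun k => ((hbM k).trans_lt (lt_top_iff_ne_top.2 hM)).ne
  have h1 : ∀ k, ∑' j, latDecay (k - j) * b j = ∑' r, latDecay r * b (k - r) := fun k => by
    rw [← (Equiv.subLeft k).tsum_eq fun j => latDecay (k - j) * b j]
    simp
  have h2 : Tendsto (fun k : Fin d → ℤ => ∑' r : Fin d → ℤ,
      ((1 + ‖latticePoint r‖) ^ (d + 1))⁻¹ * (b (k - r)).toReal) cofinite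
      (𝓝 (∑' _ : Fin d → ℤ, (0 : ℝ))) := by
    refine tendsto_tsum_of_dominated_convergence
      (bound := fun r => ((1 + ‖latticePoint r‖) ^ (d + 1))⁻¹ * M.toReal)
      ((summable_lattice (Nat.lt_succ_self d)).mul_right _) (fun r => ?_)
      (.of_forall fun k r => ?_)
    · have h3 : Tendsto (fun k => (b (k - r)).toReal) cofinite (𝓝 0) := by
        have h4 := (ENNReal.tendsto_toReal ENNReal.zero_ne_top).comp
          (hb.comp (Equiv.subRight r).injective.tendsto_cofinite)
        rw [ENNReal.toReal_zero] at h4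
        exact h4
      simpa using h3.const_mul (((1 + ‖latticePoint r‖) ^ (d + 1))⁻¹)
    · rw [Real.norm_of_nonneg (by positivity)]
      gcongr
      exact hbM _
  rw [tsum_zero] at h2
  have h5 := (ENNReal.tendsto_ofReal h2)
  rw [ENNReal.ofReal_zero] at h5
  refine h5.congr fun k => ?_
  rw [h1, ENNReal.ofReal_tsum_of_nonneg (fun r => by positivity)
    (((summable_lattice (Nat.lt_succ_self d)).mul_right M.toReal).of_nonneg_of_le
      (fun r => by positivity) fun r => ?_)]
  · refine tsum_congr fun r => ?_
    rw [ENNReal.ofReal_mul (by positivity), ENNReal.ofReal_toReal (hbt _), latDecay]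
  · gcongr
    exact hbM _

theorem tsum_latDecay_mul_le {d : ℕ} {b : (Fin d → ℤ) → ℝ≥0∞} {M : ℝ≥0∞} (hb : ∀ k, b k ≤ M)
    (k : Fin d → ℤ) :
    ∑' j, latDecay (k - j) * b j ≤ (∑' j : Fin d → ℤ, latDecay j) * M := by
  rw [← tsum_latDecay_sub k, ← ENNReal.tsum_mul_right]
  exact ENNReal.tsum_le_tsum fun j => by gcongr; exact hb j

namespace IsAmalgam

variable {d : ℕ} {W E : DistSpace d} {φ : Test d} {η : Rd d → ℝ} {p : ℝ≥0∞}

theorem exists_enorm_apply_tr_le (hW : IsAmalgam W E φ η p) (hE : E.IsTMIB)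
    (hφ : IsPartitionGenerator φ) (hη : IsPolyWeight η) : ∃ m : ℕ, ∃ C > 0,
    ∀ k : Fin d → ℤ, (∀ e, E.eNorm (translate (-latticePoint k) e) ≤ E.eNorm e) →
    ∀ (f : 𝓢'(Rd d, ℂ)) (ψ : 𝓢(Rd d, ℂ)), ‖f (tr (latticePoint k) ψ)‖ₑ * latW η k ≤
      ENNReal.ofReal (C * SN m ψ) * W.eNorm f := by
  obtain ⟨m, C₁, hC₁, h₁⟩ := hE.exists_enorm_apply_tr_le hφ hη
  obtain ⟨C₂, h₂⟩ := hW.exists_ampl_le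
  let T : ℝ := (∑' j : Fin d → ℤ, latDecay j).toReal
  have hT : ∑' j : Fin d → ℤ, latDecay j = ENNReal.ofReal T :=
    (ENNReal.ofReal_toReal (tsum_latDecay_ne_top d)).symm
  have hT0 : 0 ≤ T := ENNReal.toReal_nonneg
  refine ⟨m, C₁ * (T + 1) * (C₂ + 1), by positivity, fun k hk f ψ => ?_⟩
  refine (h₁ k hk f ψ).trans ?_
  calc ENNReal.ofReal (C₁ * SN m ψ) * ∑' j, latDecay (k - j) * ampl E φ η f j
      ≤ ENNReal.ofReal (C₁ * SN m ψ) * (ENNReal.ofReal T * (ENNReal.ofReal C₂ * W.eNorm f)) := by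
        gcongr
        rw [← hT]
        refine tsum_latDecay_mul_le (fun j => ?_) k
        simpa using h₂ f j
    _ = ENNReal.ofReal (C₁ * SN m ψ * T * C₂) * W.eNorm f := by
        rw [ENNReal.ofReal_mul (p := C₁ * SN m ψ * T) (by positivity),
          ENNReal.ofReal_mul (p := C₁ * SN m ψ) (by positivity)]
        ring
    _ ≤ _ := by
        refine mul_le_mul_left (ENNReal.ofReal_le_ofReal ?_) _
        calc C₁ * SN m ψ * T * C₂ ≤ C₁ * SN m ψ * (T + 1) * (C₂ + 1) := by gcongr <;> linarith
          _ = _ := by ring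

theorem tendsto_enorm_apply_tr (hW : IsAmalgam W E φ η p) (hE : E.IsTMIB)
    (hφ : IsPartitionGenerator φ) (hη : IsPolyWeight η)
    (ht : ∀ k e, E.eNorm (translate (-latticePoint k) e) ≤ E.eNorm e)
    {f : 𝓢'(Rd d, ℂ)} (hf : W.eNorm f < ∞) (ψ : 𝓢(Rd d, ℂ)) :
    Tendsto (fun k => ‖f (tr (latticePoint k) ψ)‖ₑ * latW η k) cofinite (𝓝 0) := by
  obtain ⟨m, C₁, hC₁, h₁⟩ := hE.exists_enorm_apply_tr_le hφ hη
  obtain ⟨C₂, h₂⟩ := hW.exists_ampl_le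
  have h3 := ENNReal.Tendsto.const_mul (a := ENNReal.ofReal (C₁ * SN m ψ)) (tendsto_convolution
    (ENNReal.mul_ne_top ENNReal.coe_ne_top hf.ne) (h₂ f) (hW.tendsto f hf))
    (Or.inr ENNReal.ofReal_ne_top)
  rw [mul_zero] at h3
  exact tendsto_of_tendsto_of_tendsto_of_le_of_le tendsto_const_nhds h3 (fun _ => zero_le)
    fun k => h₁ k (ht k) f ψ

theorem exists_enorm_apply_le (hW : IsAmalgam W E φ η p) (hE : E.IsTMIB)
    (hφ : IsPartitionGenerator φ) (hη : IsPolyWeight η) : ∃ m : ℕ, ∃ C > 0,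
    ∀ (f : 𝓢'(Rd d, ℂ)) (ψ : 𝓢(Rd d, ℂ)), ‖f ψ‖ₑ ≤ ENNReal.ofReal (C * SN m ψ) * W.eNorm f := by
  obtain ⟨m, C, hC, h⟩ := hW.exists_enorm_apply_tr_le hE hφ hη
  have h0 : 0 < η (latticePoint (0 : Fin d → ℤ)) := hη.pos _
  refine ⟨m, C / η (latticePoint (0 : Fin d → ℤ)), by positivity, fun f ψ => ?_⟩
  have h1 := h 0 (fun e => by rw [latticePoint_zero, neg_zero, translate_zero]) f ψ
  rw [latticePoint_zero, tr_zero] at h1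
  have h2 := (ENNReal.le_div_iff_mul_le (Or.inl (hη.latW_ne_zero 0))
    (Or.inl (latW_ne_top η 0))).2 h1
  refine h2.trans (le_of_eq ?_)
  rw [ENNReal.div_eq_inv_mul, ← mul_assoc]
  congr 1
  rw [latW, ← ENNReal.ofReal_inv_of_pos h0, ← ENNReal.ofReal_mul (by positivity)]
  congr 1
  field_simp

end IsAmalgam

/-- The distributions in an amalgam space are tempered. -/
theorem IsAmalgamNorm.exists_restr_eq {d : ℕ} {N : Dist d → ℝ≥0∞} {E : DistSpace d} {φ : Test d}
    {η : Rd d → ℝ} {p : ℝ≥0∞} (hN : IsAmalgamNorm N E φ η p) (hE : E.IsTMIB)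
    (hφ : IsPartitionGenerator φ) (hη : IsPolyWeight η) {u : Dist d} (hu : N u < ∞) :
    ∃ f : 𝓢'(Rd d, ℂ), restr f = u := by
  obtain ⟨τ, hτ⟩ := exists_isCutoff hφ
  choose e he heE using fun k : Fin d → ℤ =>
    hN.isLocallyIn u hu (testTranslate (latticePoint k) φ)
  have hloc : ∀ k, mulD (tr (latticePoint k) τ) (e k) = e k := fun k => by
    refine tempered_ext hφ fun ψ => ?_
    rw [mulD_apply]
    set θ := mulS (tr (latticePoint k) τ) (testToSchwartz ψ) with hθ
    have hc : HasCompactSupport θ := by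
      rw [hθ, mulS_comm]
      exact hasCompactSupport_mulS (hasCompactSupport_testToSchwartz ψ) _
    have hval : ∀ x, φ (x - latticePoint k) ≠ 0 → θ x = ψ x := fun x hx => by
      rw [hθ, mulS_apply, tr_apply, hτ.one _ (subset_tsupport _ hx), one_mul, testToSchwartz_apply]
    have h1 : testMul (testTranslate (latticePoint k) φ) (testRe θ hc) =
        testMul (testTranslate (latticePoint k) φ) ψ := by
      ext x
      change φ (x - latticePoint k) * (θ x).re = φ (x - latticePoint k) * ψ x
      by_cases hx : φ (x - latticePoint k) = 0
      · rw [hx, zero_mul, zero_mul]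
      · rw [hval x hx, Complex.ofReal_re]
    have h2 : testMul (testTranslate (latticePoint k) φ) (testIm θ hc) = 0 := by
      ext x
      change φ (x - latticePoint k) * (θ x).im = 0
      by_cases hx : φ (x - latticePoint k) = 0
      · rw [hx, zero_mul]
      · rw [hval x hx, Complex.ofReal_im, mul_zero]
    rw [eq_testRe_add_testIm θ hc, map_add, map_smul, he k, he k, he k, h1, h2, map_zero,
      smul_zero, add_zero]
  obtain ⟨C₁, h₁⟩ := hN.lpN_le
  have hseq : ∀ k, E.eNorm (e k) * latW η k ≤ C₁ * N u := fun k => by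
    have h3 := (TMIB.le_lpN hN.one_le (locSeq E φ η u) k).trans (h₁ u)
    rwa [locSeq, localENorm_eq hφ E (he k)] at h3
  obtain ⟨m, C, hC, h⟩ := hE.exists_enorm_local_apply_le hη τ
  let D : ℝ := (C₁ * N u / latW η 0).toReal
  have hDtop : C₁ * N u / latW η 0 ≠ ∞ :=
    ENNReal.div_ne_top (ENNReal.mul_ne_top ENNReal.coe_ne_top hu.ne) (hη.latW_ne_zero 0)
  have hD0 : 0 ≤ D := ENNReal.toReal_nonneg
  have hbound : ∀ (ψ : 𝓢(Rd d, ℂ)) (k : Fin d → ℤ),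
      ‖e k ψ‖ ≤ C * SN m ψ * D * ((1 + ‖latticePoint k‖) ^ (d + 1))⁻¹ := fun ψ k => by
    have h3 := h 0 (fun e => by rw [latticePoint_zero, neg_zero, translate_zero]) k (e k) ψ
    rw [hloc, latticePoint_zero, tr_zero] at h3
    have h4 := (ENNReal.le_div_iff_mul_le (Or.inl (hη.latW_ne_zero 0))
      (Or.inl (latW_ne_top η 0))).2 h3
    have h5 : ‖e k ψ‖ₑ ≤ ENNReal.ofReal (C * SN m ψ * D *
        ((1 + ‖latticePoint k‖) ^ (d + 1))⁻¹) := by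
      refine h4.trans ?_
      rw [ENNReal.ofReal_mul (p := C * SN m ψ * D) (by positivity),
        ENNReal.ofReal_mul (p := C * SN m ψ) (by positivity), ENNReal.ofReal_toReal hDtop]
      calc _ ≤ ENNReal.ofReal (C * SN m ψ) * (latDecay (0 - k) * (C₁ * N u)) / latW η 0 := by
            gcongr ENNReal.ofReal (C * SN m ψ) * (latDecay (0 - k) * ?_) / latW η 0
            exact hseq k
        _ = _ := by
            have h6 : latDecay (0 - k) = ENNReal.ofReal ((1 + ‖latticePoint k‖) ^ (d + 1))⁻¹ := by
              rw [latDecay, latticePoint_sub, latticePoint_zero, zero_sub, norm_neg]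
            rw [h6, ENNReal.div_eq_inv_mul, ENNReal.div_eq_inv_mul]
            ring
    rw [← ofReal_norm] at h5
    exact (ENNReal.ofReal_le_ofReal_iff (by positivity)).1 h5
  have hsum : ∀ ψ, Summable fun k => e k ψ := fun ψ =>
    Summable.of_norm_bounded ((summable_lattice (Nat.lt_succ_self d)).mul_left _) (hbound ψ)
  let f : 𝓢'(Rd d, ℂ) := mkTempered (fun ψ => ∑' k, e k ψ)
    (fun ψ χ => by
      simp only [map_add]
      exact (hsum ψ).tsum_add (hsum χ))
    (fun c ψ => by
      simp only [map_smul, smul_eq_mul]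
      exact tsum_mul_left)
    ⟨m, C * D * ∑' k : Fin d → ℤ, ((1 + ‖latticePoint k‖) ^ (d + 1))⁻¹,
      mul_nonneg (by positivity) (tsum_nonneg fun k => by positivity), fun ψ => by
      refine (tsum_of_norm_bounded ((summable_lattice (Nat.lt_succ_self d)).mul_left
        (C * SN m ψ * D)).hasSum (hbound ψ)).trans (le_of_eq ?_)
      rw [tsum_mul_left]
      ring⟩
  refine ⟨f, ?_⟩
  ext ψ
  change ∑' k, e k (testToSchwartz ψ) = u ψ
  obtain ⟨S, hS⟩ := exists_finset_pu hφ (hasCompactSupport_testToSchwartz ψ)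
  simp only [he _ ψ]
  have hz : ∀ k ∉ S, u (testMul (testTranslate (latticePoint k) φ) ψ) = 0 := fun k hk => by
    have h7 : testMul (testTranslate (latticePoint k) φ) ψ = 0 := by
      ext x
      change φ (x - latticePoint k) * ψ x = 0
      have h8 := hS k hk x
      rw [pu_apply, testToSchwartz_apply] at h8
      exact_mod_cast h8
    rw [h7, map_zero]
  rw [tsum_eq_sum hz, ← map_sum]
  congr 1
  ext x
  have h9 := congrArg (fun θ : 𝓢(Rd d, ℂ) => θ x) (sum_pu_mulS hφ hS)
  simp only [sum_apply, mulS_apply, pu_apply, testToSchwartz_apply] at h9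
  have h10 : ∀ T : Finset (Fin d → ℤ), (∑ k ∈ T, testMul (testTranslate (latticePoint k) φ) ψ) x =
      ∑ k ∈ T, φ (x - latticePoint k) * ψ x := fun T => by
    classical
    induction T using Finset.induction_on with
    | empty => simp
    | insert a T ha ih => rw [Finset.sum_insert ha, Finset.sum_insert ha, ← ih]; rfl
  rw [h10 S]
  exact_mod_cast h9

/-! ### Synthesis in amalgam spaces -/

theorem IsAmalgam.exists_eNorm_sum_le {d : ℕ} {W E : DistSpace d} {φ : Test d} {η : Rd d → ℝ}
    {p : ℝ≥0∞} (hW : IsAmalgam W E φ η p) (hη : IsPolyWeight η) : ∃ N : ℕ, ∃ C : ℝ≥0,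
    ∀ (S : Finset (Fin d → ℤ)) (x : (Fin d → ℤ) → 𝓢'(Rd d, ℂ)) (α : (Fin d → ℤ) → ℝ≥0∞),
      (∀ k, α k ≠ ∞) → (∀ j, ∀ k ∈ S, E.eNorm (mulD (pu φ j) (x k)) ≤
        ENNReal.ofReal (((1 + ‖latticePoint (j - k)‖) ^ N)⁻¹) * α k) →
      W.eNorm (∑ k ∈ S, x k) ≤ C * lpN p ((S : Set (Fin d → ℤ)).indicator fun k =>
        α k * latW η k) := by
  obtain ⟨N, C₁, hC₁, h₁⟩ := hη.exists_latW_le_latW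
  obtain ⟨C₂, h₂⟩ := hW.le_lpN
  let T : ℝ≥0 := (∑' j : Fin d → ℤ, latDecay j).toNNReal
  have hT : ∑' j : Fin d → ℤ, latDecay j = T := (ENNReal.coe_toNNReal (tsum_latDecay_ne_top d)).symm
  refine ⟨N + (d + 1), C₂ * (Real.toNNReal C₁ * T), fun S x α hα hx => ?_⟩
  set β : (Fin d → ℤ) → ℝ≥0∞ := (S : Set (Fin d → ℤ)).indicator fun k => α k * latW η k with hβ
  have hβS : ∀ k ∈ S, β k = α k * latW η k := fun k hk => Set.indicator_of_mem hk _
  have hβ0 : ∀ k ∉ S, β k = 0 := fun k hk => Set.indicator_of_notMem hk _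
  have hle : ∀ j, ampl E φ η (∑ k ∈ S, x k) j ≤
      Real.toNNReal C₁ * ∑' k, latDecay (j - k) * β k := by
    intro j
    rw [ampl, map_sum]
    calc E.eNorm (∑ k ∈ S, mulD (pu φ j) (x k)) * latW η j
        ≤ (∑ k ∈ S, E.eNorm (mulD (pu φ j) (x k))) * latW η j := by
          gcongr
          exact E.eNorm_sum_le _ _
      _ = ∑ k ∈ S, E.eNorm (mulD (pu φ j) (x k)) * latW η j := Finset.sum_mul _ _ _
      _ ≤ ∑ k ∈ S, ENNReal.ofReal C₁ * (latDecay (j - k) * β k) := by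
          refine Finset.sum_le_sum fun k hk => ?_
          rw [hβS k hk]
          refine (mul_le_mul' (hx j k hk) (h₁ j k)).trans (le_of_eq ?_)
          rw [latDecay]
          have hpos : 0 < 1 + ‖latticePoint (j - k)‖ := by positivity
          have h3 : ENNReal.ofReal (((1 + ‖latticePoint (j - k)‖) ^ (N + (d + 1)))⁻¹) *
              ENNReal.ofReal (C₁ * (1 + ‖latticePoint (j - k)‖) ^ N) =
              ENNReal.ofReal C₁ * ENNReal.ofReal (((1 + ‖latticePoint (j - k)‖) ^ (d + 1))⁻¹) := by
            rw [← ENNReal.ofReal_mul (by positivity), ← ENNReal.ofReal_mul (by positivity)]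
            congr 1
            rw [pow_add, mul_inv]
            field_simp
          calc _ = (ENNReal.ofReal (((1 + ‖latticePoint (j - k)‖) ^ (N + (d + 1)))⁻¹) *
                ENNReal.ofReal (C₁ * (1 + ‖latticePoint (j - k)‖) ^ N)) * (α k * latW η k) := by ring
            _ = _ := by rw [h3]; ring
      _ ≤ ∑' k, ENNReal.ofReal C₁ * (latDecay (j - k) * β k) := ENNReal.sum_le_tsum S
      _ = _ := ENNReal.tsum_mul_left
  have hβM : ∀ k, β k ≤ ∑ i ∈ S, α i * latW η i := fun k => by
    by_cases hk : k ∈ S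
    · rw [hβS k hk]
      exact Finset.single_le_sum_of_canonicallyOrdered (f := fun i => α i * latW η i) hk
    · rw [hβ0 k hk]; exact zero_le
  have hβt : Tendsto β cofinite (𝓝 0) := by
    refine (tendsto_const_nhds (x := (0 : ℝ≥0∞))).congr' ?_
    filter_upwards [S.finite_toSet.compl_mem_cofinite] with k hk
    exact (hβ0 k hk).symm
  have ht : Tendsto (ampl E φ η (∑ k ∈ S, x k)) cofinite (𝓝 0) := by
    have h4 := ENNReal.Tendsto.const_mul (a := (Real.toNNReal C₁ : ℝ≥0∞)) (tendsto_convolution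
      (ENNReal.sum_ne_top.2 fun i _ => ENNReal.mul_ne_top (hα i) (latW_ne_top η i)) hβM hβt)
      (Or.inr ENNReal.coe_ne_top)
    rw [mul_zero] at h4
    exact tendsto_of_tendsto_of_tendsto_of_le_of_le tendsto_const_nhds h4 (fun _ => zero_le) hle
  refine (h₂ _ ht).trans ?_
  push_cast
  rw [mul_assoc (C₂ : ℝ≥0∞)]
  gcongr
  refine (lpN_mono hle).trans ((lpN_const_mul_le _ _).trans ?_)
  rw [mul_assoc, ← hT]
  gcongr
  exact lpN_convolution_le hW.one_le latDecay β latDecay_ne_top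

/-- Sums of translates of a Schwartz function. -/
theorem IsAmalgam.exists_eNorm_sum_translates_le {d : ℕ} {W F : DistSpace d} {φ : Test d}
    {η : Rd d → ℝ} {p : ℝ≥0∞} (hW : IsAmalgam W F φ η p) (hη : IsPolyWeight η) (hF : F.IsTMIB)
    (hω : ∀ x, F.omega x = 1) (hφ : IsPartitionGenerator φ) : ∃ m : ℕ, ∃ C > 0,
    ∀ (c : 𝓢(Rd d, ℂ)) (S : Finset (Fin d → ℤ)) (a : (Fin d → ℤ) → ℂ),
      W.eNorm (∑ k ∈ S, a k • toTD (tr (latticePoint k) c)) ≤ ENNReal.ofReal (C * SN m c) *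
        lpN p ((S : Set (Fin d → ℤ)).indicator fun k => ‖a k‖ₑ * latW η k) := by
  obtain ⟨N, C₁, h₁⟩ := hW.exists_eNorm_sum_le hη
  obtain ⟨m₂, C₂, hC₂, h₂⟩ := hF.exists_eNorm_toTD_le hφ
  obtain ⟨m, C₃, hC₃, h₃⟩ := exists_SN_pu_mulS_le φ m₂ N
  refine ⟨m, (C₁ + 1) * (C₂ * C₃), by positivity, fun c S a => ?_⟩
  let K : ℝ≥0 := Real.toNNReal (C₂ * C₃ * SN m c)
  refine (h₁ S _ (fun k => K * ‖a k‖ₑ) (fun k => ENNReal.mul_ne_top ENNReal.coe_ne_top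
    enorm_ne_top) fun j k _ => ?_).trans ?_
  · have e1 : mulD (pu φ j) (a k • toTD (tr (latticePoint k) c)) =
        a k • translate (latticePoint k) (toTD (mulS (pu φ (j - k)) c)) := by
      rw [map_smul, mulD_toTD, translate_toTD, tr_mulS, tr_pu, add_sub_cancel]
    rw [e1, F.smul_eq]
    calc ‖a k‖ₑ * F.eNorm (translate (latticePoint k) (toTD (mulS (pu φ (j - k)) c)))
        ≤ ‖a k‖ₑ * ENNReal.ofReal (C₂ * (C₃ * ((1 + ‖latticePoint (j - k)‖) ^ N)⁻¹ * SN m c)) := by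
          gcongr
          refine (eNorm_translate_le_of_omega_eq_one hF hω _ _).trans ((h₂ _).trans ?_)
          refine ENNReal.ofReal_le_ofReal ?_
          gcongr
          exact h₃ _ _
      _ = _ := by
          rw [show C₂ * (C₃ * ((1 + ‖latticePoint (j - k)‖) ^ N)⁻¹ * SN m c) =
            ((1 + ‖latticePoint (j - k)‖) ^ N)⁻¹ * (C₂ * C₃ * SN m c) by ring,
            ENNReal.ofReal_mul (by positivity)]
          change _ = _ * (ENNReal.ofReal (C₂ * C₃ * SN m c) * _)
          ring
  · have e2 : ((S : Set (Fin d → ℤ)).indicator fun k => K * ‖a k‖ₑ * latW η k) =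
        fun k => K * (S : Set (Fin d → ℤ)).indicator (fun k => ‖a k‖ₑ * latW η k) k := by
      funext k
      by_cases hk : k ∈ (S : Set (Fin d → ℤ))
      · rw [Set.indicator_of_mem hk, Set.indicator_of_mem hk, mul_assoc]
      · rw [Set.indicator_of_notMem hk, Set.indicator_of_notMem hk, mul_zero]
    rw [e2]
    refine (mul_le_mul_right (lpN_const_mul_le K _) _).trans ?_
    rw [← mul_assoc]
    refine mul_le_mul_left ?_ _
    rw [show (C₁ : ℝ≥0∞) = ENNReal.ofReal C₁ by simp]
    change _ * ENNReal.ofReal (C₂ * C₃ * SN m c) ≤ _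
    rw [← ENNReal.ofReal_mul (by positivity)]
    refine ENNReal.ofReal_le_ofReal ?_
    rw [mul_assoc ((C₁ : ℝ) + 1)]
    gcongr
    linarith

/-- Sums of modulated local parts of a distribution. -/
theorem IsAmalgam.exists_eNorm_sum_modulate_le {d : ℕ} {W E : DistSpace d} {φ : Test d}
    {η : Rd d → ℝ} {p : ℝ≥0∞} (hW : IsAmalgam W E φ η p) (hη : IsPolyWeight η) (hE : E.IsTMIB)
    (hφ : IsPartitionGenerator φ) : ∃ m : ℕ, ∃ C > 0,
    ∀ (f : 𝓢'(Rd d, ℂ)) (ξ : Rd d) (S : Finset (Fin d → ℤ)) (a : (Fin d → ℤ) → ℂ),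
      (∀ k, E.eNorm (mulD (pu φ k) f) ≠ ∞) →
      W.eNorm (∑ k ∈ S, a k • modulate ξ (mulD (pu φ k) f)) ≤
        ENNReal.ofReal (C * (1 + ‖ξ‖) ^ m) *
        lpN p ((S : Set (Fin d → ℤ)).indicator fun k => ‖a k‖ₑ * ampl E φ η f k) := by
  obtain ⟨τ, hτ⟩ := exists_isCutoff hφ
  obtain ⟨N, C₁, h₁⟩ := hW.exists_eNorm_sum_le hη
  obtain ⟨m, C₂, hC₂, h₂⟩ := hE.exists_growth
  obtain ⟨m₃, C₃, hC₃, h₃⟩ := hE.exists_eNorm_mulD_le hφ hτ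
  obtain ⟨m₄, C₄, hC₄, h₄⟩ := exists_SN_pu_mulS_le φ m₃ N
  refine ⟨m, (C₁ + 1) * (C₂ * (C₃ * C₄ * (SN m₄ τ + 1))), by positivity, fun f ξ S a hf => ?_⟩
  let K : ℝ≥0 := Real.toNNReal (C₂ * (1 + ‖ξ‖) ^ m * (C₃ * C₄ * (SN m₄ τ + 1)))
  refine (h₁ S _ (fun k => K * (‖a k‖ₑ * E.eNorm (mulD (pu φ k) f))) (fun k =>
    ENNReal.mul_ne_top ENNReal.coe_ne_top (ENNReal.mul_ne_top enorm_ne_top (hf k)))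
    fun j k _ => ?_).trans ?_
  · rw [map_smul, ← modulate_mulD, E.smul_eq]
    have h5 := h₃ (pu φ (j - k)) (latticePoint k) f
    rw [tr_pu, add_sub_cancel] at h5
    change E.eNorm (mulD (pu φ j) (mulD (pu φ k) f)) ≤ _ * E.eNorm (mulD (pu φ k) f) at h5
    have h6 : C₃ * SN m₃ (mulS τ (pu φ (j - k))) ≤
        ((1 + ‖latticePoint (j - k)‖) ^ N)⁻¹ * (C₃ * C₄ * (SN m₄ τ + 1)) := by
      have h7 := h₄ (j - k) τ
      rw [mulS_comm]
      calc C₃ * SN m₃ (mulS (pu φ (j - k)) τ)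
          ≤ C₃ * (C₄ * ((1 + ‖latticePoint (j - k)‖) ^ N)⁻¹ * (SN m₄ τ + 1)) := by
            gcongr
            refine h7.trans ?_
            gcongr
            linarith
        _ = _ := by ring
    calc ‖a k‖ₑ * E.eNorm (modulate ξ (mulD (pu φ j) (mulD (pu φ k) f)))
        ≤ ‖a k‖ₑ * (ENNReal.ofReal (C₂ * (1 + ‖ξ‖) ^ m) *
          (ENNReal.ofReal (((1 + ‖latticePoint (j - k)‖) ^ N)⁻¹ * (C₃ * C₄ * (SN m₄ τ + 1))) *
            E.eNorm (mulD (pu φ k) f))) := by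
          gcongr
          refine (h₂ _ _).2.trans ?_
          gcongr
          refine h5.trans ?_
          gcongr
      _ = _ := by
          change _ = _ * (ENNReal.ofReal (C₂ * (1 + ‖ξ‖) ^ m * (C₃ * C₄ * (SN m₄ τ + 1))) * _)
          rw [ENNReal.ofReal_mul (p := C₂ * (1 + ‖ξ‖) ^ m) (by positivity),
            ENNReal.ofReal_mul (p := ((1 + ‖latticePoint (j - k)‖) ^ N)⁻¹) (by positivity)]
          ring
  · have e2 : ((S : Set (Fin d → ℤ)).indicator fun k =>
        K * (‖a k‖ₑ * E.eNorm (mulD (pu φ k) f)) * latW η k) =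
        fun k => K * (S : Set (Fin d → ℤ)).indicator (fun k => ‖a k‖ₑ * ampl E φ η f k) k := by
      funext k
      by_cases hk : k ∈ (S : Set (Fin d → ℤ))
      · rw [Set.indicator_of_mem hk, Set.indicator_of_mem hk, ampl]; ring
      · rw [Set.indicator_of_notMem hk, Set.indicator_of_notMem hk, mul_zero]
    rw [e2]
    refine (mul_le_mul_right (lpN_const_mul_le K _) _).trans ?_
    rw [← mul_assoc]
    refine mul_le_mul_left ?_ _
    rw [show (C₁ : ℝ≥0∞) = ENNReal.ofReal C₁ by simp]
    change _ * ENNReal.ofReal (C₂ * (1 + ‖ξ‖) ^ m * (C₃ * C₄ * (SN m₄ τ + 1))) ≤ _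
    rw [← ENNReal.ofReal_mul (by positivity)]
    refine ENNReal.ofReal_le_ofReal ?_
    calc (C₁ : ℝ) * (C₂ * (1 + ‖ξ‖) ^ m * (C₃ * C₄ * (SN m₄ τ + 1)))
        ≤ (C₁ + 1) * (C₂ * (1 + ‖ξ‖) ^ m * (C₃ * C₄ * (SN m₄ τ + 1))) := by gcongr; linarith
      _ = _ := by ring

/-! ### Duality of sequence spaces and finite sums of elementary tensors -/

theorem lpN_indicator_le_of_dual {d : ℕ} {p q : ℝ≥0∞} (hp : 1 ≤ p) (hq : 1 ≤ q)
    (hpq : p⁻¹ + q⁻¹ ≤ 1) (S : Finset (Fin d → ℤ)) (β : (Fin d → ℤ) → ℂ) (D : ℝ≥0∞)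
    (h : ∀ μ : (Fin d → ℤ) → ℂ, ‖∑ k ∈ S, μ k * β k‖ₑ ≤
      D * lpN q ((S : Set (Fin d → ℤ)).indicator fun k => ‖μ k‖ₑ)) :
    lpN p ((S : Set (Fin d → ℤ)).indicator fun k => ‖β k‖ₑ) ≤ D := by
  classical
  set B : (Fin d → ℤ) → ℝ≥0∞ := (S : Set (Fin d → ℤ)).indicator fun k => ‖β k‖ₑ with hB
  have hBS : ∀ k ∈ S, B k = ‖β k‖ₑ := fun k hk => Set.indicator_of_mem hk _
  have hB0 : ∀ k ∉ S, B k = 0 := fun k hk => Set.indicator_of_notMem hk _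
  have hq0 : q ≠ 0 := (zero_lt_one.trans_le hq).ne'
  by_cases hp' : p = ∞
  · subst hp'
    rw [lpN_top]
    refine iSup_le fun k => ?_
    by_cases hk : k ∈ S
    · have h1 := h (Pi.single k 1)
      have h2 : ∑ j ∈ S, (Pi.single k 1 : (Fin d → ℤ) → ℂ) j * β j = β k := by
        rw [Finset.sum_eq_single_of_mem k hk]
        · simp
        · intro j _ hj
          rw [Pi.single_eq_of_ne hj, zero_mul]
      have h3 : lpN q ((S : Set (Fin d → ℤ)).indicator fun j =>
          ‖(Pi.single k 1 : (Fin d → ℤ) → ℂ) j‖ₑ) ≤ 1 := by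
        have h4 : ((S : Set (Fin d → ℤ)).indicator fun j =>
            ‖(Pi.single k 1 : (Fin d → ℤ) → ℂ) j‖ₑ) = Pi.single k 1 := by
          funext j
          by_cases hj : j = k
          · subst hj
            rw [Set.indicator_of_mem (by exact hk)]; simp
          · rw [Pi.single_eq_of_ne hj]
            by_cases hjS : j ∈ (S : Set (Fin d → ℤ))
            · rw [Set.indicator_of_mem hjS, Pi.single_eq_of_ne hj, enorm_zero]
            · rw [Set.indicator_of_notMem hjS]
        rw [h4]
        by_cases hq' : q = ∞
        · subst hq'
          rw [lpN_top]
          refine iSup_le fun j => ?_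
          by_cases hj : j = k
          · subst hj; simp
          · rw [Pi.single_eq_of_ne hj]; exact zero_le
        · rw [lpN_le_iff hq hq', tsum_eq_single k]
          · simp
          · intro j hj
            rw [Pi.single_eq_of_ne hj, ENNReal.zero_rpow_of_pos (ENNReal.toReal_pos hq0 hq')]
      rw [h2] at h1
      rw [hBS k hk]
      exact h1.trans ((mul_le_mul_right h3 _).trans (mul_one _).le)
    · rw [hB0 k hk]; exact zero_le
  have hp0 : 0 < p.toReal := ENNReal.toReal_pos (zero_lt_one.trans_le hp).ne' hp'
  have hp1 : 1 ≤ p.toReal := by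
    rw [← ENNReal.toReal_one]; exact ENNReal.toReal_mono hp' hp
  set b := lpN p B with hb
  have hbp : b ^ p.toReal = ∑ k ∈ S, ‖β k‖ₑ ^ p.toReal := by
    rw [hb, lpN_rpow hp hp', tsum_eq_sum (s := S) fun k hk => by
      rw [hB0 k hk, ENNReal.zero_rpow_of_pos hp0]]
    exact Finset.sum_congr rfl fun k hk => by rw [hBS k hk]
  have hbt : b ≠ ∞ := by
    intro h1
    rw [h1, ENNReal.top_rpow_of_pos hp0] at hbp
    refine ENNReal.sum_ne_top.2 (fun k _ => ?_) hbp.symm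
    exact ENNReal.rpow_ne_top_of_nonneg hp0.le enorm_ne_top
  by_cases hb0 : b = 0
  · rw [hb0]; exact zero_le
  let μ : (Fin d → ℤ) → ℂ := fun k =>
    ((starRingEnd ℂ) (β k) / ‖β k‖) * ((‖β k‖ ^ (p.toReal - 1) : ℝ) : ℂ)
  have hμβ : ∀ k, μ k * β k = ((‖β k‖ ^ p.toReal : ℝ) : ℂ) := fun k => by
    by_cases hk : β k = 0
    · simp [μ, hk, Real.zero_rpow hp0.ne']
    · have hn : (‖β k‖ : ℂ) ≠ 0 := by exact_mod_cast norm_ne_zero_iff.2 hk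
      have h1 : (starRingEnd ℂ) (β k) * β k = (‖β k‖ : ℂ) ^ 2 := Complex.conj_mul' (β k)
      have h2 : ‖β k‖ ^ p.toReal = ‖β k‖ ^ (p.toReal - 1) * ‖β k‖ := by
        conv_lhs => rw [show p.toReal = p.toReal - 1 + 1 by ring]
        rw [Real.rpow_add_one (norm_ne_zero_iff.2 hk)]
      rw [h2]
      simp only [μ]
      push_cast
      calc (starRingEnd ℂ) (β k) / ‖β k‖ * ((‖β k‖ ^ (p.toReal - 1) : ℝ) : ℂ) * β k
          = ((starRingEnd ℂ) (β k) * β k) / ‖β k‖ * ((‖β k‖ ^ (p.toReal - 1) : ℝ) : ℂ) := by ring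
        _ = _ := by rw [h1]; field_simp
  have hμn : ∀ k, ‖μ k‖ₑ ≤ ‖β k‖ₑ ^ (p.toReal - 1) := fun k => by
    rw [← ofReal_norm, ← ofReal_norm, ENNReal.ofReal_rpow_of_nonneg (norm_nonneg _) (by linarith)]
    refine ENNReal.ofReal_le_ofReal ?_
    simp only [μ, norm_mul, norm_div, Complex.norm_real, RCLike.norm_conj, norm_norm]
    rw [Real.norm_of_nonneg (Real.rpow_nonneg (norm_nonneg _) _)]
    exact mul_le_of_le_one_left (Real.rpow_nonneg (norm_nonneg _) _) (div_self_le_one _)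
  have hsum : ‖∑ k ∈ S, μ k * β k‖ₑ = b ^ p.toReal := by
    rw [hbp, Finset.sum_congr rfl fun k _ => hμβ k, ← Complex.ofReal_sum, ← ofReal_norm,
      Complex.norm_real, Real.norm_of_nonneg (Finset.sum_nonneg fun k _ => by positivity),
      ENNReal.ofReal_sum_of_nonneg fun k _ => by positivity]
    refine Finset.sum_congr rfl fun k _ => ?_
    rw [← ofReal_norm, ENNReal.ofReal_rpow_of_nonneg (norm_nonneg _) hp0.le]
  have hβb : ∀ k ∈ S, ‖β k‖ₑ ≤ b := fun k hk => by
    rw [← hBS k hk]; exact le_lpN hp B k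
  have hμb : lpN q ((S : Set (Fin d → ℤ)).indicator fun k => ‖μ k‖ₑ) ≤ b ^ (p.toReal - 1) := by
    by_cases hq' : q = ∞
    · subst hq'
      rw [lpN_top]
      refine iSup_le fun k => ?_
      by_cases hk : k ∈ (S : Set (Fin d → ℤ))
      · rw [Set.indicator_of_mem hk]
        exact (hμn k).trans (ENNReal.rpow_le_rpow (hβb k hk) (by linarith))
      · rw [Set.indicator_of_notMem hk]; exact zero_le
    have hq1 : 0 < q.toReal := ENNReal.toReal_pos hq0 hq'
    have hpq' : p.toReal⁻¹ + q.toReal⁻¹ ≤ 1 := by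
      have h1 := ENNReal.toReal_mono ENNReal.one_ne_top hpq
      rwa [ENNReal.toReal_add (by simpa using (zero_lt_one.trans_le hp).ne')
        (by simpa using hq0), ENNReal.toReal_inv, ENNReal.toReal_inv, ENNReal.toReal_one] at h1
    have hexp : 0 ≤ (p.toReal - 1) * q.toReal - p.toReal := by
      have h2 := mul_le_mul_of_nonneg_left hpq' (mul_pos hp0 hq1).le
      have h3 : p.toReal * q.toReal * (p.toReal⁻¹ + q.toReal⁻¹) = q.toReal + p.toReal := by
        field_simp
      nlinarith
    rw [lpN_le_iff hq hq', tsum_eq_sum (s := S) fun k hk => by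
      rw [Set.indicator_of_notMem (by exact hk), ENNReal.zero_rpow_of_pos hq1]]
    calc ∑ k ∈ S, ((S : Set (Fin d → ℤ)).indicator (fun k => ‖μ k‖ₑ) k) ^ q.toReal
        ≤ ∑ k ∈ S, b ^ ((p.toReal - 1) * q.toReal - p.toReal) * ‖β k‖ₑ ^ p.toReal := by
          refine Finset.sum_le_sum fun k hk => ?_
          rw [Set.indicator_of_mem (by exact hk)]
          calc ‖μ k‖ₑ ^ q.toReal ≤ (‖β k‖ₑ ^ (p.toReal - 1)) ^ q.toReal :=
                ENNReal.rpow_le_rpow (hμn k) hq1.le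
            _ = ‖β k‖ₑ ^ (((p.toReal - 1) * q.toReal - p.toReal) + p.toReal) := by
                rw [← ENNReal.rpow_mul]; congr 1; ring
            _ = ‖β k‖ₑ ^ ((p.toReal - 1) * q.toReal - p.toReal) * ‖β k‖ₑ ^ p.toReal :=
                ENNReal.rpow_add_of_nonneg _ _ hexp hp0.le
            _ ≤ _ := by
                gcongr
                exact hβb k hk
      _ = b ^ ((p.toReal - 1) * q.toReal - p.toReal) * b ^ p.toReal := by
          rw [← Finset.mul_sum, hbp]
      _ = (b ^ (p.toReal - 1)) ^ q.toReal := by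
          rw [← ENNReal.rpow_add_of_nonneg _ _ hexp hp0.le, ← ENNReal.rpow_mul]
          congr 1; ring
  have hfin := (h μ).trans (mul_le_mul_right hμb D)
  rw [hsum] at hfin
  have hne : b ^ (p.toReal - 1) ≠ 0 := by
    rw [Ne, ENNReal.rpow_eq_zero_iff]
    rintro (⟨h1, -⟩ | ⟨h1, -⟩)
    · exact hb0 h1
    · exact hbt h1
  have hnt : b ^ (p.toReal - 1) ≠ ∞ := ENNReal.rpow_ne_top_of_nonneg (by linarith) hbt
  refine (ENNReal.mul_le_mul_iff_left hne hnt).1 (le_trans (le_of_eq ?_) hfin)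
  conv_rhs => rw [show p.toReal = 1 + (p.toReal - 1) by ring]
  rw [ENNReal.rpow_add_of_nonneg _ _ zero_le_one (by linarith), ENNReal.rpow_one]

theorem elementaryTensor_apply {d : ℕ} (A B : DistSpace d) (a : A.Carrier) (b : B.Carrier)
    (a' : StrongDual ℂ A.Carrier) (b' : StrongDual ℂ B.Carrier) :
    elementaryTensor A B a b a' b' = a' a * b' b := rfl

/-- The injective norm of a finite sum of elementary tensors. -/
theorem enorm_sum_elementaryTensor_le {d : ℕ} {A B : DistSpace d} {p q : ℝ≥0∞} (hp : 1 ≤ p)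
    (hq : 1 ≤ q) (hpq : p⁻¹ + q⁻¹ ≤ 1) (S : Finset (Fin d → ℤ)) (x : (Fin d → ℤ) → A.Carrier)
    (y : (Fin d → ℤ) → B.Carrier) {η : Rd d → ℝ} (hη : IsPolyWeight η) (v : (Fin d → ℤ) → ℝ≥0∞)
    (C₁ C₂ M : ℝ≥0)
    (hx : ∀ a : (Fin d → ℤ) → ℂ, ‖∑ k ∈ S, a k • x k‖ₑ ≤
      C₁ * lpN p ((S : Set (Fin d → ℤ)).indicator fun k => ‖a k‖ₑ * latW η k))
    (hy : ∀ a : (Fin d → ℤ) → ℂ, ‖∑ k ∈ S, a k • y k‖ₑ ≤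
      C₂ * lpN q ((S : Set (Fin d → ℤ)).indicator fun k => ‖a k‖ₑ * v k))
    (hv : ∀ k ∈ S, latW η k * v k ≤ M) :
    ‖∑ k ∈ S, elementaryTensor A B (x k) (y k)‖ ≤ C₁ * C₂ * M := by
  refine ContinuousLinearMap.opNorm_le_bound₂ _ (by positivity) fun a' b' => ?_
  have hval : (∑ k ∈ S, elementaryTensor A B (x k) (y k)) a' b' =
      a' (∑ k ∈ S, b' (y k) • x k) := by
    rw [map_sum, sum_apply, sum_apply]
    refine Finset.sum_congr rfl fun k _ => ?_
    rw [elementaryTensor_apply, map_smul, smul_eq_mul, mul_comm]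
  have hwr : ∀ k, latW η k = ‖((η (latticePoint k) : ℝ) : ℂ)‖ₑ := fun k => by
    rw [← ofReal_norm, Complex.norm_real, Real.norm_of_nonneg (hη.pos _).le, latW]
  have hdual : lpN p ((S : Set (Fin d → ℤ)).indicator fun k => ‖b' (y k)‖ₑ * latW η k) ≤
      ‖b'‖ₑ * (C₂ * M) := by
    have h1 := lpN_indicator_le_of_dual hp hq hpq S
      (fun k => b' (y k) * ((η (latticePoint k) : ℝ) : ℂ)) (‖b'‖ₑ * (C₂ * M)) fun μ => by
        have e1 : ∑ k ∈ S, μ k * (b' (y k) * ((η (latticePoint k) : ℝ) : ℂ)) =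
            b' (∑ k ∈ S, (μ k * ((η (latticePoint k) : ℝ) : ℂ)) • y k) := by
          rw [map_sum]
          refine Finset.sum_congr rfl fun k _ => ?_
          rw [map_smul, smul_eq_mul]; ring
        rw [e1, mul_assoc]
        refine (b'.le_opENorm _).trans ?_
        gcongr
        refine (hy _).trans ?_
        rw [mul_assoc]
        gcongr
        refine le_trans (lpN_mono fun k => ?_) (lpN_const_mul_le M _)
        by_cases hk : k ∈ (S : Set (Fin d → ℤ))
        · rw [Set.indicator_of_mem hk, Set.indicator_of_mem hk, enorm_mul, ← hwr, mul_assoc,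
            mul_comm]
          gcongr
          exact hv k hk
        · rw [Set.indicator_of_notMem hk, Set.indicator_of_notMem hk, mul_zero]
    simpa only [enorm_mul, ← hwr] using h1
  rw [hval]
  have h2 : ‖a' (∑ k ∈ S, b' (y k) • x k)‖ₑ ≤ ‖a'‖ₑ * (C₁ * (‖b'‖ₑ * (C₂ * M))) := by
    refine (a'.le_opENorm _).trans ?_
    gcongr
    refine (hx _).trans ?_
    gcongr
  have h3 : ‖a'‖ₑ * (C₁ * (‖b'‖ₑ * (C₂ * M))) =
      ENNReal.ofReal (C₁ * C₂ * M * ‖a'‖ * ‖b'‖) := by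
    rw [← ofReal_norm, ← ofReal_norm, ENNReal.ofReal_mul (by positivity),
      ENNReal.ofReal_mul (by positivity), ENNReal.ofReal_mul (by positivity),
      ENNReal.ofReal_mul (by positivity)]
    simp only [ENNReal.ofReal_coe_nnreal]
    ring
  rw [h3, ← ofReal_norm] at h2
  exact (ENNReal.ofReal_le_ofReal_iff (by positivity)).1 h2

/-! ### The expansion of the short-time Fourier transform into elementary tensors -/

/-- The reflection `ψ(-·)` of a Schwartz function. -/
def reflS {d : ℕ} (ψ : 𝓢(Rd d, ℂ)) : 𝓢(Rd d, ℂ) :=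
  SchwartzMap.compCLMOfContinuousLinearEquiv ℂ (ContinuousLinearEquiv.neg ℝ) ψ

theorem reflS_apply {d : ℕ} (ψ : 𝓢(Rd d, ℂ)) (x : Rd d) : reflS ψ x = ψ (-x) := rfl

theorem tr_conv {d : ℕ} (a : Rd d) (φ ψ : 𝓢(Rd d, ℂ)) : tr a (conv φ ψ) = conv (tr a φ) ψ := by
  ext t
  rw [tr_apply, conv_apply, conv_apply, ← integral_sub_right_eq_self _ a]
  refine integral_congr_ae (.of_forall fun x => ?_)
  simp only [tr_apply]
  congr 2
  abel

theorem integral_mul_conv {d : ℕ} (A φ G : 𝓢(Rd d, ℂ)) :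
    ∫ t, A t * conv φ G t = ∫ x, φ x * conv A (reflS G) x := by
  simp only [conv_apply, reflS_apply, ← integral_const_mul]
  rw [integral_integral_swap]
  · refine integral_congr_ae (.of_forall fun x => ?_)
    refine integral_congr_ae (.of_forall fun t => ?_)
    simp only [neg_sub]
    ring
  · obtain ⟨C, hC⟩ : ∃ C, ∀ x, ‖G x‖ ≤ C := ⟨2 ^ 0 * SN 0 G, fun x => by
      simpa using norm_apply_le_SN (le_refl 0) G x⟩
    have h1 : Integrable (fun z : Rd d × Rd d => A z.1 * φ z.2) (volume.prod volume) :=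
      A.integrable.mul_prod φ.integrable
    have h2 : Integrable (fun z : Rd d × Rd d => G (z.1 - z.2) * (A z.1 * φ z.2))
        (volume.prod volume) :=
      h1.bdd_mul (c := C) (G.continuous.comp (by fun_prop)).aestronglyMeasurable
        (.of_forall fun z => hC _)
    refine h2.congr (.of_forall fun z => ?_)
    simp only [Function.uncurry]
    ring

/-- The window functions in the expansion of the short-time Fourier transform. -/
def cubeWindow {d : ℕ} (τ G : 𝓢(Rd d, ℂ)) (n : Fin d → ℤ) : 𝓢(Rd d, ℂ) :=
  (2⁻¹ : ℂ) ^ d • conv (md (-halfLattice n) τ) (reflS G)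

theorem fourierCoeffCube_mulS_conv {d : ℕ} (τ φ G : 𝓢(Rd d, ℂ)) (y : Rd d) (n : Fin d → ℤ) :
    fourierCoeffCube (mulS τ (tr (-y) (conv φ G))) n = toTD (tr y (cubeWindow τ G n)) φ := by
  rw [← translate_toTD, translate_apply, tr_conv, toTD_apply, fourierCoeffCube,
    fourier_schwartz_apply]
  simp only [cubeWindow, smul_apply, smul_eq_mul]
  have h1 : ∀ t, character (-halfLattice n) t * mulS τ (conv (tr (-y) φ) G) t =
      md (-halfLattice n) τ t * conv (tr (-y) φ) G t := fun t => by
    rw [mulS_apply, md_apply]; ring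
  simp only [h1]
  rw [integral_mul_conv, ← integral_const_mul]
  refine integral_congr_ae (.of_forall fun x => ?_)
  simp only
  ring

theorem exists_SN_cubeWindow_le {d : ℕ} (τ G : 𝓢(Rd d, ℂ)) (m N : ℕ) : ∃ C > 0, ∀ n : Fin d → ℤ,
    SN m (cubeWindow τ G n) ≤ C * ((1 + ‖latticePoint n‖) ^ N)⁻¹ := by
  obtain ⟨m₁, C₁, hC₁, h₁⟩ := exists_SN_comp_le
    (FourierTransform.fourierInvCLM ℂ 𝓢(Rd d, ℂ)) m
  set D : ℝ := 2 ^ m₁ * 4 ^ (m₁ + N) * SN (m₁ + N) (𝓕 (reflS G)) * SN (m₁ + N) (𝓕 τ) with hD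
  have hD0 : 0 ≤ D := by positivity
  have h2d : 0 < ‖(2⁻¹ : ℂ) ^ d‖ := norm_pos_iff.2 (pow_ne_zero _ (by norm_num))
  refine ⟨‖(2⁻¹ : ℂ) ^ d‖ * C₁ * (D + 1) * 2 ^ N, by positivity, fun n => ?_⟩
  have e1 : conv (md (-halfLattice n) τ) (reflS G) =
      FourierTransform.fourierInvCLM ℂ 𝓢(Rd d, ℂ)
        (mulS (𝓕 (reflS G)) (tr (-halfLattice n) (𝓕 τ))) := by
    rw [FourierTransform.fourierInvCLM_apply, mulS_comm, ← fourier_md, ← fourier_conv,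
      FourierTransform.fourierInv_fourier_eq]
  have h2 := SN_mulS_tr_le m₁ N (𝓕 (reflS G)) (𝓕 τ) (-halfLattice n)
  rw [← hD, norm_neg] at h2
  have hpos : 0 < 1 + ‖latticePoint n‖ := by positivity
  have h3 : SN m₁ (mulS (𝓕 (reflS G)) (tr (-halfLattice n) (𝓕 τ))) ≤
      (D + 1) * 2 ^ N * ((1 + ‖latticePoint n‖) ^ N)⁻¹ := by
    rw [← div_eq_mul_inv, le_div_iff₀ (by positivity)]
    calc SN m₁ (mulS (𝓕 (reflS G)) (tr (-halfLattice n) (𝓕 τ))) * (1 + ‖latticePoint n‖) ^ N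
        ≤ SN m₁ (mulS (𝓕 (reflS G)) (tr (-halfLattice n) (𝓕 τ))) *
          (2 * (1 + ‖halfLattice n‖)) ^ N := by
          gcongr
          exact le_one_add_norm_halfLattice n
      _ = SN m₁ (mulS (𝓕 (reflS G)) (tr (-halfLattice n) (𝓕 τ))) * (1 + ‖halfLattice n‖) ^ N *
          2 ^ N := by rw [mul_pow]; ring
      _ ≤ (D + 1) * 2 ^ N := by gcongr; linarith
  rw [cubeWindow, map_smul_eq_mul, e1]
  calc ‖(2⁻¹ : ℂ) ^ d‖ * SN m (FourierTransform.fourierInvCLM ℂ 𝓢(Rd d, ℂ)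
        (mulS (𝓕 (reflS G)) (tr (-halfLattice n) (𝓕 τ))))
      ≤ ‖(2⁻¹ : ℂ) ^ d‖ * (C₁ * ((D + 1) * 2 ^ N * ((1 + ‖latticePoint n‖) ^ N)⁻¹)) := by
        gcongr
        exact (h₁ _).trans (by gcongr)
    _ = _ := by ring

/-! ### Bounded evaluation functionals -/

/-- The Schwartz functions act on the space as bounded functionals. -/
def HasBoundedEval {d : ℕ} (A : DistSpace d) : Prop :=
  ∀ ψ : 𝓢(Rd d, ℂ), ∃ C : ℝ≥0, ∀ f, ‖f ψ‖ₑ ≤ C * A.eNorm f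

/-- The functional on `A` given by a Schwartz function. -/
def evalDual {d : ℕ} {A : DistSpace d} (hA : HasBoundedEval A) (ψ : 𝓢(Rd d, ℂ)) :
    StrongDual ℂ A.Carrier :=
  LinearMap.mkContinuous
    { toFun := fun a => A.incl a ψ
      map_add' := fun a b => by rw [map_add, add_apply]
      map_smul' := fun c a => by rw [map_smul, smul_apply]; rfl }
    (hA ψ).choose fun a => by
      have h := (hA ψ).choose_spec (A.incl a)
      rw [← A.enorm_eq, ← ofReal_norm, ← ofReal_norm, ← ENNReal.ofReal_coe_nnreal,
        ← ENNReal.ofReal_mul (by positivity)] at h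
      exact (ENNReal.ofReal_le_ofReal_iff (by positivity)).1 h

theorem evalDual_apply {d : ℕ} {A : DistSpace d} (hA : HasBoundedEval A) (ψ : 𝓢(Rd d, ℂ))
    (a : A.Carrier) : evalDual hA ψ a = A.incl a ψ := rfl

theorem IsAmalgam.hasBoundedEval {d : ℕ} {W E : DistSpace d} {φ : Test d} {η : Rd d → ℝ}
    {p : ℝ≥0∞} (hW : IsAmalgam W E φ η p) (hE : E.IsTMIB) (hφ : IsPartitionGenerator φ)
    (hη : IsPolyWeight η) : HasBoundedEval W := fun ψ => by
  obtain ⟨m, C, hC, h⟩ := hW.exists_enorm_apply_le hE hφ hη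
  exact ⟨Real.toNNReal (C * SN m ψ), fun f => h f ψ⟩

theorem HasBoundedEval.fourier {d : ℕ} {W : DistSpace d} (hW : HasBoundedEval W) :
    HasBoundedEval W.fourier := fun ψ => by
  obtain ⟨C, h⟩ := hW (𝓕 ψ)
  refine ⟨C, fun f => ?_⟩
  have h1 := h (𝓕⁻ f)
  rwa [TemperedDistribution.fourierInv_apply, FourierTransform.fourierInv_fourier_eq] at h1

theorem eNorm_fourier_fourier {d : ℕ} (W : DistSpace d) (f : 𝓢'(Rd d, ℂ)) :
    W.fourier.eNorm (𝓕 f) = W.eNorm f := by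
  change W.eNorm (𝓕⁻ (𝓕 f)) = _
  rw [FourierTransform.fourierInv_fourier_eq]

theorem lpN_indicator_lt_top {d : ℕ} {p : ℝ≥0∞} (hp : 1 ≤ p) (S : Finset (Fin d → ℤ))
    {v : (Fin d → ℤ) → ℝ≥0∞} (hv : ∀ k, v k ≠ ∞) :
    lpN p ((S : Set (Fin d → ℤ)).indicator v) < ∞ := by
  by_cases hp' : p = ∞
  · subst hp'
    rw [lpN_top]
    refine lt_of_le_of_lt (iSup_le fun k => ?_) (ENNReal.sum_lt_top.2 fun k (_ : k ∈ S) =>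
      lt_top_iff_ne_top.2 (hv k))
    by_cases hk : k ∈ (S : Set (Fin d → ℤ))
    · rw [Set.indicator_of_mem hk]
      exact Finset.single_le_sum_of_canonicallyOrdered (f := v) hk
    · rw [Set.indicator_of_notMem hk]; exact zero_le
  · have h0 : 0 < p.toReal := ENNReal.toReal_pos (zero_lt_one.trans_le hp).ne' hp'
    rw [lt_top_iff_ne_top]
    intro h
    have h1 := lpN_rpow hp hp' ((S : Set (Fin d → ℤ)).indicator v)
    rw [h, ENNReal.top_rpow_of_pos h0, tsum_eq_sum (s := S) fun k hk => by
      rw [Set.indicator_of_notMem (by exact hk), ENNReal.zero_rpow_of_pos h0]] at h1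
    refine ENNReal.sum_ne_top.2 (fun k hk => ?_) h1.symm
    rw [Set.indicator_of_mem (by exact hk)]
    exact ENNReal.rpow_ne_top_of_nonneg h0.le (hv k)

theorem ampl_mul {d : ℕ} (E : DistSpace d) (φ : Test d) {η₁ : Rd d → ℝ} (hη₁ : IsPolyWeight η₁)
    (η₂ : Rd d → ℝ) (f : 𝓢'(Rd d, ℂ)) (k : Fin d → ℤ) :
    ampl E φ (fun x => η₁ x * η₂ x) f k = latW η₁ k * ampl E φ η₂ f k := by
  rw [ampl, ampl, latW_mul hη₁]; ring

theorem fourier_sum_smul {d : ℕ} {ι : Type*} (S : Finset ι) (a : ι → ℂ) (u : ι → 𝓢'(Rd d, ℂ)) :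
    ∑ k ∈ S, a k • 𝓕 (u k) = 𝓕 (∑ k ∈ S, a k • u k) := by
  have h := map_sum (FourierTransform.fourierCLM ℂ 𝓢'(Rd d, ℂ)) (fun k => a k • u k) S
  simp only [map_smul, FourierTransform.fourierCLM_apply] at h
  exact h.symm

/-- The decomposition of the short-time Fourier transform into localized pieces that belong to the
injective tensor product. -/
theorem exists_tensor_decomposition {d : ℕ} {A W E F : DistSpace d} {φ : Test d}
    {η₁ η₂ : Rd d → ℝ} {p q : ℝ≥0∞} (hA : IsAmalgam A F φ η₁ p) (hW : IsAmalgam W E φ η₂ q)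
    (hpq : p⁻¹ + q⁻¹ ≤ 1) (hE : E.IsTMIB) (hF : F.IsTMIB) (hω : ∀ x, F.omega x = 1)
    (hφ : IsPartitionGenerator φ) (hη₁ : IsPolyWeight η₁) (hη₂ : IsPolyWeight η₂)
    (eA : HasBoundedEval A) (eB : HasBoundedEval W.fourier) (G : 𝓢(Rd d, ℂ)) :
    ∃ K : ℝ≥0, ∀ f : 𝓢'(Rd d, ℂ), (∀ k, E.eNorm (mulD (pu φ k) f) ≠ ∞) →
    ∃ z : (Fin d → ℤ) → StrongDual ℂ A.Carrier →L[ℂ] StrongDual ℂ W.fourier.Carrier →L[ℂ] ℂ,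
      (∀ k, z k ∈ injTensor A W.fourier) ∧
      (∀ (S : Finset (Fin d → ℤ)) (M : ℝ≥0),
        (∀ k ∈ S, ampl E φ (fun x => η₁ x * η₂ x) f k ≤ M) → ‖∑ k ∈ S, z k‖ ≤ K * M) ∧
      ∀ k χ ψ, z k (evalDual eA χ) (evalDual eB ψ) =
        mulD (pu φ k) f (mulS (conv χ G) (𝓕 ψ)) := by
  obtain ⟨τ, hτ⟩ := exists_isCutoff hφ
  obtain ⟨m₁, C₁, hC₁, h₁⟩ := hA.exists_eNorm_sum_translates_le hη₁ hF hω hφ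
  obtain ⟨m₂, C₂, hC₂, h₂⟩ := hW.exists_eNorm_sum_modulate_le hη₂ hE hφ
  obtain ⟨C₃, hC₃, h₃⟩ := exists_SN_cubeWindow_le τ G m₁ (m₂ + (d + 1))
  set c : (Fin d → ℤ) → 𝓢(Rd d, ℂ) := cubeWindow τ G with hc
  let T : ℝ := ∑' k : Fin d → ℤ, ((1 + ‖latticePoint k‖) ^ (d + 1))⁻¹
  have hT : 0 ≤ T := tsum_nonneg fun k => by positivity
  refine ⟨Real.toNNReal (C₁ * C₃ * C₂ * T), fun f hf => ?_⟩
  have hxm : ∀ n k, A.eNorm (toTD (tr (latticePoint k) (c n))) < ∞ := fun n k => by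
    have h4 := h₁ (c n) {k} 1
    simp only [Finset.sum_singleton, Pi.one_apply] at h4
    rw [show (1 : ℂ) • toTD (tr (latticePoint k) (c n)) = toTD (tr (latticePoint k) (c n)) from
      one_smul ℂ _] at h4
    refine h4.trans_lt (ENNReal.mul_lt_top ENNReal.ofReal_lt_top (lpN_indicator_lt_top hA.one_le _
      fun k => ENNReal.mul_ne_top enorm_ne_top (latW_ne_top _ k)))
  have hym : ∀ n k, W.fourier.eNorm (𝓕 (modulate (halfLattice n) (mulD (pu φ k) f))) < ∞ :=
    fun n k => by
    have h4 := h₂ f (halfLattice n) {k} 1 hf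
    simp only [Finset.sum_singleton, Pi.one_apply] at h4
    rw [show (1 : ℂ) • modulate (halfLattice n) (mulD (pu φ k) f) =
      modulate (halfLattice n) (mulD (pu φ k) f) from one_smul ℂ _] at h4
    rw [eNorm_fourier_fourier]
    refine h4.trans_lt (ENNReal.mul_lt_top ENNReal.ofReal_lt_top (lpN_indicator_lt_top hW.one_le _
      fun k => ENNReal.mul_ne_top enorm_ne_top (ENNReal.mul_ne_top (hf k) (latW_ne_top _ k))))
  let x : (Fin d → ℤ) → (Fin d → ℤ) → A.Carrier := fun n k =>
    character (halfLattice n) (-latticePoint k) • A.elem _ (hxm n k)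
  let y : (Fin d → ℤ) → (Fin d → ℤ) → W.fourier.Carrier := fun n k => W.fourier.elem _ (hym n k)
  let t : (Fin d → ℤ) → (Fin d → ℤ) →
      StrongDual ℂ A.Carrier →L[ℂ] StrongDual ℂ W.fourier.Carrier →L[ℂ] ℂ := fun n k =>
    elementaryTensor A W.fourier (x n k) (y n k)
  have hbound : ∀ (S : Finset (Fin d → ℤ)) (M : ℝ≥0),
      (∀ k ∈ S, ampl E φ (fun x => η₁ x * η₂ x) f k ≤ M) → ∀ n,
      ‖∑ k ∈ S, t n k‖ ≤ C₁ * C₃ * C₂ * M * ((1 + ‖latticePoint n‖) ^ (d + 1))⁻¹ := by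
    intro S M hM n
    have h5 := enorm_sum_elementaryTensor_le (A := A) (B := W.fourier) hA.one_le hW.one_le hpq S
      (x n) (y n) hη₁ (ampl E φ η₂ f) (Real.toNNReal (C₁ * SN m₁ (c n)))
      (Real.toNNReal (C₂ * (1 + ‖halfLattice n‖) ^ m₂)) M
      (fun a => by
        have e1 : A.incl (∑ k ∈ S, a k • x n k) =
            ∑ k ∈ S, (a k * character (halfLattice n) (-latticePoint k)) •
              toTD (tr (latticePoint k) (c n)) := by
          rw [map_sum]
          refine Finset.sum_congr rfl fun k _ => ?_
          simp only [x]
          rw [smul_smul, map_smul, A.incl_elem]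
        rw [A.enorm_eq, e1]
        refine (h₁ (c n) S _).trans (le_of_eq ?_)
        have e2 : ∀ k, ‖a k * character (halfLattice n) (-latticePoint k)‖ₑ = ‖a k‖ₑ := fun k => by
          rw [← ofReal_norm, norm_mul, norm_character, mul_one, ofReal_norm]
        simp only [e2]
        rfl)
      (fun a => by
        have e1 : W.fourier.incl (∑ k ∈ S, a k • y n k) =
            𝓕 (∑ k ∈ S, a k • modulate (halfLattice n) (mulD (pu φ k) f)) := by
          rw [map_sum, ← fourier_sum_smul]
          refine Finset.sum_congr rfl fun k _ => ?_
          rw [map_smul]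
          rfl
        rw [W.fourier.enorm_eq, e1, eNorm_fourier_fourier]
        exact h₂ f (halfLattice n) S a hf)
      (fun k hk => by
        rw [← ampl_mul E φ hη₁]
        exact hM k hk)
    refine h5.trans ?_
    rw [Real.coe_toNNReal _ (by positivity), Real.coe_toNNReal _ (by positivity)]
    have hpos : 0 < 1 + ‖latticePoint n‖ := by positivity
    calc C₁ * SN m₁ (c n) * (C₂ * (1 + ‖halfLattice n‖) ^ m₂) * M
        ≤ C₁ * (C₃ * ((1 + ‖latticePoint n‖) ^ (m₂ + (d + 1)))⁻¹) *
          (C₂ * (1 + ‖latticePoint n‖) ^ m₂) * M := by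
          gcongr C₁ * ?_ * (C₂ * ?_ ^ m₂) * _
          · exact h₃ n
          · exact one_add_norm_halfLattice_le n
      _ = _ := by
          rw [pow_add, mul_inv]
          field_simp
  have hampl : ∀ k, ampl E φ (fun x => η₁ x * η₂ x) f k ≠ ∞ := fun k =>
    ENNReal.mul_ne_top (hf k) (latW_ne_top _ k)
  have hsum : ∀ k, Summable fun n => t n k := fun k => by
    refine Summable.of_norm_bounded ((summable_lattice (Nat.lt_succ_self d)).mul_left
      (C₁ * C₃ * C₂ * (ampl E φ (fun x => η₁ x * η₂ x) f k).toNNReal)) fun n => ?_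
    have h6 := hbound {k} (ampl E φ (fun x => η₁ x * η₂ x) f k).toNNReal (fun j hj => by
      rw [Finset.mem_singleton.1 hj, ENNReal.coe_toNNReal (hampl k)]) n
    rwa [Finset.sum_singleton] at h6
  refine ⟨fun k => ∑' n, t n k, fun k => ?_, fun S M hM => ?_, fun k χ ψ => ?_⟩
  · refine (Submodule.isClosed_topologicalClosure _).mem_of_tendsto (hsum k).hasSum
      (.of_forall fun S => Submodule.sum_mem _ fun n _ => ?_)
    exact Submodule.le_topologicalClosure _ (Submodule.subset_span ⟨(x n k, y n k), rfl⟩)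
  · rw [← Summable.tsum_finsetSum fun k _ => hsum k, Real.coe_toNNReal _ (by positivity)]
    refine (tsum_of_norm_bounded ((summable_lattice (Nat.lt_succ_self d)).mul_left
      (C₁ * C₃ * C₂ * M)).hasSum (hbound S M hM)).trans (le_of_eq ?_)
    rw [tsum_mul_left]
    change C₁ * C₃ * C₂ * M * T = _
    ring
  · have h7 : HasSum (fun n => t n k (evalDual eA χ) (evalDual eB ψ))
        ((∑' n, t n k) (evalDual eA χ) (evalDual eB ψ)) :=
      ((hsum k).hasSum.mapL (ContinuousLinearMap.apply ℂ _ (evalDual eA χ))).mapL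
        (ContinuousLinearMap.apply ℂ _ (evalDual eB ψ))
    have h8 := hasSum_smul_modulate_apply hφ hτ (tr (-latticePoint k) (conv χ G)) (latticePoint k)
      f (𝓕 ψ)
    rw [tr_tr, add_neg_cancel, tr_zero, mulD_apply] at h8
    refine h7.unique (h8.congr_fun fun n => ?_)
    rw [fourierCoeffCube_mulS_conv]
    simp only [t, x, y]
    rw [elementaryTensor_apply, map_smul, evalDual_apply, evalDual_apply, A.incl_elem,
      W.fourier.incl_elem, TemperedDistribution.fourier_apply, smul_apply, smul_eq_mul, smul_eq_mul,
      ← hc]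
    change _ = _ * character (halfLattice n) (-latticePoint k) *
      (modulate (halfLattice n) (mulD (pu φ k) f)) (𝓕 ψ)
    ring

/-- The embedding of the amalgam space into the modulation space. -/
theorem exists_modulationENorm_le {d : ℕ} {A W E F : DistSpace d} {φ : Test d}
    {η₁ η₂ : Rd d → ℝ} {p q : ℝ≥0∞} (hA : IsAmalgam A F φ η₁ p) (hW : IsAmalgam W E φ η₂ q)
    (hpq : p⁻¹ + q⁻¹ ≤ 1) (hE : E.IsTMIB) (hF : F.IsTMIB) (hω : ∀ x, F.omega x = 1)
    (hφ : IsPartitionGenerator φ) (hη₁ : IsPolyWeight η₁) (hη₂ : IsPolyWeight η₂)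
    (g : 𝓢(Rd d, ℂ)) : ∃ C : ℝ≥0, ∀ f : 𝓢'(Rd d, ℂ),
      Tendsto (ampl E φ (fun x => η₁ x * η₂ x) f) cofinite (𝓝 0) →
      modulationENorm g (injTensorENorm A W.fourier) f ≤
        C * lpN ∞ (ampl E φ (fun x => η₁ x * η₂ x) f) := by
  have eA := hA.hasBoundedEval hF hφ hη₁
  have eB := (hW.hasBoundedEval hE hφ hη₂).fourier
  obtain ⟨K, hK⟩ := exists_tensor_decomposition hA hW hpq hE hF hω hφ hη₁ hη₂ eA eB (conjS g)
  refine ⟨K + 1, fun f hf => ?_⟩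
  set ρ := ampl E φ (fun x => η₁ x * η₂ x) f with hρ
  by_cases hfin : lpN ∞ ρ = ∞
  · rw [hfin, ENNReal.mul_top (by simp)]; exact le_top
  lift lpN ∞ ρ to ℝ≥0 using hfin with M hM
  have hρM : ∀ k, ρ k ≤ M := fun k => by rw [hM]; exact le_lpN le_top ρ k
  have hfk : ∀ k, E.eNorm (mulD (pu φ k) f) ≠ ∞ := fun k h => by
    have h1 := hρM k
    rw [hρ, ampl, h, ENNReal.top_mul ((hη₁.mul hη₂).latW_ne_zero k)] at h1
    exact ENNReal.coe_ne_top (top_le_iff.1 h1)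
  obtain ⟨z, hz1, hz2, hz3⟩ := hK f hfk
  have hs : Summable z := by
    rw [summable_iff_vanishing_norm]
    intro ε hε
    let δ : ℝ≥0 := Real.toNNReal (ε / (2 * (K + 1)))
    have hδ : (δ : ℝ) = ε / (2 * (K + 1)) := Real.coe_toNNReal _ (by positivity)
    have hδ0 : 0 < δ := Real.toNNReal_pos.2 (by positivity)
    rw [ENNReal.tendsto_nhds_zero] at hf
    have h1 := hf δ (by exact_mod_cast hδ0)
    rw [eventually_cofinite] at h1
    refine ⟨h1.toFinset, fun S hS => ?_⟩
    have h2 := hz2 S δ fun k hk => by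
      by_contra h3
      exact Finset.disjoint_left.1 hS hk (h1.mem_toFinset.2 h3)
    refine h2.trans_lt ?_
    rw [hδ]
    calc (K : ℝ) * (ε / (2 * (K + 1))) = (K / (K + 1)) * (ε / 2) := by field_simp
      _ ≤ 1 * (ε / 2) := by
          gcongr
          rw [div_le_one (by positivity)]
          linarith
      _ < ε := by linarith
  obtain ⟨U, hU⟩ := exists_stft_distribution hφ g f
  have hrep : Represents A W.fourier (∑' k, z k) U := fun χ ψ => by
    refine ⟨evalDual eA χ, evalDual eB ψ, fun _ => rfl, fun _ => rfl, ?_⟩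
    rw [hU, integral_stft_mul_schwartzTensor hφ]
    have h3 : HasSum (fun k => z k (evalDual eA χ) (evalDual eB ψ))
        ((∑' k, z k) (evalDual eA χ) (evalDual eB ψ)) :=
      (hs.hasSum.mapL (ContinuousLinearMap.apply ℂ _ (evalDual eA χ))).mapL
        (ContinuousLinearMap.apply ℂ _ (evalDual eB ψ))
    exact (hasSum_mulD_pu hφ f _).unique (h3.congr_fun fun k => (hz3 k χ ψ).symm)
  have hmem : ∑' k, z k ∈ injTensor A W.fourier :=
    (Submodule.isClosed_topologicalClosure _).mem_of_tendsto hs.hasSum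
      (.of_forall fun S => Submodule.sum_mem _ fun n _ => hz1 n)
  have hnorm : ‖∑' k, z k‖ ≤ K * M :=
    le_of_tendsto (hs.hasSum.norm) (.of_forall fun S => hz2 S M fun k _ => hρM k)
  refine (iInf₂_le U hU).trans ((iInf_le _ (∑' k, z k)).trans ((iInf₂_le hmem hrep).trans ?_))
  rw [← ofReal_norm]
  refine (ENNReal.ofReal_le_ofReal hnorm).trans ?_
  rw [ENNReal.ofReal_mul (by positivity), ENNReal.ofReal_coe_nnreal, ENNReal.ofReal_coe_nnreal]
  gcongr
  simp

/-! ### A window that is invertible on the cube -/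

theorem fourierInv_schwartz_apply {d : ℕ} (ψ : 𝓢(Rd d, ℂ)) (w : Rd d) :
    (𝓕⁻ ψ) w = ∫ t, md w ψ t := by
  rw [SchwartzMap.fourierInv_coe, Real.fourierInv_eq']
  refine integral_congr_ae (.of_forall fun t => ?_)
  simp only [md_apply, character, smul_eq_mul]
  congr 2; push_cast; ring

theorem character_re_nonneg {d : ℕ} (x t : Rd d) (h : ‖t‖ * ‖x‖ ≤ 8⁻¹) : 0 ≤ (character x t).re := by
  have h1 : (2 * Real.pi * Complex.I * (inner ℝ t x : ℝ) : ℂ) =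
      ((2 * Real.pi * inner ℝ t x : ℝ) : ℂ) * Complex.I := by
    push_cast; ring
  rw [character, h1, Complex.exp_ofReal_mul_I_re]
  have h2 : |inner ℝ t x| ≤ 8⁻¹ := (abs_real_inner_le_norm t x).trans h
  have h3 := abs_le.1 h2
  have hpi := Real.pi_pos
  refine Real.cos_nonneg_of_mem_Icc ⟨?_, ?_⟩ <;> nlinarith

theorem character_zero_right {d : ℕ} (x : Rd d) : character x 0 = 1 := by
  simp [character]

theorem fourierInv_ne_zero_of_nonneg {d : ℕ} {H : 𝓢(Rd d, ℂ)} {h : Rd d → ℝ}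
    (hH : ∀ t, H t = (h t : ℂ)) (hc : HasCompactSupport h) (h0 : ∀ t, 0 ≤ h t) {ξ x : Rd d}
    (hξ : h ξ ≠ 0) (hx : ∀ t, h t ≠ 0 → ‖t - ξ‖ * ‖x‖ ≤ 8⁻¹) : (𝓕⁻ H) x ≠ 0 := by
  intro hzero
  rw [fourierInv_schwartz_apply] at hzero
  set Φ : 𝓢(Rd d, ℂ) := character x (-ξ) • md x H with hΦ
  have hval : ∀ t, (Φ t).re = (character x (t - ξ)).re * h t := fun t => by
    rw [hΦ, smul_apply, md_apply, hH, smul_eq_mul, sub_eq_add_neg, character_apply_add,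
      ← Complex.re_mul_ofReal]
    congr 1; ring
  have h1 : ∫ t, Φ t = 0 := by
    simp only [hΦ, smul_apply]
    rw [integral_smul, hzero, smul_zero]
  have h2 : ∫ t, (Φ t).re = 0 := by
    have h3 := Complex.reCLM.integral_comp_comm (Φ.integrable (μ := volume))
    rw [h1, map_zero] at h3
    exact h3
  have hpos : 0 < ∫ t, (Φ t).re := by
    refine Continuous.integral_pos_of_hasCompactSupport_nonneg_nonzero (x := ξ)
      (Complex.continuous_re.comp Φ.continuous) ?_ (fun t => ?_) ?_
    · rw [funext hval]
      exact hc.mul_left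
    · rw [hval]
      by_cases ht : h t = 0
      · rw [ht, mul_zero]; rfl
      · exact mul_nonneg (character_re_nonneg x (t - ξ) (hx t ht)) (h0 t)
    · rw [hval, sub_self, character_zero_right, Complex.one_re, one_mul]
      exact hξ
  exact hpos.ne' h2

theorem exists_fourier_ne_zero {d : ℕ} {G : 𝓢(Rd d, ℂ)} (hG : G ≠ 0) : ∃ ξ, (𝓕 G) ξ ≠ 0 := by
  by_contra h
  push Not at h
  refine hG ?_
  have h0 : 𝓕 G = 0 := by ext ξ; exact h ξ
  rw [← FourierTransform.fourierInv_fourier_eq (F := 𝓢(Rd d, ℂ)) G, h0]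
  exact map_zero (FourierTransform.fourierInvCLM ℂ 𝓢(Rd d, ℂ))

theorem conv_fourierInv {d : ℕ} (ψ G : 𝓢(Rd d, ℂ)) : conv (𝓕⁻ ψ) G = 𝓕⁻ (mulS ψ (𝓕 G)) := by
  rw [← FourierTransform.fourierInv_fourier_eq (F := 𝓢(Rd d, ℂ)) (conv (𝓕⁻ ψ) G), fourier_conv,
    FourierTransform.fourier_fourierInv_eq]

/-- The bump function as a Schwartz function. -/
def bumpS {d : ℕ} {ξ : Rd d} (β : ContDiffBump ξ) : 𝓢(Rd d, ℂ) :=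
  HasCompactSupport.toSchwartzMap (f := fun x => (β x : ℂ))
    (β.hasCompactSupport.comp_left (g := fun r : ℝ => (r : ℂ)) Complex.ofReal_zero)
    (Complex.ofRealCLM.contDiff.comp β.contDiff)

theorem bumpS_apply {d : ℕ} {ξ : Rd d} (β : ContDiffBump ξ) (t : Rd d) : bumpS β t = (β t : ℂ) := rfl

theorem exists_conv_ne_zero {d : ℕ} {G : 𝓢(Rd d, ℂ)} (hG : G ≠ 0) :
    ∃ ψ : 𝓢(Rd d, ℂ), ∀ x : Rd d, ‖x‖ ≤ d → conv ψ G x ≠ 0 := by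
  obtain ⟨ξ, hξ⟩ := exists_fourier_ne_zero hG
  obtain ⟨r, hr⟩ : ∃ r : ℝ, r = (8 * ((d : ℝ) + 1))⁻¹ := ⟨_, rfl⟩
  have hr0 : 0 < r := by rw [hr]; positivity
  obtain ⟨β, hβ⟩ : ∃ β : ContDiffBump ξ, β.rOut = r :=
    ⟨⟨r / 2, r, by linarith, by linarith⟩, rfl⟩
  refine ⟨𝓕⁻ (mulS (bumpS β) (conjS (𝓕 G))), fun x hx => ?_⟩
  rw [conv_fourierInv]
  set h : Rd d → ℝ := fun t => β t * ‖(𝓕 G) t‖ ^ 2 with hh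
  have h1 : ∀ t, mulS (mulS (bumpS β) (conjS (𝓕 G))) (𝓕 G) t = (h t : ℂ) := fun t => by
    rw [mulS_apply, mulS_apply, bumpS_apply, conjS_apply, mul_assoc, Complex.conj_mul', hh,
      Complex.ofReal_mul, Complex.ofReal_pow]
  have h2 : HasCompactSupport h := β.hasCompactSupport.mul_right
  have h3 : ∀ t, 0 ≤ h t := fun t => mul_nonneg β.nonneg (by positivity)
  have h4 : h ξ ≠ 0 := by
    rw [hh]
    simp only
    rw [β.one_of_mem_closedBall (Metric.mem_closedBall_self β.rIn_pos.le), one_mul]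
    exact pow_ne_zero _ (norm_ne_zero_iff.2 hξ)
  have h5 : ∀ t, h t ≠ 0 → ‖t - ξ‖ * ‖x‖ ≤ 8⁻¹ := fun t ht => by
    have h6 : t ∈ Metric.ball ξ r := by
      have h7 : t ∈ Function.support β := left_ne_zero_of_mul ht
      rwa [β.support_eq, hβ] at h7
    rw [mem_ball_iff_norm] at h6
    calc ‖t - ξ‖ * ‖x‖ ≤ r * (d + 1) := by
          gcongr
          linarith
      _ = 8⁻¹ := by rw [hr]; field_simp
  exact fourierInv_ne_zero_of_nonneg h1 h2 h3 h4 h5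

theorem exists_window_inverse {d : ℕ} {φ : Test d} (hφ : IsPartitionGenerator φ)
    {G : 𝓢(Rd d, ℂ)} (hG : G ≠ 0) : ∃ ψ κ : 𝓢(Rd d, ℂ),
      mulS κ (mulS (testToSchwartz φ) (conv ψ G)) = testToSchwartz φ := by
  obtain ⟨τ, hτ⟩ := exists_isCutoff hφ
  obtain ⟨ψ, hψ⟩ := exists_conv_ne_zero hG
  have hclosed : IsClosed {x : Rd d | ∀ i, |x i| ≤ 1} := by
    rw [Set.ofPred_forall]
    exact isClosed_iInter fun i => isClosed_le (by fun_prop) continuous_const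
  have hsupp : tsupport τ ⊆ {x : Rd d | ∀ i, |x i| ≤ 1} :=
    closure_minimal (fun x hx i => (hτ.supp x hx i).le) hclosed
  have hne : ∀ x ∈ tsupport τ, conv ψ G x ≠ 0 := fun x hx =>
    hψ x ((norm_le_card_of_abs_le (c := 1) x fun i => hsupp hx i).trans (by simp))
  have hcomp : HasCompactSupport τ := by
    refine HasCompactSupport.of_support_subset_isCompact
      (isCompact_closedBall (0 : Rd d) d) fun x hx => ?_
    rw [mem_closedBall_zero_iff]
    exact (norm_le_card_of_abs_le (c := 1) x fun i => (hτ.supp x hx i).le).trans (by simp)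
  have hcd : ContDiff ℝ ((⊤ : ℕ∞) : WithTop ℕ∞) fun x => τ x * (conv ψ G x)⁻¹ := by
    rw [contDiff_iff_contDiffAt]
    intro x
    by_cases hx : x ∈ tsupport τ
    · exact ((τ.smooth ⊤).contDiffAt).mul (((conv ψ G).smooth ⊤).contDiffAt.inv (hne x hx))
    · refine (contDiffAt_const (c := (0 : ℂ))).congr_of_eventuallyEq ?_
      filter_upwards [(isClosed_tsupport τ).isOpen_compl.mem_nhds hx] with y hy
      rw [image_eq_zero_of_notMem_tsupport hy, zero_mul]
  let κ : 𝓢(Rd d, ℂ) := HasCompactSupport.toSchwartzMap (f := fun x => τ x * (conv ψ G x)⁻¹)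
    hcomp.mul_right hcd
  refine ⟨ψ, κ, ?_⟩
  ext x
  rw [mulS_apply, mulS_apply]
  change τ x * (conv ψ G x)⁻¹ * (testToSchwartz φ x * conv ψ G x) = testToSchwartz φ x
  by_cases hx : φ x = 0
  · rw [testToSchwartz_apply, hx]; simp
  · have h1 : τ x = 1 := hτ.one x (subset_tsupport _ hx)
    have h2 : x ∈ tsupport τ := subset_tsupport _ (by rw [Function.mem_support, h1]; exact one_ne_zero)
    rw [h1]
    field_simp [hne x h2]

/-! ### The modulation space is contained in the amalgam space -/

theorem DistSpace.enorm_zero_carrier {d : ℕ} (E : DistSpace d) : ‖(0 : E.Carrier)‖ₑ = 0 := by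
  rw [E.enorm_eq, map_zero, E.eNorm_zero]

theorem DistSpace.enorm_add_carrier_le {d : ℕ} (E : DistSpace d) (a b : E.Carrier) :
    ‖a + b‖ₑ ≤ ‖a‖ₑ + ‖b‖ₑ := by
  rw [E.enorm_eq, E.enorm_eq, E.enorm_eq, map_add]
  exact E.add_le _ _

/-- The algebraic tensor product. -/
abbrev algTensor {d : ℕ} (A B : DistSpace d) :
    Submodule ℂ (StrongDual ℂ A.Carrier →L[ℂ] StrongDual ℂ B.Carrier →L[ℂ] ℂ) :=
  Submodule.span ℂ (Set.range fun ab : A.Carrier × B.Carrier => elementaryTensor A B ab.1 ab.2)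

/-- The partial evaluations of an element of the algebraic tensor product. -/
theorem exists_slices {d : ℕ} {A B : DistSpace d} {η : Rd d → ℝ}
    (s : (Fin d → ℤ) → StrongDual ℂ A.Carrier)
    (hs : ∀ a, Tendsto (fun k => ‖s k a‖ₑ * latW η k) cofinite (𝓝 0))
    {v : StrongDual ℂ A.Carrier →L[ℂ] StrongDual ℂ B.Carrier →L[ℂ] ℂ} (hv : v ∈ algTensor A B) :
    ∃ b : (Fin d → ℤ) → B.Carrier, (∀ k b', v (s k) b' = b' (b k)) ∧
      Tendsto (fun k => ‖b k‖ₑ * latW η k) cofinite (𝓝 0) := by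
  induction hv using Submodule.span_induction with
  | mem v hv =>
    obtain ⟨⟨a, b⟩, rfl⟩ := hv
    refine ⟨fun k => s k a • b, fun k b' => ?_, ?_⟩
    · rw [elementaryTensor_apply, map_smul, smul_eq_mul]
    · have h := ENNReal.Tendsto.mul_const (b := ‖b‖ₑ) (hs a) (Or.inr enorm_ne_top)
      rw [zero_mul] at h
      refine h.congr fun k => ?_
      rw [enorm_smul]; ring
  | zero => exact ⟨0, fun k b' => by simp, by
      simp only [Pi.zero_apply, B.enorm_zero_carrier, zero_mul]
      exact tendsto_const_nhds⟩
  | add v w _ _ hv hw =>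
    obtain ⟨b, hb, hb'⟩ := hv
    obtain ⟨c, hc, hc'⟩ := hw
    refine ⟨b + c, fun k b' => ?_, ?_⟩
    · rw [add_apply, add_apply, hb, hc, Pi.add_apply, map_add]
    · have h := hb'.add hc'
      rw [add_zero] at h
      refine tendsto_of_tendsto_of_tendsto_of_le_of_le tendsto_const_nhds h (fun _ => zero_le)
        fun k => ?_
      simp only [Pi.add_apply]
      rw [← add_mul]
      gcongr
      exact B.enorm_add_carrier_le _ _
  | smul c v _ hv =>
    obtain ⟨b, hb, hb'⟩ := hv
    refine ⟨c • b, fun k b' => ?_, ?_⟩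
    · rw [smul_apply, smul_apply, hb, Pi.smul_apply, map_smul]
    · have h := ENNReal.Tendsto.const_mul (a := ‖c‖ₑ) hb' (Or.inr enorm_ne_top)
      rw [mul_zero] at h
      refine h.congr fun k => ?_
      rw [Pi.smul_apply, enorm_smul, mul_assoc]

theorem exists_slice {d : ℕ} {A B : DistSpace d} (a' : StrongDual ℂ A.Carrier)
    {v : StrongDual ℂ A.Carrier →L[ℂ] StrongDual ℂ B.Carrier →L[ℂ] ℂ} (hv : v ∈ algTensor A B) :
    ∃ b : B.Carrier, ∀ b', v a' b' = b' b := by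
  induction hv using Submodule.span_induction with
  | mem v hv =>
    obtain ⟨⟨a, b⟩, rfl⟩ := hv
    exact ⟨a' a • b, fun b' => by rw [elementaryTensor_apply, map_smul, smul_eq_mul]⟩
  | zero => exact ⟨0, fun b' => by simp⟩
  | add v w _ _ hv hw =>
    obtain ⟨b, hb⟩ := hv
    obtain ⟨c, hc⟩ := hw
    exact ⟨b + c, fun b' => by rw [add_apply, add_apply, hb, hc, map_add]⟩
  | smul c v _ hv =>
    obtain ⟨b, hb⟩ := hv
    exact ⟨c • b, fun b' => by rw [smul_apply, smul_apply, hb, map_smul]⟩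

theorem norm_slice_le {d : ℕ} {A B : DistSpace d} {a' : StrongDual ℂ A.Carrier}
    {v : StrongDual ℂ A.Carrier →L[ℂ] StrongDual ℂ B.Carrier →L[ℂ] ℂ} {b : B.Carrier}
    (hb : ∀ b', v a' b' = b' b) : ‖b‖ ≤ ‖v‖ * ‖a'‖ :=
  NormedSpace.norm_le_dual_bound ℂ b (by positivity) fun b' => by
    rw [← hb]; exact v.le_opNorm₂ a' b'

theorem IsAmalgam.exists_eNorm_slice_le {d : ℕ} {W E : DistSpace d} {φ : Test d} {η : Rd d → ℝ}
    {p : ℝ≥0∞} (hW : IsAmalgam W E φ η p) (hη : IsPolyWeight η) (hE : E.IsTMIB)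
    (eB : HasBoundedEval W.fourier) (A : DistSpace d) : ∃ C : ℝ≥0,
    ∀ z ∈ injTensor A W.fourier, ∀ v ∈ algTensor A W.fourier, ∀ (a' : StrongDual ℂ A.Carrier)
      (D : 𝓢'(Rd d, ℂ)) (b : W.fourier.Carrier), (∀ ψ, z a' (evalDual eB ψ) = D (𝓕 ψ)) →
      (∀ b', v a' b' = b' b) → ∀ k,
      ampl E φ η D k ≤ C * (‖b‖ₑ + ‖z - v‖ₑ * ‖a'‖ₑ) := by
  obtain ⟨C, hC⟩ := hW.exists_ampl_le
  refine ⟨C, fun z hz v hv a' D b hD hb k => ?_⟩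
  have hηk : 0 < η (latticePoint k) := hη.pos _
  set c : ℝ := C / η (latticePoint k) with hc
  have hc0 : 0 ≤ c := by positivity
  have hloc : ∀ e : W.fourier.Carrier,
      E.eNorm (mulD (pu φ k) (𝓕⁻ (W.fourier.incl e))) ≤ ENNReal.ofReal (c * ‖e‖) := fun e => by
    have h1 := hC (𝓕⁻ (W.fourier.incl e)) k
    have h2 : W.eNorm (𝓕⁻ (W.fourier.incl e)) = ‖e‖ₑ := (W.fourier.enorm_eq e).symm
    rw [h2, ampl] at h1
    have h3 := (ENNReal.le_div_iff_mul_le (Or.inl (hη.latW_ne_zero k))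
      (Or.inl (latW_ne_top η k))).2 h1
    refine h3.trans (le_of_eq ?_)
    rw [latW, ← ofReal_norm, ← ENNReal.ofReal_coe_nnreal, ← ENNReal.ofReal_mul (by positivity),
      ← ENNReal.ofReal_div_of_pos hηk, hc]
    congr 1
    ring
  have hex : ∀ m : ℕ, ∃ w ∈ algTensor A W.fourier, ‖z - w‖ ≤ 1 / ((m : ℝ) + 1) := fun m => by
    obtain ⟨w, hw, hd⟩ := Metric.mem_closure_iff.1 hz (1 / ((m : ℝ) + 1)) (by positivity)
    exact ⟨w, hw, by rw [← dist_eq_norm]; exact hd.le⟩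
  choose w hw hwz using hex
  choose e he using fun m => exists_slice a' (hw m)
  have hte : Tendsto (fun m : ℕ => 1 / ((m : ℝ) + 1)) atTop (𝓝 0) :=
    tendsto_one_div_add_atTop_nhds_zero_nat
  have htw : Tendsto w atTop (𝓝 z) := by
    rw [tendsto_iff_norm_sub_tendsto_zero]
    refine squeeze_zero (fun _ => norm_nonneg _) (fun m => ?_) hte
    rw [norm_sub_rev]; exact hwz m
  set x : ℕ → 𝓢'(Rd d, ℂ) := fun m => mulD (pu φ k) (𝓕⁻ (W.fourier.incl (e m))) with hx
  have hδt : Tendsto (fun m : ℕ => c * (2 * (1 / ((m : ℝ) + 1)) * ‖a'‖)) atTop (𝓝 0) := by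
    simpa using ((hte.const_mul 2).mul_const ‖a'‖).const_mul c
  have hlim := hE.eNorm_sub_le_of_cauchy x (mulD (pu φ k) D) (fun ψ => ?_)
    (fun m => (hloc (e m)).trans_lt ENNReal.ofReal_lt_top)
    (fun m => c * (2 * (1 / ((m : ℝ) + 1)) * ‖a'‖)) hδt (fun m n hmn => ?_)
  · have hfin : ∀ m : ℕ, E.eNorm (mulD (pu φ k) D) ≤ ENNReal.ofReal
        (c * (‖b‖ + (‖z - v‖ + 1 / ((m : ℝ) + 1)) * ‖a'‖) +
          c * (2 * (1 / ((m : ℝ) + 1)) * ‖a'‖)) := fun m => by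
      have h4 : mulD (pu φ k) D = x m + -(x m - mulD (pu φ k) D) := by abel
      rw [h4, ENNReal.ofReal_add (by positivity) (by positivity)]
      refine (E.add_le _ _).trans (add_le_add ((hloc (e m)).trans (ENNReal.ofReal_le_ofReal ?_)) ?_)
      · gcongr
        have h5 : ‖e m - b‖ ≤ ‖w m - v‖ * ‖a'‖ := norm_slice_le fun b' => by
          rw [sub_apply, sub_apply, he, hb, map_sub]
        have h6 : ‖w m - v‖ ≤ ‖z - v‖ + 1 / ((m : ℝ) + 1) := by
          rw [show w m - v = (z - v) - (z - w m) by abel]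
          exact (norm_sub_le _ _).trans (by gcongr; exact hwz m)
        calc ‖e m‖ = ‖b + (e m - b)‖ := by congr 1; abel
          _ ≤ ‖b‖ + ‖e m - b‖ := norm_add_le _ _
          _ ≤ _ := by gcongr; exact h5.trans (by gcongr)
      · rw [E.eNorm_neg]; exact hlim m
    have h7 : Tendsto (fun m : ℕ => ENNReal.ofReal
        (c * (‖b‖ + (‖z - v‖ + 1 / ((m : ℝ) + 1)) * ‖a'‖) +
          c * (2 * (1 / ((m : ℝ) + 1)) * ‖a'‖))) atTop
        (𝓝 (ENNReal.ofReal (c * (‖b‖ + ‖z - v‖ * ‖a'‖)))) := by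
      refine ENNReal.tendsto_ofReal ?_
      have h8 := (((hte.const_add ‖z - v‖).mul_const ‖a'‖).const_add ‖b‖).const_mul c
      simpa using h8.add hδt
    have h9 := ge_of_tendsto' h7 hfin
    rw [ampl]
    refine (mul_le_mul_left h9 _).trans (le_of_eq ?_)
    rw [latW, ← ofReal_norm, ← ofReal_norm, ← ofReal_norm, ← ENNReal.ofReal_mul (by positivity),
      ← ENNReal.ofReal_mul (by positivity), ← ENNReal.ofReal_add (by positivity) (by positivity),
      ← ENNReal.ofReal_coe_nnreal, ← ENNReal.ofReal_mul (by positivity), hc]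
    congr 1
    field_simp
  · have h10 : ∀ m, x m ψ = w m a' (evalDual eB (𝓕⁻ (mulS (pu φ k) ψ))) := fun m => by
      rw [he, evalDual_apply]
      rfl
    have h11 : (mulD (pu φ k) D) ψ = z a' (evalDual eB (𝓕⁻ (mulS (pu φ k) ψ))) := by
      rw [hD, FourierTransform.fourier_fourierInv_eq, mulD_apply]
    rw [h11]
    simp only [h10]
    have hcont : Continuous fun u : StrongDual ℂ A.Carrier →L[ℂ]
        StrongDual ℂ W.fourier.Carrier →L[ℂ] ℂ =>
        u a' (evalDual eB (𝓕⁻ (mulS (pu φ k) ψ))) := by fun_prop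
    exact (hcont.tendsto z).comp htw
  · have h12 : x m - x n = mulD (pu φ k) (𝓕⁻ (W.fourier.incl (e m - e n))) := by
      simp only [hx]
      rw [← map_sub, map_sub W.fourier.incl]
      rfl
    rw [h12]
    refine (hloc _).trans (ENNReal.ofReal_le_ofReal ?_)
    have h13 : ‖e m - e n‖ ≤ ‖w m - w n‖ * ‖a'‖ := norm_slice_le fun b' => by
      rw [sub_apply, sub_apply, he, he, map_sub]
    have h14 : ‖w m - w n‖ ≤ 2 * (1 / ((m : ℝ) + 1)) := by
      rw [show w m - w n = (z - w n) - (z - w m) by abel]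
      refine (norm_sub_le _ _).trans ?_
      have h15 : 1 / ((n : ℝ) + 1) ≤ 1 / ((m : ℝ) + 1) := by gcongr
      linarith [hwz m, hwz n]
    gcongr
    exact h13.trans (by gcongr)

theorem IsAmalgam.exists_enorm_evalDual_tr_le {d : ℕ} {A F : DistSpace d} {φ : Test d}
    {η : Rd d → ℝ} {p : ℝ≥0∞} (hA : IsAmalgam A F φ η p) (hF : F.IsTMIB)
    (hω : ∀ x, F.omega x = 1) (hφ : IsPartitionGenerator φ) (hη : IsPolyWeight η)
    (eA : HasBoundedEval A) (ψ : 𝓢(Rd d, ℂ)) : ∃ C : ℝ≥0, ∀ k : Fin d → ℤ,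
      ‖evalDual eA (tr (latticePoint k) ψ)‖ₑ * latW η k ≤ C := by
  obtain ⟨m, C, hC, h⟩ := hA.exists_enorm_apply_tr_le hF hφ hη
  refine ⟨Real.toNNReal (C * SN m ψ), fun k => ?_⟩
  have hηk : 0 < η (latticePoint k) := hη.pos _
  have h1 : ‖evalDual eA (tr (latticePoint k) ψ)‖ ≤ C * SN m ψ / η (latticePoint k) := by
    refine ContinuousLinearMap.opNorm_le_bound _ (by positivity) fun a => ?_
    have h2 := h k (fun e => eNorm_translate_le_of_omega_eq_one hF hω _ e) (A.incl a) ψ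
    rw [← A.enorm_eq, ← ofReal_norm, ← ofReal_norm, latW, ← ENNReal.ofReal_mul (by positivity),
      ← ENNReal.ofReal_mul (by positivity)] at h2
    have h3 := (ENNReal.ofReal_le_ofReal_iff (by positivity)).1 h2
    rw [evalDual_apply, div_mul_eq_mul_div, le_div_iff₀ hηk]
    exact h3
  rw [← ofReal_norm, latW, ← ENNReal.ofReal_mul (by positivity)]
  refine ENNReal.ofReal_le_ofReal ?_
  rwa [le_div_iff₀ hηk] at h1

/-- The embedding of the modulation space into the amalgam space. -/
theorem exists_ampl_le_of_represents {d : ℕ} {A W E F : DistSpace d} {φ : Test d}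
    {η₁ η₂ : Rd d → ℝ} {p q : ℝ≥0∞} (hA : IsAmalgam A F φ η₁ p) (hW : IsAmalgam W E φ η₂ q)
    (hE : E.IsTMIB) (hF : F.IsTMIB) (hω : ∀ x, F.omega x = 1)
    (hφ : IsPartitionGenerator φ) (hη₁ : IsPolyWeight η₁) (hη₂ : IsPolyWeight η₂)
    (eA : HasBoundedEval A) (eB : HasBoundedEval W.fourier) {G : 𝓢(Rd d, ℂ)} (hG : G ≠ 0) :
    ∃ C : ℝ≥0, ∀ f : 𝓢'(Rd d, ℂ), ∀ z ∈ injTensor A W.fourier,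
      (∀ χ ψ, z (evalDual eA χ) (evalDual eB ψ) = f (mulS (conv χ G) (𝓕 ψ))) →
      (∀ k, ampl E φ (fun x => η₁ x * η₂ x) f k ≤ C * ‖z‖ₑ) ∧
      Tendsto (ampl E φ (fun x => η₁ x * η₂ x) f) cofinite (𝓝 0) := by
  obtain ⟨τ, hτ⟩ := exists_isCutoff hφ
  obtain ⟨χ, κ, hκ⟩ := exists_window_inverse hφ hG
  obtain ⟨m, C₁, hC₁, h₁⟩ := hE.exists_eNorm_mulD_le hφ hτ
  obtain ⟨C₂, h₂⟩ := hW.exists_eNorm_slice_le hη₂ hE eB A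
  obtain ⟨C₃, h₃⟩ := hA.exists_enorm_evalDual_tr_le hF hω hφ hη₁ eA χ
  set s : (Fin d → ℤ) → StrongDual ℂ A.Carrier := fun k => evalDual eA (tr (latticePoint k) χ)
  have hs : ∀ a, Tendsto (fun k => ‖s k a‖ₑ * latW η₁ k) cofinite (𝓝 0) := fun a =>
    hA.tendsto_enorm_apply_tr hF hφ hη₁
      (fun k e => eNorm_translate_le_of_omega_eq_one hF hω _ e) (A.eNorm_incl_lt_top a) χ
  let K : ℝ≥0 := Real.toNNReal (C₁ * SN m (mulS τ κ)) * C₂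
  have key : ∀ f : 𝓢'(Rd d, ℂ), ∀ z ∈ injTensor A W.fourier,
      (∀ χ ψ, z (evalDual eA χ) (evalDual eB ψ) = f (mulS (conv χ G) (𝓕 ψ))) →
      ∀ v ∈ algTensor A W.fourier, ∀ b : (Fin d → ℤ) → W.fourier.Carrier,
      (∀ k b', v (s k) b' = b' (b k)) → ∀ k, ampl E φ (fun x => η₁ x * η₂ x) f k ≤
        K * (‖b k‖ₑ * latW η₁ k + C₃ * ‖z - v‖ₑ) := by
    intro f z hz hf v hv b hb k
    set D := mulD (tr (latticePoint k) (conv χ G)) f with hD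
    have h4 : mulD (pu φ k) f = mulD (tr (latticePoint k) κ) (mulD (pu φ k) D) := by
      rw [hD, mulD_mulD (pu φ k), mulD_mulD, pu, ← tr_mulS, ← tr_mulS, hκ]
    have h5 : E.eNorm (mulD (pu φ k) f) ≤
        Real.toNNReal (C₁ * SN m (mulS τ κ)) * E.eNorm (mulD (pu φ k) D) := by
      rw [h4]
      exact h₁ κ (latticePoint k) D
    have h6 := h₂ z hz v hv (s k) D (b k) (fun ψ => by
      rw [hf, hD, mulD_apply, ← tr_conv]) (hb k) k
    rw [ampl_mul E φ hη₁]
    calc latW η₁ k * ampl E φ η₂ f k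
        ≤ latW η₁ k * (Real.toNNReal (C₁ * SN m (mulS τ κ)) * ampl E φ η₂ D k) := by
          gcongr
          rw [ampl, ampl, ← mul_assoc]
          gcongr
      _ ≤ latW η₁ k * (Real.toNNReal (C₁ * SN m (mulS τ κ)) *
          (C₂ * (‖b k‖ₑ + ‖z - v‖ₑ * ‖s k‖ₑ))) := by gcongr
      _ = K * (‖b k‖ₑ * latW η₁ k + (‖s k‖ₑ * latW η₁ k) * ‖z - v‖ₑ) := by
          simp only [K]; push_cast; ring
      _ ≤ _ := by
          gcongr
          exact h₃ k
  refine ⟨K * C₃, fun f z hz hf => ⟨fun k => ?_, ?_⟩⟩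
  · have h7 := key f z hz hf 0 (Submodule.zero_mem _) 0 (fun k b' => by simp) k
    rw [Pi.zero_apply, W.fourier.enorm_zero_carrier, zero_mul, zero_add, sub_zero] at h7
    rw [ENNReal.coe_mul, mul_assoc]
    exact h7
  · rw [ENNReal.tendsto_nhds_zero]
    intro ε hε
    set θ : ℝ≥0∞ := ε / ((K + 1) * (1 + C₃)) with hθ
    have hden : ((K : ℝ≥0∞) + 1) * (1 + C₃) ≠ ∞ :=
      ENNReal.mul_ne_top (by simp) (by simp)
    have hθ0 : 0 < θ := ENNReal.div_pos hε.ne' hden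
    obtain ⟨v, hv, hvz⟩ := EMetric.mem_closure_iff.1 hz θ hθ0
    rw [edist_eq_enorm_sub] at hvz
    obtain ⟨b, hb, hbt⟩ := exists_slices s hs hv
    filter_upwards [ENNReal.tendsto_nhds_zero.1 hbt θ hθ0] with k hk
    refine (key f z hz hf v hv b hb k).trans ?_
    calc (K : ℝ≥0∞) * (‖b k‖ₑ * latW η₁ k + C₃ * ‖z - v‖ₑ)
        ≤ (K + 1) * (θ + C₃ * θ) := by
          gcongr
          simp
      _ = ((K + 1) * (1 + C₃)) * θ := by ring
      _ ≤ ε := ENNReal.mul_div_le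

theorem conjS_ne_zero {d : ℕ} {g : 𝓢(Rd d, ℂ)} (hg : g ≠ 0) : conjS g ≠ 0 := by
  intro h
  refine hg ?_
  ext x
  have h1 := congrArg (fun θ : 𝓢(Rd d, ℂ) => θ x) h
  simp only [conjS_apply] at h1
  exact (map_eq_zero_iff _ (starRingEnd ℂ).injective).1 h1

theorem exists_le_modulationENorm {d : ℕ} {A W E F : DistSpace d} {φ : Test d}
    {η₁ η₂ : Rd d → ℝ} {p q : ℝ≥0∞} (hA : IsAmalgam A F φ η₁ p) (hW : IsAmalgam W E φ η₂ q)
    (hE : E.IsTMIB) (hF : F.IsTMIB) (hω : ∀ x, F.omega x = 1)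
    (hφ : IsPartitionGenerator φ) (hη₁ : IsPolyWeight η₁) (hη₂ : IsPolyWeight η₂)
    {g : 𝓢(Rd d, ℂ)} (hg : g ≠ 0) : ∃ C : ℝ≥0, ∀ f : 𝓢'(Rd d, ℂ),
      amalgamZeroENorm E φ (fun x => η₁ x * η₂ x) (restr f) ≤
        C * modulationENorm g (injTensorENorm A W.fourier) f := by
  have eA := hA.hasBoundedEval hF hφ hη₁
  have eB := (hW.hasBoundedEval hE hφ hη₂).fourier
  obtain ⟨C₁, h₁⟩ := exists_ampl_le_of_represents hA hW hE hF hω hφ hη₁ hη₂ eA eB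
    (conjS_ne_zero hg)
  obtain ⟨C₂, h₂⟩ := (isAmalgam_amalgamZero hE hφ (hη₁.mul hη₂)).le_lpN
  refine ⟨C₂ * C₁ + 1, fun f => ?_⟩
  rw [← ENNReal.div_le_iff' (by simp) ENNReal.coe_ne_top]
  refine le_iInf₂ fun U hU => le_iInf fun z => le_iInf₂ fun hz hrep => ?_
  rw [ENNReal.div_le_iff' (by simp) ENNReal.coe_ne_top]
  obtain ⟨h₃, h₄⟩ := h₁ f z hz fun χ ψ => by
    obtain ⟨a', b', ha, hb, hval⟩ := hrep χ ψ
    have e₁ : a' = evalDual eA χ := ContinuousLinearMap.ext ha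
    have e₂ : b' = evalDual eB ψ := ContinuousLinearMap.ext hb
    rw [← e₁, ← e₂, ← hval, hU, integral_stft_mul_schwartzTensor hφ]
  calc amalgamZeroENorm E φ (fun x => η₁ x * η₂ x) (restr f)
      ≤ C₂ * lpN ∞ (ampl E φ (fun x => η₁ x * η₂ x) f) := h₂ f h₄
    _ ≤ C₂ * (C₁ * ‖z‖ₑ) := by
        gcongr
        rw [lpN_top]
        exact iSup_le h₃
    _ = ((C₂ * C₁ : ℝ≥0) : ℝ≥0∞) * ‖z‖ₑ := by push_cast; ring
    _ ≤ _ := by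
        gcongr
        simp

theorem equalWithEquivalentNorms_of_isAmalgam {d : ℕ} {A W E F : DistSpace d} {φ : Test d}
    {η₁ η₂ : Rd d → ℝ} {p q : ℝ≥0∞} (hA : IsAmalgam A F φ η₁ p) (hW : IsAmalgam W E φ η₂ q)
    (hpq : p⁻¹ + q⁻¹ ≤ 1) (hE : E.IsTMIB) (hF : F.IsTMIB) (hω : ∀ x, F.omega x = 1)
    (hφ : IsPartitionGenerator φ) (hη₁ : IsPolyWeight η₁) (hη₂ : IsPolyWeight η₂)
    {g : 𝓢(Rd d, ℂ)} (hg : g ≠ 0) :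
    EqualWithEquivalentNorms (amalgamZeroENorm E φ (fun x => η₁ x * η₂ x))
      (modulationENorm g (injTensorENorm A W.fourier)) := by
  have hη := hη₁.mul hη₂
  have hN := isAmalgamNorm_amalgamZeroENorm E φ hη
  have hZ := isAmalgam_amalgamZero hE hφ hη
  obtain ⟨C₁, h₁⟩ := exists_le_modulationENorm hA hW hE hF hω hφ hη₁ hη₂ hg
  obtain ⟨C₂, h₂⟩ := exists_modulationENorm_le hA hW hpq hE hF hω hφ hη₁ hη₂ g
  obtain ⟨C₃, h₃⟩ := hZ.lpN_le
  have hup : ∀ f, modulationENorm g (injTensorENorm A W.fourier) f ≤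
      ((C₂ * C₃ + 1 : ℝ≥0) : ℝ≥0∞) * amalgamZeroENorm E φ (fun x => η₁ x * η₂ x) (restr f) := by
    intro f
    by_cases hf : amalgamZeroENorm E φ (fun x => η₁ x * η₂ x) (restr f) < ∞
    · calc modulationENorm g (injTensorENorm A W.fourier) f
          ≤ C₂ * lpN ∞ (ampl E φ (fun x => η₁ x * η₂ x) f) := h₂ f (hZ.tendsto f hf)
        _ ≤ C₂ * (C₃ * amalgamZeroENorm E φ (fun x => η₁ x * η₂ x) (restr f)) := by
            gcongr
            exact h₃ f
        _ = ((C₂ * C₃ : ℝ≥0) : ℝ≥0∞) *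
            amalgamZeroENorm E φ (fun x => η₁ x * η₂ x) (restr f) := by push_cast; ring
        _ ≤ _ := by
            gcongr
            simp
    · rw [not_lt_top_iff.1 hf, ENNReal.mul_top (by simp)]
      exact le_top
  refine ⟨fun u => ⟨fun hu => ?_, ?_⟩, max C₁ (C₂ * C₃ + 1), fun f => ⟨?_, ?_⟩⟩
  · obtain ⟨f, rfl⟩ := hN.exists_restr_eq hE hφ hη hu
    exact ⟨f, rfl, (hup f).trans_lt (ENNReal.mul_lt_top ENNReal.coe_lt_top hu)⟩
  · rintro ⟨f, rfl, hf⟩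
    exact (h₁ f).trans_lt (ENNReal.mul_lt_top ENNReal.coe_lt_top hf)
  · refine (h₁ f).trans (mul_le_mul_left ?_ _)
    exact_mod_cast le_max_left _ _
  · refine (hup f).trans (mul_le_mul_left ?_ _)
    exact_mod_cast le_max_right _ _

end

end TMIB

theorem mainTheorem2 {d : ℕ} (E F : TMIB.DistSpace d) (hE : E.IsTMIB) (hF : F.IsTMIB)
    (η₁ η₂ : TMIB.Rd d → ℝ) (hη₁ : TMIB.IsPolyWeight η₁) (hη₂ : TMIB.IsPolyWeight η₂)
    (hω : ∀ x, F.omega x = 1)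
    (φ : TMIB.Test d) (hφ : TMIB.IsPartitionGenerator φ)
    (g : 𝓢(TMIB.Rd d, ℂ)) (hg : g ≠ 0) :
    (∀ (p₁ p₂ : ℝ≥0∞) (hp₁ : 1 < p₁) (_ : p₁ < ∞) (hp₂ : 1 < p₂) (_ : p₂ < ∞),
      p₁⁻¹ + p₂⁻¹ ≤ 1 →
      TMIB.EqualWithEquivalentNorms
        (TMIB.amalgamZeroENorm E φ (fun x => η₁ x * η₂ x))
        (TMIB.modulationENorm g (TMIB.injTensorENorm
          (TMIB.amalgam F φ η₁ hη₁ p₁ hp₁.le) (TMIB.amalgam E φ η₂ hη₂ p₂ hp₂.le).fourier))) ∧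
    (∀ (p₂ : ℝ≥0∞) (hp₂ : 1 ≤ p₂) (_ : p₂ < ∞),
      TMIB.EqualWithEquivalentNorms
        (TMIB.amalgamZeroENorm E φ (fun x => η₁ x * η₂ x))
        (TMIB.modulationENorm g (TMIB.injTensorENorm
          (TMIB.amalgamZero F φ η₁ hη₁) (TMIB.amalgam E φ η₂ hη₂ p₂ hp₂).fourier))) ∧
    (∀ (p₁ : ℝ≥0∞) (hp₁ : 1 ≤ p₁) (_ : p₁ < ∞),
      TMIB.EqualWithEquivalentNorms
        (TMIB.amalgamZeroENorm E φ (fun x => η₁ x * η₂ x))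
        (TMIB.modulationENorm g (TMIB.injTensorENorm
          (TMIB.amalgam F φ η₁ hη₁ p₁ hp₁) (TMIB.amalgamZero E φ η₂ hη₂).fourier))) ∧
    TMIB.EqualWithEquivalentNorms
      (TMIB.amalgamZeroENorm E φ (fun x => η₁ x * η₂ x))
      (TMIB.modulationENorm g (TMIB.injTensorENorm
        (TMIB.amalgamZero F φ η₁ hη₁) (TMIB.amalgamZero E φ η₂ hη₂).fourier)) := by
  refine ⟨fun p₁ p₂ hp₁ hp₁' hp₂ hp₂' hpq => ?_, fun p₂ hp₂ hp₂' => ?_, fun p₁ hp₁ hp₁' => ?_, ?_⟩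
  · exact TMIB.equalWithEquivalentNorms_of_isAmalgam
      (TMIB.isAmalgam_amalgam hF hφ hη₁ hp₁.le hp₁'.ne)
      (TMIB.isAmalgam_amalgam hE hφ hη₂ hp₂.le hp₂'.ne) hpq hE hF hω hφ hη₁ hη₂ hg
  · exact TMIB.equalWithEquivalentNorms_of_isAmalgam (TMIB.isAmalgam_amalgamZero hF hφ hη₁)
      (TMIB.isAmalgam_amalgam hE hφ hη₂ hp₂ hp₂'.ne) (by simpa using hp₂) hE hF hω hφ hη₁ hη₂ hg
  · exact TMIB.equalWithEquivalentNorms_of_isAmalgam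
      (TMIB.isAmalgam_amalgam hF hφ hη₁ hp₁ hp₁'.ne) (TMIB.isAmalgam_amalgamZero hE hφ hη₂)
      (by simpa using hp₁) hE hF hω hφ hη₁ hη₂ hg
  · exact TMIB.equalWithEquivalentNorms_of_isAmalgam (TMIB.isAmalgam_amalgamZero hF hφ hη₁)
      (TMIB.isAmalgam_amalgamZero hE hφ hη₂) (by simp) hE hF hω hφ hη₁ hη₂ hg
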